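/- Let $k\ge 1$. There are $n$ applicants with independent values $V_i\ge 0$, $V_i\sim F_i$, arriving in a uniformly random order; at most $k$ of them can be accepted. A static threshold policy $(t,p)$, with $t\ge 0$ and $p\in[0,1]$, declares applicant $i$ eligible if $V_i>t$, and with probability $p$ (independently of everything else) if $V_i=t$; it accepts the first $k$ eligible applicants (all of them if there are fewer than $k$). Its expected demand is the expected number of eligible applicants, its performance is the expected sum of the accepted values, and the prophet's value is the expected sum of the $k$ largest values. Put $\gamma_k=1-e^{-k}k^k/k!$. **Theorem.** (1) On every instance, the performance of every static threshold policy whose expected demand equals $k$ is at least $\min\{\gamma_k,\frac{k}{k+1}\}$ times the prophet's value. This minimum is $\frac{k}{k+1}$ if $k\le 4$ and $\gamma_k$ if $k>4$. (2) The bound in (1) is tight: if for some $c\in\mathbb R$ every static threshold policy with expected demand $k$ has performance at least $c$ times the prophet's value on every instance with $n>k$, then $c\le\min\{\gamma_k,\frac{k}{k+1}\}$. This is witnessed by two families of examples. * *Example 1.* The $n$ values are i.i.d., equal to $nW_k$ with probability $1/n^2$ and to $1$ with probability $1-1/n^2$, where $W_k=k\,\frac{P(\mathrm{Pois}(k)<k)}{P(\mathrm{Pois}(k)>k)}$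 and $\mathrm{Pois}(k)$ is a Poisson variable with mean $k$. For every $\delta>0$ and all sufficiently large $n$, a policy with expected demand $k$ exists, and every static threshold policy (whatever its expected demand) has performance less than $\gamma_k+\delta$ times the prophet's value. * *Example 2.* There are $k+1$ applicants; each of the first $k$ has value $1$ with probability $1-\varepsilon/k$ and $0$ otherwise, and the last has value $1/\varepsilon^2$ with probability $\varepsilon$ and $0$ otherwise. For every $\delta>0$ and all sufficiently small $\varepsilon>0$, the policy $(t,p)=(0,0)$ has expected demand $k$, and every static threshold policy with expected demand $k$ has performance less than $\frac{k}{k+1}+\delta$ times the prophet's value. (3) For $k>4$ the bound is optimal among static threshold policies: if $c\in\mathbb R$ is such that on every instance with $n>k$ some static threshold policy has performance at least $c$ times the prophet's value, then $c\le\min\{\gamma_k,\frac{k}{k+1}\}=\gamma_k$. -/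

import Mathlib

open MeasureTheory ProbabilityTheory Filter
open scoped NNReal ENNReal unitInterval

noncomputable section

namespace ProphetSecretary

/-- A static threshold policy with tie-breaking: a threshold `t ≥ 0` and a probability `p` with
which a value exactly equal to `t` is considered eligible.  `p = 0` is the policy which accepts
only values strictly exceeding `t`. -/
structure Policy where
  t : ℝ≥0
  p : I

/-- What the policy sees of one applicant: the value, drawn from `μ`, and an independent
tie-breaking coin, which shows `true` with probability `p`. -/
def applicantLaw (μ : Measure ℝ≥0) (p : I) : Measure (ℝ≥0 × Bool) :=
  μ.prod (bernoulliMeasure true false p)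

/-- The joint law of values and coins of `n` independent applicants, the `i`-th value having
distribution `F i`. -/
def jointLaw {n : ℕ} (F : Fin n → Measure ℝ≥0) (π : Policy) : Measure (Fin n → ℝ≥0 × Bool) :=
  Measure.pi fun i => applicantLaw (F i) π.p

open scoped Classical in
/-- The applicants whose value passes the threshold: it exceeds `t`, or it equals `t` and the
tie-breaking coin shows `true`. -/
def eligible {n : ℕ} (π : Policy) (ω : Fin n → ℝ≥0 × Bool) : Finset (Fin n) :=
  Finset.univ.filter fun i => π.t < (ω i).1 ∨ ((ω i).1 = π.t ∧ (ω i).2 = true)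

/-- Given an arrival order (`τ i` is the position at which applicant `i` arrives) and the set `S`
of eligible applicants, the applicants accepted with supply `k`: those eligible applicants before
whom fewer than `k` eligible applicants have arrived. -/
def accepted {n : ℕ} (k : ℕ) (τ : Equiv.Perm (Fin n)) (S : Finset (Fin n)) : Finset (Fin n) :=
  S.filter fun i => (S.filter fun j => τ j < τ i).card < k

/-- The expected number of eligible applicants. -/
def expectedDemand {n : ℕ} (F : Fin n → Measure ℝ≥0) (π : Policy) : ℝ≥0∞ :=
  ∫⁻ ω, ((eligible π ω).card : ℝ≥0∞) ∂(jointLaw F π)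

/-- The expected sum of the values of the accepted applicants, over values, tie-breaking coins and
a uniformly random arrival order. -/
def performance {n : ℕ} (k : ℕ) (F : Fin n → Measure ℝ≥0) (π : Policy) : ℝ≥0∞ :=
  (∑ τ : Equiv.Perm (Fin n),
      ∫⁻ ω, (∑ i ∈ accepted k τ (eligible π ω), ((ω i).1 : ℝ≥0∞)) ∂(jointLaw F π)) /
    (Fintype.card (Equiv.Perm (Fin n)) : ℝ≥0∞)

/-- The sum of the `k` largest entries of `v` (of all entries, if there are fewer than `k`): the
largest total of at most `k` of the nonnegative numbers `v i`. -/
def topSum {n : ℕ} (k : ℕ) (v : Fin n → ℝ≥0) : ℝ≥0 :=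
  (Finset.univ.powerset.filter fun S : Finset (Fin n) => S.card ≤ k).sup fun S => ∑ i ∈ S, v i

/-- The prophet's value: the expected sum of the `k` largest values. -/
def prophetValue {n : ℕ} (k : ℕ) (F : Fin n → Measure ℝ≥0) : ℝ≥0∞ :=
  ∫⁻ v, (topSum k v : ℝ≥0∞) ∂(Measure.pi F)

/-- `γ_k = 1 - e^{-k} k^k / k!`. -/
def gam (k : ℕ) : ℝ :=
  1 - Real.exp (-(k : ℝ)) * (k : ℝ) ^ k / (k.factorial : ℝ)

/-- The probability `x / m`, for a probability `x` and a natural number `m`. -/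
def divNat (x : I) (m : ℕ) : I :=
  ⟨(x : ℝ) / (m : ℝ), by
    have h0 : (0 : ℝ) ≤ x := x.2.1
    have h1 : (x : ℝ) ≤ 1 := x.2.2
    refine ⟨by positivity, ?_⟩
    rcases Nat.eq_zero_or_pos m with rfl | hm
    · simp
    · have : (1 : ℝ) ≤ m := by exact_mod_cast hm
      rw [div_le_one (by linarith)]
      linarith⟩

/-- `W_k = k * P(Pois(k) < k) / P(Pois(k) > k)`. -/
def bigW (k : ℕ) : ℝ≥0 :=
  (k : ℝ≥0) * (poissonMeasure (k : ℝ≥0) (Set.Iio k)).toNNReal /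
    (poissonMeasure (k : ℝ≥0) (Set.Ioi k)).toNNReal

/-- The first example: `n` identically distributed values, equal to `n * W_k` with probability
`1 / n ^ 2` and to `1` otherwise. -/
def exampleOne (k n : ℕ) : Fin n → Measure ℝ≥0 :=
  fun _ => bernoulliMeasure ((n : ℝ≥0) * bigW k) 1 (divNat 1 (n ^ 2))

/-- The second example, with `k + 1` applicants: the last value is `1 / ε ^ 2` with probability `ε`
and `0` otherwise; each of the others is `1` with probability `1 - ε / k` and `0` otherwise. -/
def exampleTwo (k : ℕ) (ε : I) : Fin (k + 1) → Measure ℝ≥0 :=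
  fun i =>
    if i = Fin.last k then bernoulliMeasure (1 / (unitInterval.toNNReal ε) ^ 2) 0 ε
    else bernoulliMeasure 1 0 (unitInterval.symm (divNat ε k))

end ProphetSecretary

end

/-! Fix a policy with expected demand k. Let q_i be the probability that applicant i is eligible, D
the number of eligible applicants, and D_i the number of those other than i. By symmetry of the
arrival order, an eligible applicant with d eligible rivals is accepted with probability `share k d`
= min{1, k/(d+1)}. By independence the performance is the sum over i of the expected eligible value
of i times E share(D_i) (`performance_eq`). The prophet gets at most k t + Σ E(V_i - t)^+, and when
Σ q_i = k this is exactly the total expected eligible value. Since share is decreasing and D_i ≤ D,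
the guarantee reduces to bounding E share(D) from below over all sums D of independent Bernoulli
variables with mean k (`guarantee`).

This is an extremal problem of Hoeffding type. Moving probability between two summands changes E
f(D) by the change in their product times the averaged second difference of f, so some minimizer
uses only the probabilities 0, 1 and one further value (`exists_minimizer_binomial`). The second
difference of share changes sign once; together with log-concavity of the binomial law this excludes
sure successes next to a nontrivial binomial part (`share_minimizer`). There remain the constant k,
of value k/(k+1), and Bin(l, k/l). If l is smaller than the number N of summands, either a
first-order condition fails or the value is computed to be at least k/(k+1); for k ≤ 2 an affine
minorant of share suffices (`min_le_ev_share`). Padding with zeros lets N tend to infinity, and size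
biasing identifies the limit for Bin(N, k/N) as E min{k, Pois(k)}/k = γ_k (`tendsto_ev_share`).

In the first example a policy of demand x earns asymptotically at most (W_k + x) E min{k,
Pois(x)}/x, and W_k is the weight for which x = k is the maximum (`limitValue_le`, made uniform in
`exists_forall_value_le`), while the prophet gets nearly W_k + k. In the second example a rare huge
value, which carries nearly all of the prophet's value, meets k almost sure rivals and is accepted
with probability about k/(k+1). Which bound is smaller depends on whether e^k exceeds (k+1) k^k/k!.
-/

noncomputable section

namespace ProphetSecretary

/-! ### Generating polynomials of sums of independent Bernoulli variables -/

open Polynomial in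
/-- The linear functional on polynomials sending `X ^ j` to `f j`: if the coefficients of `P` are
the probabilities of a random variable `D` on `ℕ`, then `ev f P` is the expectation of `f D`. -/
def ev (f : ℕ → ℝ) : ℝ[X] →ₗ[ℝ] ℝ := Polynomial.lsum fun j => LinearMap.mulRight ℝ (f j)

open Polynomial in
/-- The generating polynomial of a Bernoulli variable with parameter `p`. -/
def bern (p : ℝ) : ℝ[X] := C (1 - p) + C p * X

/-- The second difference of a sequence. -/
def diffTwo (f : ℕ → ℝ) (d : ℕ) : ℝ := f (d + 2) - 2 * f (d + 1) + f d

section Polynomials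

open Polynomial

lemma ev_apply (f : ℕ → ℝ) (P : ℝ[X]) : ev f P = P.sum fun j c => c * f j := rfl

lemma ev_monomial (f : ℕ → ℝ) (j : ℕ) (c : ℝ) : ev f (monomial j c) = c * f j := by
  rw [ev_apply, sum_monomial_index _ _ (by simp)]

lemma ev_C_mul_X_pow (f : ℕ → ℝ) (j : ℕ) (c : ℝ) : ev f (C c * X ^ j) = c * f j := by
  rw [C_mul_X_pow_eq_monomial, ev_monomial]

lemma ev_C_mul (f : ℕ → ℝ) (c : ℝ) (P : ℝ[X]) : ev f (C c * P) = c * ev f P := by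
  rw [← smul_eq_C_mul, map_smul, smul_eq_mul]

lemma ev_one (f : ℕ → ℝ) : ev f 1 = f 0 := by
  simpa using ev_monomial f 0 1

lemma ev_X_pow (f : ℕ → ℝ) (m : ℕ) : ev f (X ^ m) = f m := by
  simpa using ev_C_mul_X_pow f m 1

lemma ev_X_mul (f : ℕ → ℝ) (P : ℝ[X]) : ev f (X * P) = ev (fun d => f (d + 1)) P := by
  induction P using Polynomial.induction_on' with
  | add p q hp hq => rw [mul_add, map_add, map_add, hp, hq]
  | monomial n a => rw [X_mul_monomial, ev_monomial, ev_monomial]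

lemma ev_add_fun (f g : ℕ → ℝ) (P : ℝ[X]) : ev (fun d => f d + g d) P = ev f P + ev g P := by
  simp only [ev_apply, Polynomial.sum, mul_add, Finset.sum_add_distrib]

lemma ev_const_mul_fun (r : ℝ) (f : ℕ → ℝ) (P : ℝ[X]) :
    ev (fun d => r * f d) P = r * ev f P := by
  simp only [ev_apply, Polynomial.sum, Finset.mul_sum]
  exact Finset.sum_congr rfl fun _ _ => by ring

lemma ev_mono {f g : ℕ → ℝ} (hfg : ∀ d, f d ≤ g d) {P : ℝ[X]} (hP : ∀ d, 0 ≤ P.coeff d) :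
    ev f P ≤ ev g P := by
  simp only [ev_apply, Polynomial.sum]
  exact Finset.sum_le_sum fun d _ => mul_le_mul_of_nonneg_left (hfg d) (hP d)

/-- Multiplication by X is adjoint to the shift of f, hence multiplication by X - 1 to the forward
difference. -/
lemma ev_sq_X_sub_one_mul (f : ℕ → ℝ) (P : ℝ[X]) :
    ev f ((X - 1) ^ 2 * P) = ev (diffTwo f) P := by
  have h : (X - 1 : ℝ[X]) ^ 2 * P = X * (X * P) - (2 : ℝ) • (X * P) + P := by
    rw [smul_eq_C_mul]
    have : (C (2 : ℝ) : ℝ[X]) = 2 := rfl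
    rw [this]; ring
  have h2 : diffTwo f = fun d => (f (d + 2) + (-2) * f (d + 1)) + f d := by
    funext d; simp only [diffTwo]; ring
  rw [h, map_add, map_sub, map_smul, ev_X_mul, ev_X_mul, ev_X_mul, h2, ev_add_fun,
    ev_add_fun, ev_const_mul_fun]
  simp only [smul_eq_mul]; ring

lemma ev_bern_mul (f : ℕ → ℝ) (p : ℝ) (P : ℝ[X]) :
    ev f (bern p * P) = (1 - p) * ev f P + p * ev f (X * P) := by
  rw [bern, add_mul, map_add, mul_assoc, ev_C_mul, ev_C_mul]

lemma bern_zero : bern 0 = 1 := by simp [bern]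

lemma bern_one : bern 1 = X := by simp [bern]

lemma bern_mul_bern (p q : ℝ) :
    bern p * bern q = 1 + C (p + q) * (X - 1) + C (p * q) * (X - 1) ^ 2 := by
  simp only [bern, C_add, C_sub, C_mul, C_1]; ring

/-- With p + q fixed only the term in p q varies, so exchanges of probability between two variables
are governed by the second difference of f averaged over the others. -/
lemma ev_bern_mul_bern_mul (f : ℕ → ℝ) (p q : ℝ) (P : ℝ[X]) :
    ev f (bern p * (bern q * P)) =
      ev f P + (p + q) * ev f ((X - 1) * P) + p * q * ev (diffTwo f) P := by
  rw [← mul_assoc, bern_mul_bern, add_mul, add_mul, one_mul, mul_assoc, mul_assoc, map_add, map_add,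
    ev_C_mul, ev_C_mul, ev_sq_X_sub_one_mul]

lemma coeff_bern_mul_nonneg {p : ℝ} (hp : p ∈ Set.Icc (0 : ℝ) 1) {P : ℝ[X]}
    (hP : ∀ d, 0 ≤ P.coeff d) (d : ℕ) : 0 ≤ (bern p * P).coeff d := by
  rw [bern, add_mul, mul_assoc, coeff_add, coeff_C_mul, coeff_C_mul]
  have h1 : 0 ≤ (X * P).coeff d := by
    cases d with
    | zero => simp
    | succ d => rw [coeff_X_mul]; exact hP d
  exact add_nonneg (mul_nonneg (by linarith [hp.2]) (hP d)) (mul_nonneg hp.1 h1)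

lemma coeff_prod_bern_nonneg {ι : Type*} (s : Finset ι) {p : ι → ℝ}
    (hp : ∀ i, p i ∈ Set.Icc (0 : ℝ) 1) (d : ℕ) : 0 ≤ (∏ i ∈ s, bern (p i)).coeff d := by
  classical
  induction s using Finset.induction_on generalizing d with
  | empty => simp only [Finset.prod_empty, coeff_one]; split_ifs <;> norm_num
  | insert i s hi ih =>
    rw [Finset.prod_insert hi]
    exact coeff_bern_mul_nonneg (hp i) ih d

/-- The expectation of a function of a sum of independent Bernoulli variables, written as a sum
over the set of successes. -/
lemma ev_prod_bern {ι : Type*} [DecidableEq ι] (f : ℕ → ℝ) (s : Finset ι) (p : ι → ℝ) :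
    ev f (∏ i ∈ s, bern (p i)) =
      ∑ T ∈ s.powerset, (∏ i ∈ T, p i) * (∏ i ∈ s \ T, (1 - p i)) * f T.card := by
  have h : ∏ i ∈ s, bern (p i) = ∏ i ∈ s, (C (p i) * X + C (1 - p i)) :=
    Finset.prod_congr rfl fun i _ => by rw [bern, add_comm]
  rw [h, Finset.prod_add, map_sum]
  refine Finset.sum_congr rfl fun T _ => ?_
  rw [Finset.prod_mul_distrib, Finset.prod_const, ← map_prod, ← map_prod,
    mul_right_comm, ← C_mul, ev_C_mul_X_pow]

lemma ev_X_pow_mul_bern_pow (f : ℕ → ℝ) (m N : ℕ) (a : ℝ) :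
    ev f (X ^ m * bern a ^ N) =
      ∑ j ∈ Finset.range (N + 1), (N.choose j : ℝ) * a ^ j * (1 - a) ^ (N - j) * f (m + j) := by
  rw [bern, add_comm, add_pow, Finset.mul_sum, map_sum]
  refine Finset.sum_congr rfl fun j _ => ?_
  have : X ^ m * ((C a * X) ^ j * C (1 - a) ^ (N - j) * (N.choose j : ℝ[X])) =
      C ((N.choose j : ℝ) * a ^ j * (1 - a) ^ (N - j)) * X ^ (m + j) := by
    simp only [C_mul, C_pow, mul_pow, pow_add, map_natCast]; ring
  rw [this, ev_C_mul_X_pow]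

lemma ev_bern_pow (f : ℕ → ℝ) (N : ℕ) (a : ℝ) :
    ev f (bern a ^ N) =
      ∑ j ∈ Finset.range (N + 1), (N.choose j : ℝ) * a ^ j * (1 - a) ^ (N - j) * f j := by
  simpa using ev_X_pow_mul_bern_pow f 0 N a

lemma ev_const_prod_bern {ι : Type*} (s : Finset ι) (p : ι → ℝ) (r : ℝ) :
    ev (fun _ => r) (∏ i ∈ s, bern (p i)) = r := by
  classical
  induction s using Finset.induction_on with
  | empty => rw [Finset.prod_empty, ev_one]
  | insert i s hi ih =>
    rw [Finset.prod_insert hi, ev_bern_mul, ev_X_mul, ih]; ring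

lemma ev_bern_pow_one (N : ℕ) (a : ℝ) : ev (fun _ => 1) (bern a ^ N) = 1 := by
  simpa using ev_const_prod_bern (Finset.range N) (fun _ => a) 1

/-- The mean of a sum of independent Bernoulli variables. -/
lemma ev_id_prod_bern {ι : Type*} (s : Finset ι) (p : ι → ℝ) :
    ev (fun d => (d : ℝ)) (∏ i ∈ s, bern (p i)) = ∑ i ∈ s, p i := by
  classical
  induction s using Finset.induction_on with
  | empty => rw [Finset.prod_empty, ev_one]; simp
  | insert i s hi ih =>
    have : (fun d : ℕ => ((d + 1 : ℕ) : ℝ)) = fun d : ℕ => (d : ℝ) + 1 := by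
      funext d; push_cast; ring
    rw [Finset.prod_insert hi, ev_bern_mul, ev_X_mul, Finset.sum_insert hi, this,
      ev_add_fun, ih, ev_const_prod_bern]
    ring

/-- Removing a summand lowers the sum pointwise. This replaces the rivals of one applicant by all
eligible applicants. -/
lemma ev_prod_bern_le_of_antitone {ι : Type*} [DecidableEq ι] {f : ℕ → ℝ} (hf : Antitone f)
    {s : Finset ι} {p : ι → ℝ} (hp : ∀ i, p i ∈ Set.Icc (0 : ℝ) 1) {i : ι} (hi : i ∈ s) :
    ev f (∏ j ∈ s, bern (p j)) ≤ ev f (∏ j ∈ s.erase i, bern (p j)) := by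
  rw [← Finset.mul_prod_erase s _ hi, ev_bern_mul, ev_X_mul]
  have : ev (fun d => f (d + 1)) (∏ j ∈ s.erase i, bern (p j)) ≤
      ev f (∏ j ∈ s.erase i, bern (p j)) :=
    ev_mono (fun d => hf (Nat.le_succ d)) (coeff_prod_bern_nonneg _ hp)
  nlinarith [(hp i).1]

end Polynomials

/-! ### Hoeffding's exchange argument at a fixed mean -/

section Minimizer

open Polynomial

variable {N : ℕ}

/-- The vectors of success probabilities with a given sum. -/
def successVectors (N : ℕ) (κ : ℝ) : Set (Fin N → ℝ) :=
  {p | (∀ i, p i ∈ Set.Icc (0 : ℝ) 1) ∧ ∑ i, p i = κ}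

lemma isCompact_successVectors (N : ℕ) (κ : ℝ) : IsCompact (successVectors N κ) := by
  have h : successVectors N κ =
      Set.pi Set.univ (fun _ : Fin N => Set.Icc (0 : ℝ) 1) ∩ {p | ∑ i, p i = κ} := by
    ext p
    exact ⟨fun h => ⟨fun i _ => h.1 i, h.2⟩, fun h => ⟨fun i => h.1 i trivial, h.2⟩⟩
  rw [h]
  refine (isCompact_univ_pi fun _ => isCompact_Icc).inter_right ?_
  exact isClosed_eq (by fun_prop) continuous_const

lemma continuous_ev_prod_bern (f : ℕ → ℝ) :
    Continuous fun p : Fin N → ℝ => ev f (∏ i, bern (p i)) := by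
  simp only [ev_prod_bern]
  fun_prop

/-- Moving the amount `s` from coordinate `j` to coordinate `i`. -/
def transfer (p : Fin N → ℝ) (i j : Fin N) (s : ℝ) : Fin N → ℝ :=
  Function.update (Function.update p i (p i + s)) j (p j - s)

lemma transfer_left (p : Fin N → ℝ) {i j : Fin N} (hij : i ≠ j) (s : ℝ) :
    transfer p i j s i = p i + s := by
  simp [transfer, Function.update_of_ne hij]

lemma transfer_right (p : Fin N → ℝ) (i j : Fin N) (s : ℝ) :
    transfer p i j s j = p j - s := by
  simp [transfer]

lemma transfer_of_ne (p : Fin N → ℝ) {i j r : Fin N} (hi : r ≠ i) (hj : r ≠ j) (s : ℝ) :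
    transfer p i j s r = p r := by
  simp [transfer, hi, hj]

lemma sum_eq_add_add_sum_erase {M : Type*} [AddCommMonoid M] (g : Fin N → M) {i j : Fin N}
    (hij : i ≠ j) :
    ∑ r, g r = g i + (g j + ∑ r ∈ (Finset.univ.erase i).erase j, g r) := by
  rw [← Finset.add_sum_erase _ _ (Finset.mem_univ i),
    ← Finset.add_sum_erase (Finset.univ.erase i) _
      (Finset.mem_erase.2 ⟨hij.symm, Finset.mem_univ j⟩)]

lemma prod_eq_mul_mul_prod_erase {M : Type*} [CommMonoid M] (g : Fin N → M) {i j : Fin N}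
    (hij : i ≠ j) :
    ∏ r, g r = g i * (g j * ∏ r ∈ (Finset.univ.erase i).erase j, g r) := by
  rw [← Finset.mul_prod_erase _ _ (Finset.mem_univ i),
    ← Finset.mul_prod_erase (Finset.univ.erase i) _
      (Finset.mem_erase.2 ⟨hij.symm, Finset.mem_univ j⟩)]

lemma sum_transfer (φ : ℝ → ℝ) (p : Fin N → ℝ) {i j : Fin N} (hij : i ≠ j) (s : ℝ) :
    ∑ r, φ (transfer p i j s r) - ∑ r, φ (p r) =
      φ (p i + s) + φ (p j - s) - φ (p i) - φ (p j) := by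
  have h : ∑ r ∈ (Finset.univ.erase i).erase j, φ (transfer p i j s r) =
      ∑ r ∈ (Finset.univ.erase i).erase j, φ (p r) := by
    refine Finset.sum_congr rfl fun r hr => ?_
    simp only [Finset.mem_erase, Finset.mem_univ, and_true] at hr
    rw [transfer_of_ne p hr.2 hr.1]
  rw [sum_eq_add_add_sum_erase (fun r => φ (transfer p i j s r)) hij,
    sum_eq_add_add_sum_erase (fun r => φ (p r)) hij, h, transfer_left p hij, transfer_right]
  ring

/-- The first factor on the right is the change of the product, (p_i + s)(p_j - s) - p_i p_j. -/
lemma ev_prod_bern_transfer (f : ℕ → ℝ) (p : Fin N → ℝ) {i j : Fin N} (hij : i ≠ j) (s : ℝ) :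
    ev f (∏ r, bern (transfer p i j s r)) - ev f (∏ r, bern (p r)) =
      s * (p j - p i - s) *
        ev (diffTwo f) (∏ r ∈ (Finset.univ.erase i).erase j, bern (p r)) := by
  have h : ∏ r ∈ (Finset.univ.erase i).erase j, bern (transfer p i j s r) =
      ∏ r ∈ (Finset.univ.erase i).erase j, bern (p r) := by
    refine Finset.prod_congr rfl fun r hr => ?_
    simp only [Finset.mem_erase, Finset.mem_univ, and_true] at hr
    rw [transfer_of_ne p hr.2 hr.1]
  rw [prod_eq_mul_mul_prod_erase (fun r => bern (transfer p i j s r)) hij,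
    prod_eq_mul_mul_prod_erase (fun r => bern (p r)) hij, h, transfer_left p hij, transfer_right,
    ev_bern_mul_bern_mul, ev_bern_mul_bern_mul]
  ring

lemma transfer_mem {κ : ℝ} {p : Fin N → ℝ} (hp : p ∈ successVectors N κ) {i j : Fin N}
    (hij : i ≠ j) {s : ℝ} (hi : p i + s ∈ Set.Icc (0 : ℝ) 1) (hj : p j - s ∈ Set.Icc (0 : ℝ) 1) :
    transfer p i j s ∈ successVectors N κ := by
  refine ⟨fun r => ?_, ?_⟩
  · by_cases hrj : r = j
    · rw [hrj, transfer_right]; exact hj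
    by_cases hri : r = i
    · rw [hri, transfer_left p hij]; exact hi
    rw [transfer_of_ne p hri hrj]; exact hp.1 r
  · have := sum_transfer (fun x => x) p hij s
    have h2 := hp.2
    linarith

/-- Among the sums of `N` independent Bernoulli variables with a given mean there is one which
minimizes the expectation of `f` and satisfies the first-order conditions for all exchanges of
success probability between two of the variables. -/
theorem exists_minimizer (f : ℕ → ℝ) {κ : ℝ} (hne : (successVectors N κ).Nonempty) :
    ∃ p ∈ successVectors N κ,
      (∀ p' ∈ successVectors N κ, ev f (∏ i, bern (p i)) ≤ ev f (∏ i, bern (p' i))) ∧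
      (∀ i j, i ≠ j → 0 < p i → p i ≤ p j → p j < 1 →
        ev (diffTwo f) (∏ r ∈ (Finset.univ.erase i).erase j, bern (p r)) < 0) ∧
      (∀ i j, p i < p j →
        0 ≤ ev (diffTwo f) (∏ r ∈ (Finset.univ.erase i).erase j, bern (p r))) := by
  have hcont := continuous_ev_prod_bern (N := N) f
  obtain ⟨p₀, hp₀, hmin₀⟩ := (isCompact_successVectors N κ).exists_isMinOn hne hcont.continuousOn
  -- Among all minimizers one with the largest Σ p_i² is taken; this tie-break turns the condition
  -- for spreading two coordinates into a strict inequality.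
  set K' : Set (Fin N → ℝ) :=
    successVectors N κ ∩ {p | ev f (∏ i, bern (p i)) = ev f (∏ i, bern (p₀ i))} with hK'
  have hK'c : IsCompact K' :=
    (isCompact_successVectors N κ).inter_right (isClosed_eq hcont continuous_const)
  have hsq : Continuous fun p : Fin N → ℝ => ∑ i, p i ^ 2 := by fun_prop
  obtain ⟨p, hp, hmax⟩ := hK'c.exists_isMaxOn ⟨p₀, hp₀, rfl⟩ hsq.continuousOn
  have hmin : ∀ p' ∈ successVectors N κ, ev f (∏ i, bern (p i)) ≤ ev f (∏ i, bern (p' i)) := by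
    intro p' hp'
    rw [hp.2]
    exact hmin₀ hp'
  refine ⟨p, hp.1, hmin, ?_, ?_⟩
  · intro i j hij hi hle hj
    set c := ev (diffTwo f) (∏ r ∈ (Finset.univ.erase i).erase j, bern (p r)) with hc
    have hi1 := (hp.1.1 i).2
    have hj0 := (hp.1.1 j).1
    have hs : 0 < min (p i) (1 - p j) := lt_min hi (by linarith)
    set s := min (p i) (1 - p j) with hsdef
    have hs1 : s ≤ p i := min_le_left _ _
    have hs2 : s ≤ 1 - p j := min_le_right _ _
    have hmem : transfer p i j (-s) ∈ successVectors N κ :=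
      transfer_mem hp.1 hij ⟨by linarith, by linarith⟩ ⟨by linarith, by linarith⟩
    have hdiff := ev_prod_bern_transfer f p hij (-s)
    rw [← hc] at hdiff
    have hge := hmin _ hmem
    have hpos : 0 < s * (p j - p i + s) := mul_pos hs (by linarith)
    have hdiff' : ev f (∏ r, bern (transfer p i j (-s) r)) - ev f (∏ r, bern (p r)) =
        -(s * (p j - p i + s) * c) := by rw [hdiff]; ring
    have hc0 : c ≤ 0 := by
      by_contra hcpos
      push Not at hcpos
      have := mul_pos hpos hcpos
      linarith
    -- If c = 0, the spread vector is again a minimizer, but its sum of squares is larger by 2s(p_j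
    -- - p_i + s) > 0.
    refine lt_of_le_of_ne hc0 fun hc0 => ?_
    rw [hc0, mul_zero, neg_zero] at hdiff'
    have hK : transfer p i j (-s) ∈ K' := ⟨hmem, by
      have := hp.2
      simp only [Set.mem_ofPred_eq] at this ⊢
      linarith⟩
    have h1 : ∑ r, transfer p i j (-s) r ^ 2 ≤ ∑ r, p r ^ 2 := hmax hK
    have h2 := sum_transfer (fun x => x ^ 2) p hij (-s)
    nlinarith
  · intro i j hlt
    have hij : i ≠ j := by rintro rfl; exact lt_irrefl _ hlt
    set c := ev (diffTwo f) (∏ r ∈ (Finset.univ.erase i).erase j, bern (p r)) with hc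
    have hi0 := (hp.1.1 i).1
    have hj1 := (hp.1.1 j).2
    -- This transfer makes the two coordinates equal and increases their product, so c < 0 would
    -- lower the minimum.
    set s := (p j - p i) / 2 with hsdef
    have hs : 0 < s := by rw [hsdef]; linarith
    have hmem : transfer p i j s ∈ successVectors N κ :=
      transfer_mem hp.1 hij ⟨by linarith, by linarith⟩ ⟨by linarith, by linarith⟩
    have hdiff := ev_prod_bern_transfer f p hij s
    rw [← hc] at hdiff
    have hge := hmin _ hmem
    have hpos : 0 < s * (p j - p i - s) := mul_pos hs (by rw [hsdef]; linarith)
    by_contra hcneg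
    push Not at hcneg
    have := mul_neg_of_pos_of_neg hpos hcneg
    linarith

lemma prod_bern_eq_pow {ι : Type*} [DecidableEq ι] (T : Finset ι) {p : ι → ℝ} {a : ℝ}
    (hp : ∀ i, p i = 0 ∨ p i = 1 ∨ p i = a) (ha0 : a ≠ 0) (ha1 : a ≠ 1) :
    ∏ i ∈ T, bern (p i) =
      X ^ (T.filter fun i => p i = 1).card * bern a ^ (T.filter fun i => p i = a).card := by
  induction T using Finset.induction_on with
  | empty => simp
  | insert i s hi ih =>
    rw [Finset.prod_insert hi, ih, Finset.filter_insert, Finset.filter_insert]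
    rcases hp i with h | h | h
    · simp [h, bern_zero, ha0.symm]
    · simp [h, bern_one, ha1.symm, hi]; ring
    · simp [h, ha1, hi]; ring

/-- **Hoeffding's reduction**: the expectation of `f` over sums of `N` independent Bernoulli
variables with mean `κ` is minimized either by a sum of constants or by `m + B`, with a binomial
variable `B` with `l ≥ 1` trials and success probability `a ∈ (0, 1)`. In the second case, the
second difference of `f` has signed expectations. -/
theorem exists_minimizer_binomial (f : ℕ → ℝ) {κ : ℝ} (hne : (successVectors N κ).Nonempty) :
    (∃ m : ℕ, (m : ℝ) = κ ∧
      ∀ p ∈ successVectors N κ, f m ≤ ev f (∏ i, bern (p i))) ∨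
    ∃ (m l : ℕ) (a : ℝ), 0 < a ∧ a < 1 ∧ 1 ≤ l ∧ m + l ≤ N ∧ (m : ℝ) + l * a = κ ∧
      (∀ p ∈ successVectors N κ, ev f (X ^ m * bern a ^ l) ≤ ev f (∏ i, bern (p i))) ∧
      (2 ≤ l → ev (diffTwo f) (X ^ m * bern a ^ (l - 2)) < 0) ∧
      (1 ≤ m → 0 ≤ ev (diffTwo f) (X ^ (m - 1) * bern a ^ (l - 1))) ∧
      (m + l < N → 0 ≤ ev (diffTwo f) (X ^ m * bern a ^ (l - 1))) := by
  obtain ⟨p, hp, hmin, hneg, hpos⟩ := exists_minimizer (N := N) f hne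
  by_cases hint : ∃ i, 0 < p i ∧ p i < 1
  · obtain ⟨i₀, hi0, hi1⟩ := hint
    set a := p i₀ with ha
    right
    -- Two distinct values inside (0, 1) would force the same averaged second difference to be
    -- negative (spreading) and nonnegative (equalizing).
    have hall : ∀ i, p i = 0 ∨ p i = 1 ∨ p i = a := by
      intro i
      by_contra hcon
      push Not at hcon
      obtain ⟨h0, h1, h2⟩ := hcon
      have h0' : 0 < p i := lt_of_le_of_ne (hp.1 i).1 (Ne.symm h0)
      have h1' : p i < 1 := lt_of_le_of_ne (hp.1 i).2 h1
      rcases lt_or_gt_of_ne h2 with h | h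
      · have := hneg i i₀ (by rintro rfl; exact h2 rfl) h0' h.le hi1
        linarith [hpos i i₀ h]
      · have := hneg i₀ i (by rintro rfl; exact h2 rfl) hi0 h.le h1'
        linarith [hpos i₀ i h]
    set O := Finset.univ.filter fun i => p i = 1 with hO
    set A := Finset.univ.filter fun i => p i = a with hA
    have hprod := fun T => prod_bern_eq_pow T hall hi0.ne' hi1.ne
    have hi₀A : i₀ ∈ A := by simp [hA, ha]
    have hdisj : Disjoint O A := by
      rw [Finset.disjoint_left]
      intro i hi hi'
      simp only [hO, hA, Finset.mem_filter, Finset.mem_univ, true_and] at hi hi'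
      rw [hi] at hi'
      linarith
    have hsum : ∑ i, p i = O.card + A.card * a := by
      have h1 : ∀ i, p i = (if i ∈ O then (1 : ℝ) else 0) + (if i ∈ A then a else 0) := by
        intro i
        simp only [hO, hA, Finset.mem_filter, Finset.mem_univ, true_and]
        rcases hall i with h | h | h
        · simp [h, hi0.ne]
        · simp [h, hi1.ne']
        · simp [h, hi1.ne]
      rw [Finset.sum_congr rfl fun i _ => h1 i, Finset.sum_add_distrib]
      simp
    have hcardle : O.card + A.card ≤ N := by
      rw [← Finset.card_union_of_disjoint hdisj]
      simpa using Finset.card_le_univ (O ∪ A)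
    have herase : ∀ (i j : Fin N), i ≠ j → ∀ v : ℝ,
        (((Finset.univ.erase i).erase j).filter fun r => p r = v).card =
          (Finset.univ.filter fun r => p r = v).card - (if p i = v then 1 else 0) -
            (if p j = v then 1 else 0) := by
      intro i j hij v
      rw [Finset.filter_erase, Finset.filter_erase, Finset.card_erase_eq_ite,
        Finset.card_erase_eq_ite]
      simp only [Finset.mem_erase, Finset.mem_filter, Finset.mem_univ, true_and, ne_eq,
        hij.symm, not_false_eq_true]
      split_ifs <;> rfl
    refine ⟨O.card, A.card, a, hi0, hi1, Finset.card_pos.2 ⟨i₀, hi₀A⟩, hcardle, ?_, ?_, ?_, ?_, ?_⟩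
    · rw [← hsum, hp.2]
    · intro p' hp'
      rw [hO, hA, ← hprod]
      exact hmin p' hp'
    · intro hl
      obtain ⟨j, hj, hji⟩ := Finset.exists_mem_ne (by omega : 1 < A.card) i₀
      have hjA : p j = a := by simpa [hA] using hj
      have := hneg i₀ j hji.symm hi0 (by rw [hjA]) (by rw [hjA]; exact hi1)
      rw [hprod, herase i₀ j hji.symm, herase i₀ j hji.symm] at this
      simpa [← ha, hjA, hi1.ne, ← hO, ← hA, Nat.sub_sub] using this
    · intro hm
      obtain ⟨j, hj⟩ := Finset.card_pos.1 hm
      have hj1 : p j = 1 := by simpa [hO] using hj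
      have hne : i₀ ≠ j := by rintro rfl; rw [← ha] at hj1; linarith
      have := hpos i₀ j (by rw [hj1]; exact hi1)
      rw [hprod, herase i₀ j hne, herase i₀ j hne] at this
      simpa [← ha, hj1, hi1.ne, hi1.ne', ← hO, ← hA] using this
    · intro hN
      have hex : ∃ j, j ∉ O ∪ A := by
        by_contra hcon
        push Not at hcon
        have : O ∪ A = Finset.univ := Finset.eq_univ_iff_forall.2 hcon
        rw [← Finset.card_union_of_disjoint hdisj, this] at hN
        simp at hN
      obtain ⟨j, hj⟩ := hex
      have hj0 : p j = 0 := by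
        simp only [hO, hA, Finset.mem_union, Finset.mem_filter, Finset.mem_univ, true_and,
          not_or] at hj
        rcases hall j with h | h | h
        · exact h
        · exact absurd h hj.1
        · exact absurd h hj.2
      have hne : j ≠ i₀ := by rintro rfl; rw [← ha] at hj0; linarith
      have := hpos j i₀ (by rw [hj0]; exact hi0)
      rw [hprod, herase j i₀ hne, herase j i₀ hne] at this
      simpa [← ha, hj0, hi1.ne, hi0.ne, ← hO, ← hA] using this
  · left
    push Not at hint
    -- Here 1/2 is a dummy interior value that no coordinate takes; it only makes `prod_bern_eq_pow`
    -- applicable.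
    have hall : ∀ i, p i = 0 ∨ p i = 1 ∨ p i = 1 / 2 := by
      intro i
      rcases (hp.1 i).1.eq_or_lt with h | h
      · exact Or.inl h.symm
      · exact Or.inr (Or.inl (le_antisymm (hp.1 i).2 (hint i h)))
    have hhalf : (Finset.univ.filter fun i => p i = 1 / 2) = ∅ := by
      rw [Finset.filter_eq_empty_iff]
      intro i _ h
      have := hint i (by rw [h]; norm_num)
      rw [h] at this
      norm_num at this
    have hprod := prod_bern_eq_pow Finset.univ hall (by norm_num) (by norm_num)
    rw [hhalf, Finset.card_empty, pow_zero, mul_one] at hprod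
    refine ⟨(Finset.univ.filter fun i => p i = 1).card, ?_, ?_⟩
    · rw [← hp.2, Finset.card_filter]
      push_cast
      refine Finset.sum_congr rfl fun i _ => ?_
      rcases (hp.1 i).1.eq_or_lt with h | h
      · simp [← h]
      · simp [le_antisymm (hp.1 i).2 (hint i h)]
    · intro p' hp'
      have := hmin p' hp'
      rwa [hprod, ev_X_pow] at this

end Minimizer

/-! ### The share function, binomial probabilities and the reduction to Bin(l, k/l) -/

/-- The probability that an eligible applicant is accepted when there are `d` further eligible
applicants: the fraction `min {1, k / (d + 1)}`. -/
def share (k d : ℕ) : ℝ := min (k : ℝ) (d + 1) / (d + 1)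

lemma share_of_le {k d : ℕ} (h : d + 1 ≤ k) : share k d = 1 := by
  have h' : (d : ℝ) + 1 ≤ k := by exact_mod_cast h
  rw [share, min_eq_right h', div_self (by positivity)]

lemma share_of_ge {k d : ℕ} (h : k ≤ d + 1) : share k d = k / (d + 1) := by
  have h' : (k : ℝ) ≤ d + 1 := by exact_mod_cast h
  rw [share, min_eq_left h']

lemma share_nonneg (k d : ℕ) : 0 ≤ share k d := by
  unfold share; positivity

lemma share_le_one (k d : ℕ) : share k d ≤ 1 := by
  unfold share
  rw [div_le_one (by positivity)]
  exact min_le_right _ _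

lemma share_antitone (k : ℕ) : Antitone (share k) := by
  refine antitone_nat_of_succ_le fun d => ?_
  rcases le_total (d + 1) k with h | h
  · rw [share_of_le h]; exact share_le_one _ _
  · rw [share_of_ge h, share_of_ge (h.trans (Nat.le_succ _))]
    gcongr
    simp

/-- The second difference of share is zero below k - 2, negative at k - 2 alone, and nonnegative
from k - 1 on. All later sign arguments rest on this single sign change. -/
lemma diffTwo_share_of_lt {k d : ℕ} (h : d + 3 ≤ k) : diffTwo (share k) d = 0 := by
  rw [diffTwo, share_of_le (by omega), share_of_le (by omega), share_of_le (by omega)]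
  norm_num

lemma diffTwo_share_of_eq {k d : ℕ} (h : d + 2 = k) :
    diffTwo (share k) d = -(1 / ((k : ℝ) + 1)) := by
  subst h
  rw [diffTwo, share_of_ge (by omega), share_of_le (by omega), share_of_le (by omega)]
  push_cast
  field_simp
  ring

lemma diffTwo_share_of_ge {k d : ℕ} (h : k ≤ d + 1) :
    diffTwo (share k) d = 2 * k / (((d : ℝ) + 1) * (d + 2) * (d + 3)) := by
  rw [diffTwo, share_of_ge (by omega), share_of_ge (by omega), share_of_ge (by omega)]
  push_cast
  field_simp
  ring

lemma diffTwo_share_nonneg {k d : ℕ} (h : k ≤ d + 1) : 0 ≤ diffTwo (share k) d := by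
  rw [diffTwo_share_of_ge h]; positivity

/-- The probability mass function of the binomial distribution. -/
def binomPmf (N : ℕ) (a : ℝ) (j : ℕ) : ℝ := (N.choose j : ℝ) * a ^ j * (1 - a) ^ (N - j)

lemma binomPmf_nonneg {a : ℝ} (h0 : 0 ≤ a) (h1 : a ≤ 1) (N j : ℕ) : 0 ≤ binomPmf N a j := by
  have := sub_nonneg.2 h1
  unfold binomPmf; positivity

lemma binomPmf_pos {a : ℝ} (h0 : 0 < a) (h1 : a < 1) {N j : ℕ} (h : j ≤ N) :
    0 < binomPmf N a j := by
  have := sub_pos.2 h1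
  have := Nat.choose_pos h
  unfold binomPmf; positivity

lemma binomPmf_eq_zero {N j : ℕ} (h : N < j) (a : ℝ) : binomPmf N a j = 0 := by
  rw [binomPmf, Nat.choose_eq_zero_of_lt h]; simp

lemma binomPmf_succ {N j : ℕ} (h : j < N) (a : ℝ) :
    (j + 1) * (1 - a) * binomPmf N a (j + 1) = (N - j) * a * binomPmf N a j := by
  have h1 : (N.choose (j + 1) : ℝ) * (j + 1) = N.choose j * (N - j) := by
    have := Nat.choose_succ_right_eq N j
    rw [← Nat.cast_sub h.le]
    exact_mod_cast this
  have h2 : N - j = N - (j + 1) + 1 := by omega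
  rw [binomPmf, binomPmf, h2, pow_succ, pow_succ]
  linear_combination (a ^ j * a * (1 - a) ^ (N - (j + 1)) * (1 - a)) * h1

lemma choose_mul_choose_le {N i j : ℕ} (hij : i ≤ j) (hj : j < N) :
    N.choose (j + 1) * N.choose i ≤ N.choose j * N.choose (i + 1) := by
  have h1 := Nat.choose_succ_right_eq N j
  have h2 := Nat.choose_succ_right_eq N i
  have h3 : (N - j) * (i + 1) ≤ (j + 1) * (N - i) := by
    rw [mul_comm]; exact Nat.mul_le_mul (by omega) (by omega)
  have hpos : 0 < (j + 1) * (N - i) := Nat.mul_pos (by omega) (by omega)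
  refine Nat.le_of_mul_le_mul_right ?_ hpos
  calc N.choose (j + 1) * N.choose i * ((j + 1) * (N - i))
      = (N.choose (j + 1) * (j + 1)) * (N.choose i * (N - i)) := by ring
    _ = N.choose j * N.choose (i + 1) * ((N - j) * (i + 1)) := by rw [h1, ← h2]; ring
    _ ≤ N.choose j * N.choose (i + 1) * ((j + 1) * (N - i)) := Nat.mul_le_mul_left _ h3

/-- The binomial distribution is log-concave. -/
lemma binomPmf_mul_le {a : ℝ} (h0 : 0 ≤ a) (h1 : a ≤ 1) {N i j : ℕ} (hij : i ≤ j) (hj : j < N) :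
    binomPmf N a (j + 1) * binomPmf N a i ≤ binomPmf N a j * binomPmf N a (i + 1) := by
  have hch : (N.choose (j + 1) * N.choose i : ℝ) ≤ N.choose j * N.choose (i + 1) := by
    exact_mod_cast choose_mul_choose_le hij hj
  have h1' := sub_nonneg.2 h1
  have e1 : N - i = N - (i + 1) + 1 := by omega
  have e2 : N - j = N - (j + 1) + 1 := by omega
  calc binomPmf N a (j + 1) * binomPmf N a i
      = (N.choose (j + 1) * N.choose i : ℝ) *
          (a ^ j * a ^ i * a * ((1 - a) ^ (N - (j + 1)) * (1 - a) ^ (N - (i + 1)) * (1 - a))) := by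
        rw [binomPmf, binomPmf, e1]; ring
    _ ≤ (N.choose j * N.choose (i + 1) : ℝ) *
          (a ^ j * a ^ i * a * ((1 - a) ^ (N - (j + 1)) * (1 - a) ^ (N - (i + 1)) * (1 - a))) :=
        mul_le_mul_of_nonneg_right hch (by positivity)
    _ = _ := by rw [binomPmf, binomPmf, e2]; ring

section

open Polynomial

lemma ev_X_pow_mul_bern_pow' (f : ℕ → ℝ) (m N : ℕ) (a : ℝ) :
    ev f (X ^ m * bern a ^ N) = ∑ j ∈ Finset.range (N + 1), binomPmf N a j * f (m + j) :=
  ev_X_pow_mul_bern_pow f m N a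

lemma ev_bern_pow' (f : ℕ → ℝ) (N : ℕ) (a : ℝ) :
    ev f (bern a ^ N) = ∑ j ∈ Finset.range (N + 1), binomPmf N a j * f j :=
  ev_bern_pow f N a

/-- Excludes a sure success beside a binomial part. Conditioning on one trial, the two hypotheses
make the average after the shift m positive and that after m + 1 negative. But the shift by one
moves the unique negative place to a neighbouring index, and log-concavity bounds the first average
by a positive multiple of the second after weighting. -/
lemma shifted_binomial_not_minimizer {k m N : ℕ} {a : ℝ} (h0 : 0 < a) (h1 : a < 1)
    (hmk : m + 1 < k) (hk : k < m + 1 + (N + 2))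
    (hneg : ev (diffTwo (share k)) (X ^ (m + 1) * bern a ^ N) < 0)
    (hpos : 0 ≤ ev (diffTwo (share k)) (X ^ m * bern a ^ (N + 1))) : False := by
  set c := diffTwo (share k) with hc
  have hsplit : ev c (X ^ m * bern a ^ (N + 1)) =
      (1 - a) * ev c (X ^ m * bern a ^ N) + a * ev c (X ^ (m + 1) * bern a ^ N) := by
    have : X ^ m * bern a ^ (N + 1) = bern a * (X ^ m * bern a ^ N) := by ring
    rw [this, ev_bern_mul]
    congr 3
    ring
  rw [hsplit] at hpos
  have hu : 0 < ev c (X ^ m * bern a ^ N) := by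
    by_contra hcon
    push Not at hcon
    nlinarith
  rw [ev_X_pow_mul_bern_pow'] at hneg hu
  have hb := binomPmf_nonneg h0.le h1.le N
  rcases Nat.lt_or_ge (m + 2) k with hK | hK
  -- The index i satisfies m + 1 + i = k - 2, the only place where c is negative. At j = i the
  -- weighted terms agree, for j < i they vanish, and for j > i log-concavity compares them.
  · obtain ⟨i, rfl⟩ : ∃ i, k = m + 3 + i := ⟨k - (m + 3), by omega⟩
    have key : (∑ j ∈ Finset.range (N + 1), binomPmf N a j * c (m + j)) * binomPmf N a i ≤
        (∑ j ∈ Finset.range (N + 1), binomPmf N a j * c (m + 1 + j)) * binomPmf N a (i + 1) := by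
      rw [Finset.sum_mul, Finset.sum_mul, Finset.sum_range_succ', Finset.sum_range_succ]
      have hz : c (m + 0) = 0 := diffTwo_share_of_lt (by omega)
      have hl : 0 ≤ c (m + 1 + N) := diffTwo_share_nonneg (by omega)
      have hl' : 0 ≤ binomPmf N a N * c (m + 1 + N) * binomPmf N a (i + 1) :=
        mul_nonneg (mul_nonneg (hb _) hl) (hb _)
      rw [hz, mul_zero, zero_mul, add_zero]
      refine (Finset.sum_le_sum fun j hj => ?_).trans (le_add_of_nonneg_right hl')
      have hjN := Finset.mem_range.1 hj
      have e : m + (j + 1) = m + 1 + j := by ring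
      rw [e]
      rcases lt_trichotomy j i with h | h | h
      · have : c (m + 1 + j) = 0 := diffTwo_share_of_lt (by omega)
        rw [this]; simp
      · rw [h]; apply le_of_eq; ring
      · have hcj : 0 ≤ c (m + 1 + j) := diffTwo_share_nonneg (by omega)
        have := mul_le_mul_of_nonneg_left (binomPmf_mul_le h0.le h1.le h.le hjN) hcj
        linarith
    have hbpos : 0 < binomPmf N a (i + 1) := binomPmf_pos h0 h1 (by omega)
    have h2 := mul_neg_of_neg_of_pos hneg hbpos
    have h3 := mul_nonneg hu.le (hb i)
    linarith
  · refine absurd hneg (not_lt.2 (Finset.sum_nonneg fun j _ => mul_nonneg (hb j) ?_))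
    exact diffTwo_share_nonneg (by omega)

/-- Minimizers of the expected share over sums of independent Bernoulli variables with mean `k`:
unless the constant `k` is optimal, some binomial distribution `Bin(l, k / l)` with `l > k` is. -/
theorem share_minimizer {k : ℕ} {N : ℕ} (hne : (successVectors N (k : ℝ)).Nonempty) :
    (∀ p ∈ successVectors N (k : ℝ), (k : ℝ) / (k + 1) ≤ ev (share k) (∏ i, bern (p i))) ∨
    ∃ l : ℕ, k < l ∧ l ≤ N ∧
      (∀ p ∈ successVectors N (k : ℝ),
        ev (share k) (bern (k / l : ℝ) ^ l) ≤ ev (share k) (∏ i, bern (p i))) ∧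
      ev (diffTwo (share k)) (bern (k / l : ℝ) ^ (l - 2)) < 0 ∧
      (l < N → 0 ≤ ev (diffTwo (share k)) (bern (k / l : ℝ) ^ (l - 1))) := by
  rcases exists_minimizer_binomial (share k) hne with ⟨m, hm, hmin⟩ | ⟨m, l, a, h0, h1, hl, hN,
    hsum, hmin, hneg, hpos1, hpos0⟩
  · left
    obtain rfl : m = k := by exact_mod_cast hm
    intro p hp
    have := hmin p hp
    rwa [share_of_ge (Nat.le_succ _)] at this
  · right
    have hl1 : (1 : ℝ) ≤ l := by exact_mod_cast hl
    have hmk : m < k := by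
      have : (m : ℝ) < k := by rw [← hsum]; nlinarith
      exact_mod_cast this
    have hkl : k < m + l := by
      have : (k : ℝ) < (m + l : ℕ) := by rw [← hsum]; push_cast; nlinarith
      exact_mod_cast this
    have hl2 : 2 ≤ l := by omega
    rcases Nat.eq_zero_or_pos m with rfl | hm
    · have ha : a = k / l := by
        rw [eq_div_iff (by positivity)]
        rw [← hsum]; push_cast; ring
      subst ha
      simp only [pow_zero, one_mul, zero_add] at *
      exact ⟨l, hkl, hN, hmin, hneg hl2, hpos0⟩
    · exfalso
      obtain ⟨m', rfl⟩ : ∃ m', m = m' + 1 := ⟨m - 1, by omega⟩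
      obtain ⟨l', rfl⟩ : ∃ l', l = l' + 2 := ⟨l - 2, by omega⟩
      exact shifted_binomial_not_minimizer h0 h1 hmk hkl (hneg hl2) (hpos1 hm)

end

/-! ### Signs of the averaged second difference for binomial laws -/

/-- The weights telescope: 2k/((d+1)(d+2)(d+3)) = k/((d+1)(d+2)) - k/((d+2)(d+3)). Monotonicity
allows every b to be replaced by b s. -/
lemma sum_mul_weight_le {b : ℕ → ℝ} (hb : ∀ j, 0 ≤ b j) {s : ℕ} (k : ℕ)
    (hanti : ∀ j, s ≤ j → b (j + 1) ≤ b j) (n : ℕ) :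
    ∑ j ∈ Finset.range n,
        b (s + j) * (2 * k / ((((s + j : ℕ) : ℝ) + 1) * ((s + j : ℕ) + 2) * ((s + j : ℕ) + 3))) ≤
      b s * (k / (((s : ℝ) + 1) * (s + 2))) := by
  have hle : ∀ j, b (s + j) ≤ b s := by
    intro j
    induction j with
    | zero => exact le_rfl
    | succ j ih => exact (hanti (s + j) (by omega)).trans ih
  have htel : ∀ n : ℕ, ∑ j ∈ Finset.range n,
      (2 * k / ((((s + j : ℕ) : ℝ) + 1) * ((s + j : ℕ) + 2) * ((s + j : ℕ) + 3))) =
      (k : ℝ) / (((s : ℝ) + 1) * (s + 2)) - k / (((s + n : ℕ) + 1) * ((s + n : ℕ) + 2)) := by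
    intro n
    induction n with
    | zero => simp
    | succ n ih =>
      rw [Finset.sum_range_succ, ih]
      push_cast
      field_simp
      ring
  calc _ ≤ ∑ j ∈ Finset.range n,
        b s * (2 * k / ((((s + j : ℕ) : ℝ) + 1) * ((s + j : ℕ) + 2) * ((s + j : ℕ) + 3))) :=
        Finset.sum_le_sum fun j _ => mul_le_mul_of_nonneg_right (hle j) (by positivity)
    _ ≤ _ := by
        rw [← Finset.mul_sum, htel]
        refine mul_le_mul_of_nonneg_left ?_ (hb s)
        have : (0 : ℝ) ≤ k / (((s + n : ℕ) + 1) * ((s + n : ℕ) + 2)) := by positivity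
        linarith

lemma binomPmf_succ' (N j : ℕ) (a : ℝ) :
    (j + 1) * (1 - a) * binomPmf N a (j + 1) = (N - j) * a * binomPmf N a j := by
  rcases lt_trichotomy j N with h | h | h
  · exact binomPmf_succ h a
  · rw [h, binomPmf_eq_zero (Nat.lt_succ_self N)]; ring
  · rw [binomPmf_eq_zero h, binomPmf_eq_zero (h.trans (Nat.lt_succ_self j))]; ring

section

open Polynomial

/-- With k = κ + 2, the negative term sits at κ; M nonnegative terms are kept explicit and the rest
forms a tail. The tail range overshoots the support, where the probabilities are zero. -/
lemma ev_diffTwo_eq (κ N M : ℕ) (a : ℝ) :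
    ev (diffTwo (share (κ + 2))) (bern a ^ N) =
      -(1 / ((κ : ℝ) + 3)) * binomPmf N a κ +
      ∑ i ∈ Finset.range M, binomPmf N a (κ + 1 + i) * diffTwo (share (κ + 2)) (κ + 1 + i) +
      ∑ i ∈ Finset.range (N + 1),
        binomPmf N a (κ + 1 + M + i) * diffTwo (share (κ + 2)) (κ + 1 + M + i) := by
  have hext : ev (diffTwo (share (κ + 2))) (bern a ^ N) =
      ∑ j ∈ Finset.range (κ + 1 + M + (N + 1)), binomPmf N a j * diffTwo (share (κ + 2)) j := by
    rw [ev_bern_pow']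
    refine Finset.sum_subset (fun j hj => ?_) fun j _ hj => ?_
    · rw [Finset.mem_range] at hj ⊢; omega
    · rw [Finset.mem_range] at hj
      rw [binomPmf_eq_zero (by omega), zero_mul]
  have hz : ∑ j ∈ Finset.range κ, binomPmf N a j * diffTwo (share (κ + 2)) j = 0 := by
    refine Finset.sum_eq_zero fun j hj => ?_
    rw [Finset.mem_range] at hj
    rw [diffTwo_share_of_lt (by omega), mul_zero]
  rw [hext, Finset.sum_range_add, Finset.sum_range_add, Finset.sum_range_succ, hz,
    diffTwo_share_of_eq rfl]
  push_cast
  ring_nf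

lemma ev_diffTwo_le {κ N : ℕ} (M : ℕ) {a : ℝ} (h0 : 0 ≤ a) (h1 : a ≤ 1)
    (hanti : ∀ j, κ + 1 ≤ j → binomPmf N a (j + 1) ≤ binomPmf N a j) :
    ev (diffTwo (share (κ + 2))) (bern a ^ N) ≤
      -(1 / ((κ : ℝ) + 3)) * binomPmf N a κ +
      ∑ i ∈ Finset.range M, binomPmf N a (κ + 1 + i) * diffTwo (share (κ + 2)) (κ + 1 + i) +
      binomPmf N a (κ + 1 + M) * (((κ : ℝ) + 2) / (((κ : ℝ) + M + 2) * (κ + M + 3))) := by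
  rw [ev_diffTwo_eq κ N M]
  refine add_le_add le_rfl ?_
  have h := sum_mul_weight_le (b := binomPmf N a) (fun j => binomPmf_nonneg h0 h1 N j)
    (s := κ + 1 + M) (κ + 2) (fun j hj => hanti j (by omega)) (N + 1)
  refine le_trans (le_of_eq (Finset.sum_congr rfl fun i _ => ?_)) (h.trans (le_of_eq ?_))
  · rw [diffTwo_share_of_ge (by omega)]
  · push_cast; ring_nf

lemma le_ev_diffTwo (κ N M : ℕ) {a : ℝ} (h0 : 0 ≤ a) (h1 : a ≤ 1) :
    -(1 / ((κ : ℝ) + 3)) * binomPmf N a κ +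
      ∑ i ∈ Finset.range M, binomPmf N a (κ + 1 + i) * diffTwo (share (κ + 2)) (κ + 1 + i) ≤
      ev (diffTwo (share (κ + 2))) (bern a ^ N) := by
  rw [ev_diffTwo_eq κ N M]
  refine le_add_of_nonneg_right (Finset.sum_nonneg fun i _ => ?_)
  exact mul_nonneg (binomPmf_nonneg h0 h1 _ _) (diffTwo_share_nonneg (by omega))

/-- Ratios of consecutive binomial probabilities, for `r` trials less than the `k + L` trials for
which the mean would be `k`. -/
lemma binomPmf_ratio {k L N : ℕ} (hL : 1 ≤ L) {a r : ℝ} (ha : a = k / ((k + L : ℕ) : ℝ))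
    (hN : (N : ℝ) + r = k + L) (j : ℕ) :
    (j + 1) * binomPmf N a (j + 1) =
      (1 - (j + r - k) * (1 / (L : ℝ))) * k * binomPmf N a j := by
  have h := binomPmf_succ' N j a
  have hL' : (0 : ℝ) < L := by exact_mod_cast hL
  have hk : (0 : ℝ) < (k : ℝ) + L := by positivity
  have e1 : 1 - a = L / ((k : ℝ) + L) := by
    rw [ha]; push_cast; field_simp; ring
  have e2 : a = k / ((k : ℝ) + L) := by rw [ha]; push_cast; rfl
  have e3 : (N : ℝ) = k + L - r := by linarith
  rw [e1, e3] at h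
  generalize binomPmf N a (j + 1) = B at *
  generalize binomPmf N a j = A at *
  rw [e2] at h
  field_simp at h ⊢
  linarith

/-- The left side is affine in u, so the endpoints 0 and 1/2 suffice; the last summand vanishes at
1/2. Substituting k = m + 5 reduces both to polynomial inequalities that are visibly positive for m
≥ 0. -/
lemma exchange_inequality {k u : ℝ} (hk : 5 ≤ k) (h0 : 0 ≤ u) (h1 : u ≤ 1 / 2) :
    (2 / ((k + 1) * (k + 2)) + 2 * k / ((k + 1) * (k + 2) * (k + 3))) * (k / (k - 1) * (1 + u)) +
      2 * k / ((k + 2) * (k + 3) * (k + 4)) * (k ^ 2 / ((k - 1) * (k + 1))) +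
      (2 * k / ((k + 3) * (k + 4) * (k + 5)) + k / (k + 3) * (k / ((k + 4) * (k + 5)))) *
        ((1 - 2 * u) * (k / (k + 2)) * (k ^ 2 / ((k - 1) * (k + 1)))) < 1 / (k + 1) := by
  obtain ⟨m, rfl⟩ : ∃ m, k = m + 5 := ⟨k - 5, by ring⟩
  have hm : 0 ≤ m := by linarith
  have e : m + 5 - 1 = m + 4 := by ring
  rw [e]
  have hA : (2 / ((m + 5 + 1) * (m + 5 + 2)) +
      2 * (m + 5) / ((m + 5 + 1) * (m + 5 + 2) * (m + 5 + 3))) * ((m + 5) / (m + 4)) +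
      2 * (m + 5) / ((m + 5 + 2) * (m + 5 + 3) * (m + 5 + 4)) *
        ((m + 5) ^ 2 / ((m + 4) * (m + 5 + 1))) +
      (2 * (m + 5) / ((m + 5 + 3) * (m + 5 + 4) * (m + 5 + 5)) +
        (m + 5) / (m + 5 + 3) * ((m + 5) / ((m + 5 + 4) * (m + 5 + 5)))) *
        ((m + 5) / (m + 5 + 2) * ((m + 5) ^ 2 / ((m + 4) * (m + 5 + 1)))) < 1 / (m + 5 + 1) := by
    rw [← sub_pos]
    have : 0 < m + 4 := by linarith
    field_simp
    ring_nf
    positivity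
  have hB : (2 / ((m + 5 + 1) * (m + 5 + 2)) +
      2 * (m + 5) / ((m + 5 + 1) * (m + 5 + 2) * (m + 5 + 3))) * ((m + 5) / (m + 4) * (3 / 2)) +
      2 * (m + 5) / ((m + 5 + 2) * (m + 5 + 3) * (m + 5 + 4)) *
        ((m + 5) ^ 2 / ((m + 4) * (m + 5 + 1))) < 1 / (m + 5 + 1) := by
    rw [← sub_pos]
    have : 0 < m + 4 := by linarith
    field_simp
    ring_nf
    positivity
  have key : ∀ x₁ x₂ y z₁ z₂ z₃ z₄ T : ℝ, x₁ * x₂ + y + z₁ * (z₂ * z₃) < T →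
      x₁ * (x₂ * (3 / 2)) + y < T →
      x₁ * (x₂ * (1 + u)) + y + z₁ * ((1 - 2 * u) * z₂ * z₃) < T := by
    intro x₁ x₂ y z₁ z₂ z₃ z₄ T h1' h2'
    have e : x₁ * (x₂ * (1 + u)) + y + z₁ * ((1 - 2 * u) * z₂ * z₃) =
      (1 - 2 * u) * (x₁ * x₂ + y + z₁ * (z₂ * z₃)) +
        2 * u * (x₁ * (x₂ * (3 / 2)) + y) := by ring
    rw [e]
    rcases h1.eq_or_lt with h | h
    · rw [h]; linarith
    · have := mul_lt_mul_of_pos_left h1' (by linarith : (0 : ℝ) < 1 - 2 * u)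
      have := mul_le_mul_of_nonneg_left h2'.le (by linarith : (0 : ℝ) ≤ 2 * u)
      linarith
  exact key _ _ _ _ _ _ 0 _ hA hB

/-- Here b_i stands for the probability of k - 2 + i under k + L - 1 trials, and u = 1/L. The ratios
bound everything by b₀; the factors 1 - u² and 1 - 3u are estimated by 1, which leaves
`exchange_inequality`. -/
lemma exchange_sum_neg {k u b₀ b₁ b₂ b₃ b₄ b₅ : ℝ} (hk : 5 ≤ k) (h0 : 0 ≤ u) (h1 : u ≤ 1 / 2)
    (hb₀ : 0 < b₀) (hb₄ : 0 ≤ b₄)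
    (r₀ : (k - 1) * b₁ = (1 + u) * k * b₀) (r₁ : k * b₂ = k * b₁)
    (r₂ : (k + 1) * b₃ = (1 - u) * k * b₂) (r₃ : (k + 2) * b₄ = (1 - 2 * u) * k * b₃)
    (r₄ : (k + 3) * b₅ = (1 - 3 * u) * k * b₄) :
    -(1 / (k + 1)) * b₀ + (2 * k / (k * (k + 1) * (k + 2)) * b₁ +
      2 * k / ((k + 1) * (k + 2) * (k + 3)) * b₂ + 2 * k / ((k + 2) * (k + 3) * (k + 4)) * b₃ +
      2 * k / ((k + 3) * (k + 4) * (k + 5)) * b₄) + k / ((k + 4) * (k + 5)) * b₅ < 0 := by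
  have hk1 : 0 < k - 1 := by linarith
  have hk0 : 0 < k := by linarith
  have e₁ : b₁ = k / (k - 1) * (1 + u) * b₀ := by field_simp; linarith
  have e₂ : b₂ = b₁ := mul_left_cancel₀ hk0.ne' r₁
  have e₃ : b₃ ≤ k ^ 2 / ((k - 1) * (k + 1)) * b₀ := by
    have : b₃ = (1 - u ^ 2) * (k ^ 2 / ((k - 1) * (k + 1)) * b₀) := by
      have : b₃ = (1 - u) * k * b₂ / (k + 1) := by field_simp; linarith
      rw [this, e₂, e₁]; field_simp; ring
    rw [this]
    have h2 : 0 ≤ k ^ 2 / ((k - 1) * (k + 1)) * b₀ := by positivity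
    nlinarith [sq_nonneg u]
  have e₄ : b₄ ≤ (1 - 2 * u) * (k / (k + 2)) * (k ^ 2 / ((k - 1) * (k + 1))) * b₀ := by
    have : b₄ = (1 - 2 * u) * (k / (k + 2)) * b₃ := by field_simp; linarith
    rw [this, mul_assoc _ _ b₀]
    exact mul_le_mul_of_nonneg_left e₃ (mul_nonneg (by linarith) (by positivity))
  have e₅ : b₅ ≤ k / (k + 3) * b₄ := by
    have : b₅ = (1 - 3 * u) * (k / (k + 3) * b₄) := by field_simp; linarith
    rw [this]
    have : 0 ≤ k / (k + 3) * b₄ := by positivity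
    nlinarith
  have key := mul_lt_mul_of_pos_right (exchange_inequality hk h0 h1) hb₀
  have w1 : 2 * k / (k * (k + 1) * (k + 2)) = 2 / ((k + 1) * (k + 2)) := by field_simp
  have f₃ := mul_le_mul_of_nonneg_left e₃
    (by positivity : 0 ≤ 2 * k / ((k + 2) * (k + 3) * (k + 4)))
  have f₄ := mul_le_mul_of_nonneg_left e₄
    (by positivity : 0 ≤ 2 * k / ((k + 3) * (k + 4) * (k + 5)) +
      k / (k + 3) * (k / ((k + 4) * (k + 5))))
  have f₅ := mul_le_mul_of_nonneg_left e₅ (by positivity : 0 ≤ k / ((k + 4) * (k + 5)))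
  rw [w1, e₂, e₁]
  linarith

/-- The probabilities of the binomial distribution with `k + L - 1` trials and success
probability `k / (k + L)` decrease from `k - 1` on. -/
lemma binomPmf_succ_le {k L N : ℕ} (hk : 1 ≤ k) (hL : 1 ≤ L) {a : ℝ}
    (ha : a = k / ((k + L : ℕ) : ℝ)) (hN : N + 1 = k + L) {j : ℕ} (hj : k ≤ j + 1) :
    binomPmf N a (j + 1) ≤ binomPmf N a j := by
  have hr := binomPmf_ratio (N := N) (r := 1) hL ha (by exact_mod_cast hN) j
  have hk' : (1 : ℝ) ≤ k := by exact_mod_cast hk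
  have hj' : (k : ℝ) ≤ j + 1 := by exact_mod_cast hj
  have h0 : 0 ≤ a := by rw [ha]; positivity
  have h1 : a ≤ 1 := by
    rw [ha]; exact div_le_one_of_le₀ (by push_cast; linarith [Nat.cast_nonneg (α := ℝ) L])
      (by positivity)
  have hb := binomPmf_nonneg h0 h1 N j
  have hu : 0 ≤ ((j : ℝ) + 1 - k) * (1 / (L : ℝ)) := mul_nonneg (by linarith) (by positivity)
  have h2 : (1 - ((j : ℝ) + 1 - k) * (1 / (L : ℝ))) * k * binomPmf N a j ≤
      (j + 1) * binomPmf N a j := by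
    refine mul_le_mul_of_nonneg_right ?_ hb
    nlinarith
  rw [← hr] at h2
  exact le_of_mul_le_mul_left h2 (by positivity)

/-- Contradicts the first-order condition for an exchange between a coordinate 0 and an interior
one, so Bin(k + L, k/(k + L)) cannot be a minimizer when zeros are left. -/
lemma ev_diffTwo_neg_of_five_le {k L : ℕ} (hk : 5 ≤ k) (hL : 2 ≤ L) :
    ev (diffTwo (share k)) (bern (k / ((k + L : ℕ) : ℝ)) ^ (k + L - 1)) < 0 := by
  obtain ⟨κ, rfl⟩ : ∃ κ, k = κ + 2 := ⟨k - 2, by omega⟩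
  obtain ⟨N, hN⟩ : ∃ N, N + 1 = κ + 2 + L := ⟨κ + 1 + L, by omega⟩
  have hN' : κ + 2 + L - 1 = N := by omega
  rw [hN']
  generalize ha : ((κ + 2 : ℕ) : ℝ) / ((κ + 2 + L : ℕ) : ℝ) = a
  have h0 : 0 < a := by rw [← ha]; positivity
  have h1 : a < 1 := by
    rw [← ha, div_lt_one (by positivity)]; exact_mod_cast (by omega : κ + 2 < κ + 2 + L)
  have hr := binomPmf_ratio (N := N) (r := 1) (by omega : 1 ≤ L) ha.symm (by exact_mod_cast hN)
  have hb := binomPmf_nonneg h0.le h1.le N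
  have hpos : 0 < binomPmf N a κ := binomPmf_pos h0 h1 (by omega)
  refine (ev_diffTwo_le 4 h0.le h1.le fun j hj =>
    binomPmf_succ_le (by omega : 1 ≤ κ + 2) (by omega : 1 ≤ L) ha.symm hN
      (by omega)).trans_lt ?_
  simp only [Finset.sum_range_succ, Finset.sum_range_zero, zero_add]
  rw [diffTwo_share_of_ge (by omega), diffTwo_share_of_ge (by omega),
    diffTwo_share_of_ge (by omega), diffTwo_share_of_ge (by omega)]
  have r0 := hr κ
  have r1 := hr (κ + 1)
  have r2 := hr (κ + 2)
  have r3 := hr (κ + 3)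
  have r4 := hr (κ + 4)
  have hL' : (2 : ℝ) ≤ L := by exact_mod_cast hL
  set u : ℝ := 1 / (L : ℝ) with hu
  have hu0 : 0 ≤ u := by positivity
  have hu1 : u ≤ 1 / 2 := by
    rw [hu]; exact one_div_le_one_div_of_le (by norm_num) hL'
  have hkr : (5 : ℝ) ≤ (κ : ℝ) + 2 := by exact_mod_cast hk
  have key := exchange_inequality hkr hu0 hu1
  simp only [add_zero, add_assoc, Nat.reduceAdd] at *
  generalize binomPmf N a κ = b0 at *
  have hb1 := hb (κ + 1)
  have hb2 := hb (κ + 2)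
  have hb3 := hb (κ + 3)
  have hb4 := hb (κ + 4)
  have hb5 := hb (κ + 5)
  generalize binomPmf N a (κ + 1) = b1 at *
  generalize binomPmf N a (κ + 2) = b2 at *
  generalize binomPmf N a (κ + 3) = b3 at *
  generalize binomPmf N a (κ + 4) = b4 at *
  generalize binomPmf N a (κ + 5) = b5 at *
  push_cast at *
  have := exchange_sum_neg hkr hu0 hu1 hpos hb4 (b₁ := b1) (b₂ := b2) (b₃ := b3) (b₅ := b5)
    (by linear_combination r0) (by linear_combination r1) (by linear_combination r2)
    (by linear_combination r3) (by linear_combination r4)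
  refine lt_of_eq_of_lt ?_ this
  ring_nf

end

section

open Polynomial

/-- The case L = 1, where u = 1 is out of range for `exchange_inequality`. With k trials only the
values k - 2, k - 1, k contribute. For k = 6 the average is exactly 0, whence the bound on k. -/
lemma ev_diffTwo_neg_of_eq_succ {k : ℕ} (hk : 7 ≤ k) :
    ev (diffTwo (share k)) (bern (k / ((k + 1 : ℕ) : ℝ)) ^ k) < 0 := by
  obtain ⟨κ, rfl⟩ : ∃ κ, k = κ + 2 := ⟨k - 2, by omega⟩
  generalize ha : ((κ + 2 : ℕ) : ℝ) / ((κ + 2 + 1 : ℕ) : ℝ) = a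
  have h0 : 0 < a := by rw [← ha]; positivity
  have h1 : a < 1 := by
    rw [← ha, div_lt_one (by positivity)]; exact_mod_cast Nat.lt_succ_self _
  have hr := binomPmf_ratio (N := κ + 2) (r := 1) le_rfl ha.symm (by push_cast; ring)
  have hpos : 0 < binomPmf (κ + 2) a κ := binomPmf_pos h0 h1 (by omega)
  refine (ev_diffTwo_le 2 h0.le h1.le fun j hj =>
    binomPmf_succ_le (by omega : 1 ≤ κ + 2) le_rfl ha.symm rfl (by omega)).trans_lt ?_
  simp only [Finset.sum_range_succ, Finset.sum_range_zero, zero_add]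
  rw [diffTwo_share_of_ge (by omega), diffTwo_share_of_ge (by omega),
    binomPmf_eq_zero (by omega : κ + 2 < κ + 1 + 2)]
  have r0 := hr κ
  have r1 := hr (κ + 1)
  have hkr : (5 : ℝ) ≤ (κ : ℝ) := by exact_mod_cast (by omega : 5 ≤ κ)
  simp only [add_zero, add_assoc, Nat.reduceAdd] at *
  generalize binomPmf (κ + 2) a κ = b0 at *
  generalize binomPmf (κ + 2) a (κ + 1) = b1 at *
  generalize binomPmf (κ + 2) a (κ + 2) = b2 at *
  push_cast at *
  generalize (κ : ℝ) = x at *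
  have e2 : b2 = b1 := by
    have : (x + 2) * b2 = (x + 2) * b1 := by linear_combination r1
    exact mul_left_cancel₀ (by linarith) this
  have e1 : b1 = 2 * (x + 2) / (x + 1) * b0 := by
    have : (x + 1) * b1 = 2 * (x + 2) * b0 := by linear_combination r0
    have hx : x + 1 ≠ 0 := by linarith
    field_simp
    linarith
  have hpoly : (2 * (x + 2) / ((x + 2) * (x + 3) * (x + 4)) +
      2 * (x + 2) / ((x + 3) * (x + 4) * (x + 5))) * (2 * (x + 2) / (x + 1)) < 1 / (x + 3) := by
    obtain ⟨y, rfl⟩ : ∃ y, x = y + 5 := ⟨x - 5, by ring⟩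
    have hy : 0 ≤ y := by linarith
    rw [← sub_pos]
    field_simp
    ring_nf
    positivity
  have := mul_lt_mul_of_pos_right hpoly hpos
  rw [e2, e1]
  refine lt_of_eq_of_lt ?_ (sub_neg.2 this)
  ring_nf

/-- The same contradiction for k = 4; six explicit terms are kept and u ≤ 1/7 is used. -/
lemma ev_diffTwo_neg_of_eq_four {L : ℕ} (hL : 7 ≤ L) :
    ev (diffTwo (share 4)) (bern ((4 : ℕ) / ((4 + L : ℕ) : ℝ)) ^ (4 + L - 1)) < 0 := by
  obtain ⟨N, hN⟩ : ∃ N, N + 1 = 4 + L := ⟨3 + L, by omega⟩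
  have hN' : 4 + L - 1 = N := by omega
  rw [hN']
  generalize ha : ((4 : ℕ) : ℝ) / ((4 + L : ℕ) : ℝ) = a
  have h0 : 0 < a := by rw [← ha]; positivity
  have h1 : a < 1 := by
    rw [← ha, div_lt_one (by positivity)]; exact_mod_cast (by omega : 4 < 4 + L)
  have hr := binomPmf_ratio (N := N) (r := 1) (by omega : 1 ≤ L) ha.symm (by exact_mod_cast hN)
  have hb := binomPmf_nonneg h0.le h1.le N
  have hpos : 0 < binomPmf N a 2 := binomPmf_pos h0 h1 (by omega)
  refine (ev_diffTwo_le (κ := 2) 6 h0.le h1.le fun j hj =>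
    binomPmf_succ_le (by omega : 1 ≤ 4) (by omega : 1 ≤ L) ha.symm hN (by omega)).trans_lt ?_
  simp only [Finset.sum_range_succ, Finset.sum_range_zero, zero_add]
  simp only [diffTwo_share_of_ge (k := 2 + 2) (d := 2 + 1 + 0) (by omega),
    diffTwo_share_of_ge (k := 2 + 2) (d := 2 + 1 + 1) (by omega),
    diffTwo_share_of_ge (k := 2 + 2) (d := 2 + 1 + 2) (by omega),
    diffTwo_share_of_ge (k := 2 + 2) (d := 2 + 1 + 3) (by omega),
    diffTwo_share_of_ge (k := 2 + 2) (d := 2 + 1 + 4) (by omega),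
    diffTwo_share_of_ge (k := 2 + 2) (d := 2 + 1 + 5) (by omega)]
  have r2 := hr 2
  have r3 := hr 3
  have r4 := hr 4
  have r5 := hr 5
  have r6 := hr 6
  have r7 := hr 7
  have r8 := hr 8
  have hL' : (7 : ℝ) ≤ L := by exact_mod_cast hL
  set u : ℝ := 1 / (L : ℝ) with hu
  have hu0 : 0 ≤ u := by positivity
  have hu1 : u ≤ 1 / 7 := by
    rw [hu]; exact one_div_le_one_div_of_le (by norm_num) hL'
  have hb5 := hb 5
  have hb6 := hb 6
  have hb7 := hb 7
  have hb8 := hb 8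
  norm_num at *
  generalize binomPmf N a 2 = b2 at *
  generalize binomPmf N a 3 = b3 at *
  generalize binomPmf N a 4 = b4 at *
  generalize binomPmf N a 5 = b5 at *
  generalize binomPmf N a 6 = b6 at *
  generalize binomPmf N a 7 = b7 at *
  generalize binomPmf N a 8 = b8 at *
  generalize binomPmf N a 9 = b9 at *
  have e3 : b3 = 4 / 3 * (1 + u) * b2 := by linarith
  have e4 : b4 = b3 := by linarith
  have e5 : b5 ≤ 16 / 15 * b2 := by
    have : b5 = 16 / 15 * (1 - u ^ 2) * b2 := by rw [e4, e3] at r4; linarith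
    rw [this]
    nlinarith [mul_nonneg (sq_nonneg u) hpos.le]
  have e6 : b6 ≤ (1 - 2 * u) * (32 / 45) * b2 := by nlinarith
  have e7 : b7 ≤ 4 / 7 * b6 := by nlinarith [mul_nonneg hu0 hb6]
  have e8 : b8 ≤ 1 / 2 * b7 := by nlinarith [mul_nonneg hu0 hb7]
  have e9 : b9 ≤ 4 / 9 * b8 := by nlinarith [mul_nonneg hu0 hb8]
  have hub : u * b2 ≤ 1 / 7 * b2 := mul_le_mul_of_nonneg_right hu1 hpos.le
  have hub0 : 0 ≤ u * b2 := mul_nonneg hu0 hpos.le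
  nlinarith

/-- For k = 3 the other condition fails: the strict one for spreading two interior coordinates,
which involves two trials fewer. The discarded tail is nonnegative. -/
lemma ev_diffTwo_nonneg_of_eq_three {L : ℕ} (hL : 12 ≤ L) :
    0 ≤ ev (diffTwo (share 3)) (bern ((3 : ℕ) / ((3 + L : ℕ) : ℝ)) ^ (3 + L - 2)) := by
  obtain ⟨N, hN⟩ : ∃ N, N + 2 = 3 + L := ⟨1 + L, by omega⟩
  have hN' : 3 + L - 2 = N := by omega
  rw [hN']
  generalize ha : ((3 : ℕ) : ℝ) / ((3 + L : ℕ) : ℝ) = a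
  have h0 : 0 < a := by rw [← ha]; positivity
  have h1 : a < 1 := by
    rw [← ha, div_lt_one (by positivity)]; exact_mod_cast (by omega : 3 < 3 + L)
  have hr := binomPmf_ratio (N := N) (r := 2) (by omega : 1 ≤ L) ha.symm (by exact_mod_cast hN)
  have hpos : 0 < binomPmf N a 1 := binomPmf_pos h0 h1 (by omega)
  refine le_trans ?_ (le_ev_diffTwo 1 N 5 h0.le h1.le)
  simp only [Finset.sum_range_succ, Finset.sum_range_zero, zero_add]
  simp only [diffTwo_share_of_ge (k := 1 + 2) (d := 1 + 1 + 0) (by omega),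
    diffTwo_share_of_ge (k := 1 + 2) (d := 1 + 1 + 1) (by omega),
    diffTwo_share_of_ge (k := 1 + 2) (d := 1 + 1 + 2) (by omega),
    diffTwo_share_of_ge (k := 1 + 2) (d := 1 + 1 + 3) (by omega),
    diffTwo_share_of_ge (k := 1 + 2) (d := 1 + 1 + 4) (by omega)]
  have r1 := hr 1
  have r2 := hr 2
  have r3 := hr 3
  have r4 := hr 4
  have r5 := hr 5
  have hL' : (12 : ℝ) ≤ L := by exact_mod_cast hL
  set u : ℝ := 1 / (L : ℝ) with hu
  have hu0 : 0 ≤ u := by positivity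
  have hu1 : u ≤ 1 / 12 := by
    rw [hu]; exact one_div_le_one_div_of_le (by norm_num) hL'
  norm_num at *
  generalize binomPmf N a 1 = b1 at *
  generalize binomPmf N a 2 = b2 at *
  generalize binomPmf N a 3 = b3 at *
  generalize binomPmf N a 4 = b4 at *
  generalize binomPmf N a 5 = b5 at *
  generalize binomPmf N a 6 = b6 at *
  have e2 : b2 = 3 / 2 * b1 := by linarith
  have e3 : 11 / 12 * (3 / 2) * b1 ≤ b3 := by nlinarith
  have e4 : 10 / 12 * (3 / 4) * b3 ≤ b4 := by nlinarith
  have e5 : 9 / 12 * (3 / 5) * b4 ≤ b5 := by nlinarith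
  have e6 : 8 / 12 * (3 / 6) * b5 ≤ b6 := by nlinarith
  linarith

end

/-! ### Small cases and the lower bound for the expected share -/

section

open Polynomial

lemma share_three_binomial {l : ℕ} (h1 : 3 < l) (h2 : l ≤ 14) :
    (3 : ℝ) / (3 + 1) ≤ ev (share 3) (bern ((3 : ℕ) / (l : ℝ)) ^ l) := by
  rw [ev_bern_pow']
  interval_cases l <;>
    norm_num [Finset.sum_range_succ, binomPmf, share, Nat.choose]

lemma share_four_binomial {l : ℕ} (h1 : 4 < l) (h2 : l ≤ 10) :
    (4 : ℝ) / (4 + 1) ≤ ev (share 4) (bern ((4 : ℕ) / (l : ℝ)) ^ l) := by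
  rw [ev_bern_pow']
  interval_cases l <;>
    norm_num [Finset.sum_range_succ, binomPmf, share, Nat.choose]

lemma share_five_binomial_six :
    (5 : ℝ) / (5 + 1) ≤ ev (share 5) (bern ((5 : ℕ) / ((6 : ℕ) : ℝ)) ^ 6) := by
  rw [ev_bern_pow']
  norm_num [Finset.sum_range_succ, binomPmf, share, Nat.choose]

lemma share_six_binomial_seven :
    (6 : ℝ) / (6 + 1) ≤ ev (share 6) (bern ((6 : ℕ) / ((7 : ℕ) : ℝ)) ^ 7) := by
  rw [ev_bern_pow']
  norm_num [Finset.sum_range_succ, binomPmf, share, Nat.choose]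

/-- For d ≥ k the claim is (d - k)(d - (k² - 1)) ≥ 0. This holds for all integers d ≥ k because k² -
1 ≤ k + 1 when k ≤ 2. The affine minorant has mean exactly k/(k+1) when d has mean k. -/
lemma one_sub_le_share_of_le_two {k : ℕ} (h1 : 1 ≤ k) (h2 : k ≤ 2) (d : ℕ) :
    1 + -(1 / ((k : ℝ) * (k + 1))) * d ≤ share k d := by
  have hd : (0 : ℝ) ≤ d := Nat.cast_nonneg d
  rcases Nat.lt_or_ge d k with h | h
  · rw [share_of_le h]
    have : 0 ≤ 1 / ((k : ℝ) * (k + 1)) * d := by positivity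
    linarith
  · rw [share_of_ge (by omega), le_div_iff₀ (by positivity)]
    interval_cases k
    · have hd1 : (1 : ℝ) ≤ d := by exact_mod_cast h
      norm_num
      nlinarith
    · norm_num
      rcases Nat.lt_or_ge d 3 with h3 | h3
      · obtain rfl : d = 2 := by omega
        norm_num
      · have : (3 : ℝ) ≤ d := by exact_mod_cast h3
        nlinarith

lemma share_bound_of_le_two {k N : ℕ} (h1 : 1 ≤ k) (h2 : k ≤ 2) {p : Fin N → ℝ}
    (hp : p ∈ successVectors N (k : ℝ)) :
    (k : ℝ) / (k + 1) ≤ ev (share k) (∏ i, bern (p i)) := by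
  have hk : (0 : ℝ) < k := by exact_mod_cast h1
  refine le_trans (le_of_eq ?_) (ev_mono (one_sub_le_share_of_le_two h1 h2)
    (coeff_prod_bern_nonneg _ hp.1))
  rw [ev_add_fun, ev_const_mul_fun, ev_id_prod_bern, ev_const_prod_bern, hp.2]
  field_simp
  ring

/-- The expected share for a sum of independent Bernoulli variables with mean `k`. -/
theorem min_le_ev_share {k N : ℕ} (hk : 1 ≤ k) {p : Fin N → ℝ}
    (hp : p ∈ successVectors N (k : ℝ)) :
    min ((k : ℝ) / (k + 1)) (ev (share k) (bern ((k : ℝ) / N) ^ N)) ≤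
      ev (share k) (∏ i, bern (p i)) := by
  rcases Nat.lt_or_ge k 3 with hk3 | hk3
  · exact (min_le_left _ _).trans (share_bound_of_le_two hk (by omega) hp)
  rcases share_minimizer ⟨p, hp⟩ with h | ⟨l, hkl, hlN, hmin, hneg, hpos⟩
  · exact (min_le_left _ _).trans (h p hp)
  by_cases hlt : l < N
  · have hpos' := hpos hlt
    refine (min_le_left _ _).trans (le_trans ?_ (hmin p hp))
    obtain ⟨L, rfl⟩ : ∃ L, l = k + L := ⟨l - k, by omega⟩
    by_contra hcon
    -- Finitely many pairs (k, l) are computed and contradict `hcon`. In all others a first-order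
    -- condition fails: `hneg` for k = 3, `hpos'` for k ≥ 4.
    rcases Nat.lt_or_ge k 5 with hk5 | hk5
    · interval_cases k
      · rcases Nat.lt_or_ge L 12 with hL | hL
        · exact hcon (by exact_mod_cast share_three_binomial hkl (by omega))
        · exact absurd hneg (not_lt.2 (ev_diffTwo_nonneg_of_eq_three hL))
      · rcases Nat.lt_or_ge L 7 with hL | hL
        · exact hcon (by exact_mod_cast share_four_binomial hkl (by omega))
        · exact absurd hpos' (not_le.2 (ev_diffTwo_neg_of_eq_four hL))
    · rcases Nat.lt_or_ge L 2 with hL | hL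
      · obtain rfl : L = 1 := by omega
        rcases Nat.lt_or_ge k 7 with hk7 | hk7
        · interval_cases k
          · exact hcon (by exact_mod_cast share_five_binomial_six)
          · exact hcon (by exact_mod_cast share_six_binomial_seven)
        · exact absurd hpos' (not_le.2 (ev_diffTwo_neg_of_eq_succ hk7))
      · exact absurd hpos' (not_le.2 (ev_diffTwo_neg_of_five_le hk5 hL))
  · obtain rfl : l = N := by omega
    exact (min_le_right _ _).trans (hmin p hp)

/-- Impossible extra successes change neither the mean nor the law of the sum, so the number of
summands may tend to infinity. -/
lemma append_zero_mem_successVectors {n : ℕ} {κ : ℝ} {p : Fin n → ℝ}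
    (hp : p ∈ successVectors n κ) (m : ℕ) :
    Fin.append p (fun _ : Fin m => (0 : ℝ)) ∈ successVectors (n + m) κ := by
  refine ⟨fun i => ?_, ?_⟩
  · induction i using Fin.addCases with
    | left i => rw [Fin.append_left]; exact hp.1 i
    | right i => rw [Fin.append_right]; norm_num
  · rw [Fin.sum_univ_add]
    simpa using hp.2

lemma prod_bern_append_zero {n : ℕ} (p : Fin n → ℝ) (m : ℕ) :
    ∏ i, bern (Fin.append p (fun _ : Fin m => (0 : ℝ)) i) = ∏ i, bern (p i) := by
  rw [Fin.prod_univ_add]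
  simp [bern_zero]

/-- A lower bound for the expected share that only depends on the behaviour of the binomial
distributions with many trials. -/
theorem min_le_ev_share_of_tendsto {k n : ℕ} (hk : 1 ≤ k) {p : Fin n → ℝ}
    (hp : p ∈ successVectors n (k : ℝ)) {γ : ℝ}
    (hγ : Tendsto (fun N : ℕ => ev (share k) (bern ((k : ℝ) / N) ^ N)) atTop (nhds γ)) :
    min ((k : ℝ) / (k + 1)) γ ≤ ev (share k) (∏ i, bern (p i)) := by
  refine le_of_tendsto (tendsto_const_nhds.min hγ) ?_
  filter_upwards [eventually_ge_atTop n] with N hN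
  obtain ⟨m, rfl⟩ := Nat.exists_eq_add_of_le hN
  have := min_le_ev_share hk (append_zero_mem_successVectors hp m)
  rwa [prod_bern_append_zero] at this

end

/-! ### The Poisson limit and γ_k -/

/-- The expectation of `min {k, B}` for a binomial variable `B`. -/
def binMin (k n : ℕ) (q : ℝ) : ℝ := k - ∑ i ∈ Finset.range k, ((k : ℝ) - i) * binomPmf n q i

/-- The expectation of `min {k, P}` for a Poisson variable `P` with mean `x`. -/
def poisMin (k : ℕ) (x : ℝ) : ℝ :=
  k - ∑ i ∈ Finset.range k, ((k : ℝ) - i) * (Real.exp (-x) * x ^ i / (i.factorial : ℝ))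

/-- The partial sums of the exponential series. -/
def expPartial (m : ℕ) (x : ℝ) : ℝ := ∑ i ∈ Finset.range m, x ^ i / (i.factorial : ℝ)

lemma ev_cast_mul (g : ℕ → ℝ) (n : ℕ) (q : ℝ) :
    ev (fun d => (d : ℝ) * g d) (bern q ^ (n + 1)) =
      (n + 1) * q * ev (fun d => g (d + 1)) (bern q ^ n) := by
  rw [ev_bern_pow', ev_bern_pow', Finset.sum_range_succ', Finset.mul_sum]
  simp only [Nat.cast_zero, zero_mul, mul_zero, add_zero]
  refine Finset.sum_congr rfl fun j _ => ?_
  have h : ((n : ℝ) + 1) * n.choose j = (n + 1).choose (j + 1) * (j + 1) := by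
    exact_mod_cast Nat.add_one_mul_choose_eq n j
  have e : n + 1 - (j + 1) = n - j := by omega
  rw [binomPmf, binomPmf, e]
  push_cast
  linear_combination -(q ^ (j + 1) * (1 - q) ^ (n - j) * g (j + 1)) * h

lemma ev_min_eq_binMin (k n : ℕ) (q : ℝ) :
    ev (fun d => min (d : ℝ) k) (bern q ^ n) = binMin k n q := by
  have h1 : (fun d : ℕ => min (d : ℝ) k) = fun d : ℕ => (k : ℝ) + (-1) * (((k - d : ℕ) : ℕ) : ℝ) := by
    funext d
    rcases le_total d k with h | h
    · rw [Nat.cast_sub h, min_eq_left (by exact_mod_cast h)]; ring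
    · rw [Nat.sub_eq_zero_of_le h, min_eq_right (by exact_mod_cast h)]; simp
  have hc : ev (fun _ => (k : ℝ)) (bern q ^ n) = k := by
    simpa using ev_const_prod_bern (Finset.range n) (fun _ => q) (k : ℝ)
  have hs : ∑ j ∈ Finset.range (n + 1), binomPmf n q j * ((k - j : ℕ) : ℝ) =
      ∑ j ∈ Finset.range (n + 1 + k), binomPmf n q j * ((k - j : ℕ) : ℝ) := by
    refine Finset.sum_subset (fun j hj => ?_) fun j _ hj => ?_
    · rw [Finset.mem_range] at hj ⊢; omega
    · rw [Finset.mem_range] at hj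
      rw [binomPmf_eq_zero (by omega), zero_mul]
  have hs' : ∑ i ∈ Finset.range k, ((k : ℝ) - i) * binomPmf n q i =
      ∑ j ∈ Finset.range (n + 1 + k), binomPmf n q j * ((k - j : ℕ) : ℝ) := by
    rw [Finset.sum_congr rfl (g := fun j => binomPmf n q j * ((k - j : ℕ) : ℝ))]
    · refine Finset.sum_subset (fun j hj => ?_) fun j _ hj => ?_
      · rw [Finset.mem_range] at hj ⊢; omega
      · rw [Finset.mem_range] at hj
        rw [Nat.sub_eq_zero_of_le (by omega)]; simp
    · intro j hj
      rw [Finset.mem_range] at hj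
      rw [Nat.cast_sub hj.le, mul_comm]
  rw [h1, ev_add_fun, ev_const_mul_fun, hc, ev_bern_pow', hs, ← hs', binMin]
  ring

/-- The size-biasing identity for the binomial distribution. -/
lemma mul_ev_share (k n : ℕ) (q : ℝ) :
    ((n : ℝ) + 1) * q * ev (share k) (bern q ^ n) = binMin k (n + 1) q := by
  rw [← ev_min_eq_binMin]
  have h := ev_cast_mul (fun d => share k (d - 1)) n q
  simp only [Nat.add_sub_cancel] at h
  rw [← h]
  congr 1
  congr 1
  funext d
  cases d with
  | zero => simp
  | succ d =>
    rw [Nat.add_sub_cancel, share]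
    push_cast
    rw [mul_div_cancel₀ _ (by positivity), min_comm]

/-- The sum telescopes, since x · x^m/m! = (m+1) x^(m+1)/(m+1)!. At x = m = k it evaluates `poisMin`
at its own mean and produces γ_k. -/
lemma sum_sub_mul_pow_div_factorial (x : ℝ) (m : ℕ) :
    ∑ i ∈ Finset.range m, (x - i) * (x ^ i / (i.factorial : ℝ)) =
      m * (x ^ m / (m.factorial : ℝ)) := by
  induction m with
  | zero => simp
  | succ m ih =>
    rw [Finset.sum_range_succ, ih, Nat.factorial_succ]
    push_cast
    field_simp
    ring

lemma poisMin_eq (k : ℕ) (x : ℝ) :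
    poisMin k x = k - Real.exp (-x) *
      ∑ i ∈ Finset.range k, ((k : ℝ) - i) * (x ^ i / (i.factorial : ℝ)) := by
  rw [poisMin, Finset.mul_sum]
  congr 1
  exact Finset.sum_congr rfl fun i _ => by ring

lemma poisMin_self (k : ℕ) : poisMin k k = k * gam k := by
  rw [poisMin_eq, sum_sub_mul_pow_div_factorial, gam]
  ring

/-- The expected share for the binomial distribution with mean `k` converges to `γ_k`. -/
lemma tendsto_ev_share {k : ℕ} (hk : 1 ≤ k) :
    Tendsto (fun N : ℕ => ev (share k) (bern ((k : ℝ) / N) ^ N)) atTop (nhds (gam k)) := by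
  have hk0 : (0 : ℝ) < k := by exact_mod_cast hk
  -- Size biasing adds one trial without changing the success probability k/N, so the relevant mean
  -- is (N+1)k/N, written with n = N + 1.
  have hr : Tendsto (fun n : ℕ => (n : ℝ) * (k / ((n - 1 : ℕ) : ℝ))) atTop (nhds k) := by
    rw [← tendsto_add_atTop_iff_nat 1]
    have h1 : Tendsto (fun n : ℕ => (k : ℝ) + k * (1 / (n : ℝ))) atTop (nhds (k + k * 0)) :=
      tendsto_const_nhds.add (tendsto_const_nhds.mul tendsto_one_div_atTop_nhds_zero_nat)
    rw [mul_zero, add_zero] at h1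
    refine h1.congr' ?_
    filter_upwards [eventually_ge_atTop 1] with n hn
    have : (0 : ℝ) < n := by exact_mod_cast hn
    rw [Nat.add_sub_cancel]
    push_cast
    field_simp
  have hM : Tendsto (fun n : ℕ => binMin k n (k / ((n - 1 : ℕ) : ℝ))) atTop
      (nhds (poisMin k k)) := by
    unfold binMin poisMin
    refine tendsto_const_nhds.sub (tendsto_finsetSum _ fun i _ => ?_)
    exact (tendsto_choose_mul_pow_of_tendsto_mul_atTop i hr).const_mul _
  have hq := (hM.div hr hk0.ne').comp (tendsto_add_atTop_nat 1)
  rw [poisMin_self, mul_div_cancel_left₀ _ hk0.ne'] at hq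
  refine hq.congr' ?_
  filter_upwards [eventually_ge_atTop 1] with n hn
  have : (0 : ℝ) < n := by exact_mod_cast hn
  simp only [Function.comp, Pi.div_apply, Nat.add_sub_cancel]
  rw [← mul_ev_share]
  push_cast
  field_simp

/-- For a sum of independent Bernoulli variables with mean `k`, the expected share is at least
`min {γ_k, k / (k + 1)}`. -/
theorem min_gam_le_ev_share {k n : ℕ} (hk : 1 ≤ k) {p : Fin n → ℝ}
    (hp : p ∈ successVectors n (k : ℝ)) :
    min (gam k) ((k : ℝ) / (k + 1)) ≤ ev (share k) (∏ i, bern (p i)) := by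
  rw [min_comm]
  exact min_le_ev_share_of_tendsto hk hp (tendsto_ev_share hk)

/-! ### The limiting objective of the first example -/

lemma expPartial_succ (m : ℕ) (x : ℝ) :
    expPartial (m + 1) x = expPartial m x + x ^ m / (m.factorial : ℝ) :=
  Finset.sum_range_succ _ _

lemma hasDerivAt_expPartial (m : ℕ) (x : ℝ) :
    HasDerivAt (expPartial (m + 1)) (expPartial m x) x := by
  induction m with
  | zero =>
    have : expPartial (0 + 1) = fun _ => 1 := by funext y; simp [expPartial]
    rw [this]
    simpa [expPartial] using hasDerivAt_const x (1 : ℝ)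
  | succ m ih =>
    have h1 : HasDerivAt (fun y : ℝ => y ^ (m + 1) / ((m + 1).factorial : ℝ))
        (x ^ m / (m.factorial : ℝ)) x := by
      refine ((hasDerivAt_pow (m + 1) x).div_const _).congr_deriv ?_
      rw [Nat.factorial_succ, Nat.add_sub_cancel]
      push_cast
      field_simp
    have : expPartial (m + 1 + 1) =
        fun y => expPartial (m + 1) y + y ^ (m + 1) / ((m + 1).factorial : ℝ) := by
      funext y; exact expPartial_succ _ _
    rw [this, expPartial_succ]
    exact ih.add h1

lemma sum_sub_mul_eq (k : ℕ) (x : ℝ) :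
    ∑ i ∈ Finset.range k, ((k : ℝ) - i) * (x ^ i / (i.factorial : ℝ)) =
      k * expPartial (k + 1) x - x * expPartial k x := by
  have key : ∀ m : ℕ, ∑ i ∈ Finset.range m, (i : ℝ) * (x ^ i / (i.factorial : ℝ)) +
      m * (x ^ m / (m.factorial : ℝ)) = x * expPartial m x := by
    intro m
    induction m with
    | zero => simp [expPartial]
    | succ m ih =>
      rw [Finset.sum_range_succ, ih, expPartial_succ, Nat.factorial_succ]
      push_cast
      field_simp
      ring
  rw [← key k, expPartial_succ, expPartial]
  simp only [sub_mul, Finset.sum_sub_distrib, ← Finset.mul_sum]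
  ring

lemma poisMin_eq_expPartial (k : ℕ) (x : ℝ) :
    poisMin k x = k - Real.exp (-x) * (k * expPartial (k + 1) x - x * expPartial k x) := by
  rw [poisMin_eq, sum_sub_mul_eq]

lemma hasDerivAt_poisMin (k : ℕ) (hk : 1 ≤ k) (x : ℝ) :
    HasDerivAt (poisMin k) (Real.exp (-x) * expPartial k x) x := by
  obtain ⟨m, rfl⟩ : ∃ m, k = m + 1 := ⟨k - 1, by omega⟩
  have hfun : poisMin (m + 1) = fun y => ((m + 1 : ℕ) : ℝ) - Real.exp (-y) *
      (((m + 1 : ℕ) : ℝ) * expPartial (m + 2) y - y * expPartial (m + 1) y) := by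
    funext y; exact poisMin_eq_expPartial _ _
  rw [hfun]
  have he : HasDerivAt (fun y : ℝ => Real.exp (-y)) (-Real.exp (-x)) x := by
    simpa using (hasDerivAt_neg x).exp
  have h1 := (hasDerivAt_expPartial (m + 1) x).const_mul ((m + 1 : ℕ) : ℝ)
  have h2 := (hasDerivAt_id x).mul (hasDerivAt_expPartial m x)
  refine ((he.mul (h1.sub h2)).const_sub _).congr_deriv ?_
  have hm : expPartial (m + 2) x =
      expPartial m x + x ^ m / (m.factorial : ℝ) + x ^ (m + 1) / ((m + 1).factorial : ℝ) := by
    rw [expPartial_succ, expPartial_succ]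
  simp only [Pi.sub_apply, Pi.mul_apply, id]
  rw [hm, expPartial_succ, Nat.factorial_succ]
  push_cast
  field_simp
  ring

/-- The tails of the exponential series. -/
def expTail (m : ℕ) (x : ℝ) : ℝ := Real.exp x - expPartial m x

lemma hasSum_expTail (m : ℕ) (x : ℝ) :
    HasSum (fun j : ℕ => x ^ (j + m) / ((j + m).factorial : ℝ)) (expTail m x) := by
  rw [hasSum_nat_add_iff (f := fun j : ℕ => x ^ j / (j.factorial : ℝ)), expTail, expPartial,
    sub_add_cancel, Real.exp_eq_exp_ℝ]
  exact NormedSpace.expSeries_div_hasSum_exp x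

lemma expTail_pos (m : ℕ) {x : ℝ} (hx : 0 < x) : 0 < expTail m x :=
  (hasSum_expTail m x).summable.tsum_pos (fun _ => by positivity) 0 (by positivity) |>.trans_eq
    (hasSum_expTail m x).tsum_eq

lemma expPartial_pos {m : ℕ} (hm : 1 ≤ m) {x : ℝ} (hx : 0 ≤ x) : 0 < expPartial m x := by
  obtain ⟨m, rfl⟩ : ∃ m', m = m' + 1 := ⟨m - 1, by omega⟩
  rw [expPartial, Finset.sum_range_succ']
  have : 0 ≤ ∑ i ∈ Finset.range m, x ^ (i + 1) / ((i + 1).factorial : ℝ) :=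
    Finset.sum_nonneg fun i _ => by positivity
  simp only [pow_zero, Nat.factorial_zero, Nat.cast_one, div_one]
  linarith

/-- Divided by x^m, the tail is a power series with nonnegative exponents and coefficients, hence
increasing. -/
lemma expTail_mul_le {m : ℕ} {x y : ℝ} (hx : 0 ≤ x) (hxy : x ≤ y) :
    y ^ m * expTail m x ≤ x ^ m * expTail m y := by
  refine hasSum_le (fun j => ?_) ((hasSum_expTail m x).mul_left (y ^ m))
    ((hasSum_expTail m y).mul_left (x ^ m))
  have h : x ^ j ≤ y ^ j := pow_le_pow_left₀ hx hxy j
  have hy : 0 ≤ y := hx.trans hxy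
  calc y ^ m * (x ^ (j + m) / ((j + m).factorial : ℝ))
      = x ^ j * (x ^ m * y ^ m / ((j + m).factorial : ℝ)) := by rw [pow_add]; ring
    _ ≤ y ^ j * (x ^ m * y ^ m / ((j + m).factorial : ℝ)) := by gcongr
    _ = _ := by rw [pow_add]; ring

/-- Divided by x^m, the partial sum has only nonpositive powers of x, hence is decreasing. -/
lemma expPartial_mul_le {m : ℕ} {x y : ℝ} (hx : 0 ≤ x) (hxy : x ≤ y) :
    x ^ m * expPartial (m + 1) y ≤ y ^ m * expPartial (m + 1) x := by
  rw [expPartial, expPartial, Finset.mul_sum, Finset.mul_sum]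
  refine Finset.sum_le_sum fun i hi => ?_
  obtain ⟨j, rfl⟩ := Nat.exists_eq_add_of_le (Nat.lt_succ_iff.1 (Finset.mem_range.1 hi))
  have h : x ^ j ≤ y ^ j := pow_le_pow_left₀ hx hxy j
  have hy : 0 ≤ y := hx.trans hxy
  calc x ^ (i + j) * (y ^ i / (i.factorial : ℝ))
      = x ^ j * (x ^ i * y ^ i / (i.factorial : ℝ)) := by rw [pow_add]; ring
    _ ≤ y ^ j * (x ^ i * y ^ i / (i.factorial : ℝ)) := by gcongr
    _ = _ := by rw [pow_add]; ring

/-- The quotient x² S/T, with S the partial sum and T the tail, is (S/x^(k-1)) / (T/x^(k+1)), a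
decreasing function over an increasing one. -/
lemma sq_mul_expPartial_mul_expTail_le {k : ℕ} (hk : 1 ≤ k) {x y : ℝ} (hx : 0 < x)
    (hxy : x ≤ y) :
    y ^ 2 * expPartial k y * expTail (k + 1) x ≤ x ^ 2 * expPartial k x * expTail (k + 1) y := by
  obtain ⟨m, rfl⟩ : ∃ m, k = m + 1 := ⟨k - 1, by omega⟩
  have hy : 0 < y := hx.trans_le hxy
  have h1 := expTail_mul_le (m := m + 1 + 1) hx.le hxy
  have h2 := expPartial_mul_le (m := m) hx.le hxy
  have h3 := mul_le_mul h2 h1 (mul_nonneg (by positivity) (expTail_pos _ hx).le)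
    (mul_nonneg (by positivity) (expPartial_pos (by omega) hx.le).le)
  have hpos : 0 < x ^ m * y ^ m := by positivity
  refine le_of_mul_le_mul_left ?_ hpos
  calc _ = x ^ m * expPartial (m + 1) y * (y ^ (m + 1 + 1) * expTail (m + 1 + 1) x) := by ring
    _ ≤ _ := h3
    _ = _ := by ring

/-- The real value of `W_k`. -/
def weight (k : ℕ) : ℝ := k * expPartial k k / expTail (k + 1) k

lemma weight_pos {k : ℕ} (hk : 1 ≤ k) : 0 < weight k := by
  have hk0 : (0 : ℝ) < k := by exact_mod_cast hk
  exact div_pos (mul_pos hk0 (expPartial_pos hk hk0.le)) (expTail_pos _ hk0)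

/-- The limit value of the policies with demand `x` in the first example. -/
def limitValue (k : ℕ) (x : ℝ) : ℝ := (weight k + x) * poisMin k x / x

lemma hasDerivAt_limitValue {k : ℕ} (hk : 1 ≤ k) {x : ℝ} (hx : 0 < x) :
    HasDerivAt (limitValue k)
      (Real.exp (-x) * (expPartial k x - weight k * k * expTail (k + 1) x / x ^ 2)) x := by
  have h1 := ((hasDerivAt_id x).const_add (weight k)).mul (hasDerivAt_poisMin k hk x)
  refine (h1.div (hasDerivAt_id x) hx.ne').congr_deriv ?_
  simp only [Pi.mul_apply, id]
  have he : Real.exp x = (Real.exp (-x))⁻¹ := by rw [Real.exp_neg, inv_inv]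
  have hne : Real.exp (-x) ≠ 0 := (Real.exp_pos _).ne'
  rw [expTail, he, poisMin_eq_expPartial]
  field_simp
  ring

/-- The derivative has the sign of x² S/T - k W_k. This quotient decreases, and `weight` is defined
so that the difference vanishes at x = k: the objective rises before k and falls after it. -/
lemma limitValue_le {k : ℕ} (hk : 1 ≤ k) {x : ℝ} (hx : 0 < x) :
    limitValue k x ≤ limitValue k k := by
  have hk0 : (0 : ℝ) < k := by exact_mod_cast hk
  have hT := expTail_pos (k + 1) hk0
  have hW : ∀ y : ℝ, weight k * k * expTail (k + 1) y / y ^ 2 =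
      (k : ℝ) ^ 2 * expPartial k k * expTail (k + 1) y / (y ^ 2 * expTail (k + 1) k) := by
    intro y
    rw [weight]
    field_simp
  have hcont : ∀ s ⊆ Set.Ioi (0 : ℝ), ContinuousOn (limitValue k) s := fun s hs y hy =>
    (hasDerivAt_limitValue hk (hs hy)).continuousAt.continuousWithinAt
  rcases le_total x k with h | h
  · have hs : Set.Icc x (k : ℝ) ⊆ Set.Ioi 0 := fun y hy => hx.trans_le hy.1
    refine monotoneOn_of_deriv_nonneg (convex_Icc x (k : ℝ)) (hcont _ hs) (fun y hy => ?_)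
      (fun y hy => ?_) (Set.left_mem_Icc.2 h) (Set.right_mem_Icc.2 h) h
    · exact (hasDerivAt_limitValue hk
        (hs (interior_subset hy))).differentiableAt.differentiableWithinAt
    · have hy' := interior_subset hy
      have hy0 : 0 < y := hs hy'
      rw [(hasDerivAt_limitValue hk hy0).deriv, hW]
      refine mul_nonneg (Real.exp_pos _).le (sub_nonneg.2 ?_)
      rw [div_le_iff₀ (by positivity)]
      have := sq_mul_expPartial_mul_expTail_le hk hy0 hy'.2
      linarith
  · have hs : Set.Icc (k : ℝ) x ⊆ Set.Ioi 0 := fun y hy => hk0.trans_le hy.1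
    refine antitoneOn_of_deriv_nonpos (convex_Icc (k : ℝ) x) (hcont _ hs) (fun y hy => ?_)
      (fun y hy => ?_) (Set.left_mem_Icc.2 h) (Set.right_mem_Icc.2 h) h
    · exact (hasDerivAt_limitValue hk
        (hs (interior_subset hy))).differentiableAt.differentiableWithinAt
    · have hy' := interior_subset hy
      have hy0 : 0 < y := hs hy'
      rw [(hasDerivAt_limitValue hk hy0).deriv, hW]
      refine mul_nonpos_of_nonneg_of_nonpos (Real.exp_pos _).le (sub_nonpos.2 ?_)
      rw [le_div_iff₀ (by positivity)]
      have := sq_mul_expPartial_mul_expTail_le hk hk0 hy'.1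
      linarith

lemma limitValue_self {k : ℕ} (hk : 1 ≤ k) : limitValue k k = (weight k + k) * gam k := by
  have hk0 : (0 : ℝ) < k := by exact_mod_cast hk
  rw [limitValue, poisMin_self]
  field_simp

lemma poisMin_nonneg (k : ℕ) {x : ℝ} (hx : 0 ≤ x) : 0 ≤ poisMin k x := by
  rw [poisMin_eq]
  have h1 : ∑ i ∈ Finset.range k, ((k : ℝ) - i) * (x ^ i / (i.factorial : ℝ)) ≤
      k * Real.exp x := by
    calc _ ≤ ∑ i ∈ Finset.range k, (k : ℝ) * (x ^ i / (i.factorial : ℝ)) := by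
          refine Finset.sum_le_sum fun i _ => mul_le_mul_of_nonneg_right ?_ (by positivity)
          have : (0 : ℝ) ≤ i := Nat.cast_nonneg i
          linarith
      _ = k * ∑ i ∈ Finset.range k, x ^ i / (i.factorial : ℝ) := by rw [Finset.mul_sum]
      _ ≤ _ := mul_le_mul_of_nonneg_left (Real.sum_le_exp_of_nonneg hx k) (Nat.cast_nonneg k)
  have h2 := mul_le_mul_of_nonneg_left h1 (Real.exp_pos (-x)).le
  have h3 : Real.exp (-x) * (k * Real.exp x) = k := by
    rw [Real.exp_neg]; field_simp
  linarith

/-- Comparison with x → ∞, where all supply goes to values 1; needed for policies of large demand.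
-/
lemma cast_le_limitValue {k : ℕ} (hk : 1 ≤ k) : (k : ℝ) ≤ limitValue k k := by
  have hlim : Tendsto (poisMin k) atTop (nhds k) := by
    have h0 : Tendsto (fun x : ℝ => ∑ i ∈ Finset.range k,
        ((k : ℝ) - i) * (Real.exp (-x) * x ^ i / (i.factorial : ℝ))) atTop (nhds 0) := by
      have : (0 : ℝ) = ∑ i ∈ Finset.range k, ((k : ℝ) - i) * (0 / (i.factorial : ℝ)) := by simp
      rw [this]
      refine tendsto_finsetSum _ fun i _ => Tendsto.const_mul _ (Tendsto.div_const ?_ _)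
      simpa [mul_comm] using Real.tendsto_pow_mul_exp_neg_atTop_nhds_zero i
    have h1 := h0.const_sub (k : ℝ)
    rw [sub_zero] at h1
    exact h1
  refine le_of_tendsto hlim ?_
  filter_upwards [eventually_gt_atTop 0] with x hx
  refine le_trans ?_ (limitValue_le hk hx)
  rw [limitValue, le_div_iff₀ hx]
  nlinarith [poisMin_nonneg k hx.le, weight_pos hk]

lemma poisMin_zero {k : ℕ} (hk : 1 ≤ k) : poisMin k 0 = 0 := by
  obtain ⟨m, rfl⟩ : ∃ m, k = m + 1 := ⟨k - 1, by omega⟩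
  rw [poisMin_eq, Finset.sum_range_succ']
  simp

/-- Comparison with x → 0, where `poisMin k x / x` tends to 1; needed for policies of small demand.
-/
lemma weight_le_limitValue {k : ℕ} (hk : 1 ≤ k) : weight k ≤ limitValue k k := by
  have hd := (hasDerivAt_poisMin k hk 0).tendsto_slope_zero_right
  have hS : expPartial k 0 = 1 := by
    obtain ⟨m, rfl⟩ : ∃ m, k = m + 1 := ⟨k - 1, by omega⟩
    rw [expPartial, Finset.sum_range_succ']
    simp
  simp only [zero_add, poisMin_zero hk, sub_zero, neg_zero, Real.exp_zero, one_mul, hS,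
    smul_eq_mul] at hd
  have hd' := hd.const_mul (weight k)
  rw [mul_one] at hd'
  refine le_of_tendsto hd' ?_
  filter_upwards [self_mem_nhdsWithin] with x hx
  have hx : 0 < x := hx
  refine le_trans ?_ (limitValue_le hk hx)
  rw [limitValue, le_div_iff₀ hx]
  have : weight k * (x⁻¹ * poisMin k x) * x = weight k * poisMin k x := by field_simp
  rw [this]
  nlinarith [poisMin_nonneg k hx.le]

/-- A Poisson approximation with explicit error, uniform in q for bounded n q. Bernoulli's
inequality handles the falling factorial, and 1 - q ≥ (1 - q²) e^(-q) handles the failures. -/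
lemma binomPmf_ge {k n i : ℕ} (hn : 1 ≤ n) (hi : i < k) (hkn : k ≤ n) {q : ℝ} (h0 : 0 ≤ q)
    (h1 : q ≤ 1) :
    (1 - ((k : ℝ) ^ 2 + (n * q) ^ 2) / n) *
      (Real.exp (-(n * q)) * (n * q) ^ i / (i.factorial : ℝ)) ≤ binomPmf n q i := by
  have hn0 : (0 : ℝ) < n := by exact_mod_cast hn
  have hin : i ≤ n := by omega
  have hA : (1 - (k : ℝ) ^ 2 / n) * ((n * q) ^ i / (i.factorial : ℝ)) ≤ n.choose i * q ^ i := by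
    have hd : ((n : ℝ) - i) ^ i ≤ n.descFactorial i := by
      have h := Nat.pow_sub_le_descFactorial n i
      have h' : (n - i) ^ i ≤ n.descFactorial i :=
        (Nat.pow_le_pow_left (by omega) i).trans h
      rw [← Nat.cast_sub hin]
      exact_mod_cast h'
    have hb : 1 + (i : ℝ) * (-(i / n)) ≤ (1 + -((i : ℝ) / n)) ^ i := by
      refine one_add_mul_le_pow ?_ i
      have : (i : ℝ) / n ≤ 1 := by
        rw [div_le_one hn0]; exact_mod_cast hin
      linarith
    have hik : (i : ℝ) ^ 2 ≤ (k : ℝ) ^ 2 := by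
      have : (i : ℝ) ≤ k := by exact_mod_cast hi.le
      gcongr
    have hb' : 1 - (k : ℝ) ^ 2 / n ≤ (1 + -((i : ℝ) / n)) ^ i := by
      refine le_trans ?_ hb
      have : (i : ℝ) ^ 2 / n ≤ (k : ℝ) ^ 2 / n := by gcongr
      have e : (i : ℝ) * (-(i / n)) = -((i : ℝ) ^ 2 / n) := by ring
      rw [e]; linarith
    have hc : (n.choose i : ℝ) = n.descFactorial i / i.factorial := by
      rw [Nat.descFactorial_eq_factorial_mul_choose]
      push_cast
      field_simp
    calc (1 - (k : ℝ) ^ 2 / n) * ((n * q) ^ i / (i.factorial : ℝ))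
        ≤ (1 + -((i : ℝ) / n)) ^ i * ((n * q) ^ i / (i.factorial : ℝ)) :=
          mul_le_mul_of_nonneg_right hb' (by positivity)
      _ = ((n : ℝ) - i) ^ i * (q ^ i / (i.factorial : ℝ)) := by
          have : (n : ℝ) - i = (1 + -((i : ℝ) / n)) * n := by field_simp; ring
          rw [this, mul_pow, mul_pow]; ring
      _ ≤ n.descFactorial i * (q ^ i / (i.factorial : ℝ)) :=
          mul_le_mul_of_nonneg_right hd (by positivity)
      _ = _ := by rw [hc]; ring
  have hB : (1 - (n * q) ^ 2 / n) * Real.exp (-(n * q)) ≤ (1 - q) ^ (n - i) := by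
    have hq : (1 - q ^ 2) * Real.exp (-q) ≤ 1 - q := by
      have he := Real.add_one_le_exp q
      have h2 : (1 - q) * (1 + q) ≤ (1 - q) * Real.exp q :=
        mul_le_mul_of_nonneg_left (by linarith) (by linarith)
      have h3 := mul_le_mul_of_nonneg_right h2 (Real.exp_pos (-q)).le
      rw [mul_assoc (1 - q) (Real.exp q), ← Real.exp_add, add_neg_cancel, Real.exp_zero,
        mul_one] at h3
      refine le_trans (le_of_eq ?_) h3
      ring
    have hq2 : q ^ 2 ≤ 1 := by nlinarith
    have hb : 1 + (n : ℝ) * (-(q ^ 2)) ≤ (1 + -(q ^ 2)) ^ n :=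
      one_add_mul_le_pow (by linarith) n
    calc (1 - (n * q) ^ 2 / n) * Real.exp (-(n * q))
        = (1 + (n : ℝ) * (-(q ^ 2))) * Real.exp (-(n * q)) := by field_simp; ring
      _ ≤ (1 + -(q ^ 2)) ^ n * Real.exp (-(n * q)) :=
          mul_le_mul_of_nonneg_right hb (Real.exp_pos _).le
      _ = ((1 - q ^ 2) * Real.exp (-q)) ^ n := by
          rw [mul_pow, ← Real.exp_nat_mul, mul_neg, sub_eq_add_neg]
      _ ≤ (1 - q) ^ n :=
          pow_le_pow_left₀ (mul_nonneg (by linarith) (Real.exp_pos _).le) hq n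
      _ ≤ (1 - q) ^ (n - i) :=
          pow_le_pow_of_le_one (by linarith) (by linarith) (Nat.sub_le _ _)
  have hP : 0 ≤ (n * q) ^ i / (i.factorial : ℝ) := by positivity
  have hR := (Real.exp_pos (-(n * q))).le
  have hpmf : binomPmf n q i = (n.choose i * q ^ i) * (1 - q) ^ (n - i) := rfl
  have hx : 0 ≤ (k : ℝ) ^ 2 / n := by positivity
  have hy : 0 ≤ (n * q) ^ 2 / n := by positivity
  rw [hpmf, add_div]
  set x := (k : ℝ) ^ 2 / n
  set y := (n * q) ^ 2 / n
  have e : Real.exp (-(n * q)) * (n * q) ^ i / (i.factorial : ℝ) =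
    (n * q) ^ i / (i.factorial : ℝ) * Real.exp (-(n * q)) := by ring
  rw [e]
  set P := (n * q) ^ i / (i.factorial : ℝ)
  set R := Real.exp (-(n * q))
  have hPR : 0 ≤ P * R := mul_nonneg hP hR
  have hAB : 0 ≤ n.choose i * q ^ i * (1 - q) ^ (n - i) := by
    have := sub_nonneg.2 h1
    positivity
  rcases le_total (1 - (x + y)) 0 with h | h
  · exact (mul_nonpos_of_nonpos_of_nonneg h hPR).trans hAB
  · have h3 := mul_le_mul hA hB (mul_nonneg (by linarith) hR) (by positivity)
    refine le_trans ?_ h3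
    have : (1 - x) * P * ((1 - y) * R) = (1 - (x + y)) * (P * R) + x * y * (P * R) := by ring
    rw [this]
    have := mul_nonneg (mul_nonneg hx hy) hPR
    linarith

lemma binMin_le {k n : ℕ} (hn : 1 ≤ n) (hkn : k ≤ n) {q : ℝ} (h0 : 0 ≤ q) (h1 : q ≤ 1) :
    binMin k n q ≤ poisMin k (n * q) + k * (((k : ℝ) ^ 2 + (n * q) ^ 2) / n) := by
  set e := ((k : ℝ) ^ 2 + (n * q) ^ 2) / n with he
  have he0 : 0 ≤ e := by positivity
  have hsum : (1 - e) * ∑ i ∈ Finset.range k, ((k : ℝ) - i) *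
      (Real.exp (-(n * q)) * (n * q) ^ i / (i.factorial : ℝ)) ≤
      ∑ i ∈ Finset.range k, ((k : ℝ) - i) * binomPmf n q i := by
    rw [Finset.mul_sum]
    refine Finset.sum_le_sum fun i hi => ?_
    have hik := Finset.mem_range.1 hi
    have : (0 : ℝ) ≤ (k : ℝ) - i := by
      have : (i : ℝ) ≤ k := by exact_mod_cast hik.le
      linarith
    have := mul_le_mul_of_nonneg_left (binomPmf_ge hn hik hkn h0 h1) this
    linarith
  have hM := poisMin_nonneg k (by positivity : 0 ≤ (n : ℝ) * q)
  have hdef : ∑ i ∈ Finset.range k, ((k : ℝ) - i) *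
      (Real.exp (-(n * q)) * (n * q) ^ i / (i.factorial : ℝ)) = k - poisMin k (n * q) := by
    rw [poisMin]; ring
  rw [hdef] at hsum
  rw [binMin]
  nlinarith

lemma ev_share_le_one (k n : ℕ) {q : ℝ} (h0 : 0 ≤ q) (h1 : q ≤ 1) :
    ev (share k) (bern q ^ n) ≤ 1 := by
  rw [← ev_bern_pow_one n q]
  have := coeff_prod_bern_nonneg (Finset.range n) (p := fun _ => q) (fun _ => ⟨h0, h1⟩)
  rw [Finset.prod_const, Finset.card_range] at this
  exact ev_mono (share_le_one k) this

lemma binMin_le_cast (k n : ℕ) {q : ℝ} (h0 : 0 ≤ q) (h1 : q ≤ 1) : binMin k n q ≤ k := by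
  rw [binMin, sub_le_self_iff]
  refine Finset.sum_nonneg fun i hi => mul_nonneg ?_ (binomPmf_nonneg h0 h1 _ _)
  have : (i : ℝ) ≤ k := by exact_mod_cast (Finset.mem_range.1 hi).le
  linarith

/-- In the first example, no policy is asymptotically better than `(W_k + k) γ_k`, uniformly in
the eligibility probability `q`. -/
theorem exists_forall_value_le {k : ℕ} (hk : 1 ≤ k) {η : ℝ} (hη : 0 < η) :
    ∃ N : ℕ, ∀ n : ℕ, N ≤ n → ∀ q : ℝ, 0 ≤ q → q ≤ 1 →
      (weight k + n * q) * ev (share k) (bern q ^ (n - 1)) ≤ (weight k + k) * gam k + η := by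
  have hk0 : (0 : ℝ) < k := by exact_mod_cast hk
  have hW := weight_pos hk
  set W := weight k with hWdef
  -- Above demand Λ the share is at most k/Λ, so the term with W is at most η. Below demand η the
  -- term in x is at most η. The Poisson approximation is needed only in between, where x is bounded
  -- and (W + x)/x ≤ (W + η)/η.
  set Λ := W * k / η with hΛ
  have hΛ0 : 0 < Λ := by positivity
  obtain ⟨N₀, hN₀⟩ := exists_nat_gt ((W + η) / η * (k * ((k : ℝ) ^ 2 + Λ ^ 2)) / η)
  refine ⟨max N₀ k, fun n hn q h0 h1 => ?_⟩
  have hkn : k ≤ n := (le_max_right _ _).trans hn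
  have hn1 : 1 ≤ n := hk.trans hkn
  have hn0 : (0 : ℝ) < n := by exact_mod_cast hn1
  have hNn : (N₀ : ℝ) ≤ n := by exact_mod_cast (le_max_left _ _).trans hn
  have hid : (n : ℝ) * q * ev (share k) (bern q ^ (n - 1)) = binMin k n q := by
    have := mul_ev_share k (n - 1) q
    rw [Nat.cast_sub hn1, Nat.cast_one, sub_add_cancel, Nat.sub_add_cancel hn1] at this
    exact this
  have hα1 := ev_share_le_one k (n - 1) h0 h1
  have hMk := binMin_le_cast k n h0 h1
  rw [← limitValue_self hk]
  set α := ev (share k) (bern q ^ (n - 1)) with hα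
  have hx0 : 0 ≤ n * q := by positivity
  have hMle := binMin_le hn1 hkn h0 h1
  set x := n * q with hx
  have hsplit : (W + x) * α = W * α + binMin k n q := by rw [← hid]; ring
  rcases le_total x η with hsmall | hbig
  · have h2 := weight_le_limitValue hk
    have : W * α ≤ W := by nlinarith
    have : binMin k n q ≤ x := by rw [← hid]; nlinarith
    rw [hsplit]
    linarith
  have hxpos : 0 < x := hη.trans_le hbig
  have hαx : α = binMin k n q / x := by rw [← hid]; field_simp
  rcases le_total Λ x with hlarge | hmid
  · have h2 := cast_le_limitValue hk
    have h3 : W * α ≤ η := by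
      rw [hαx, ← mul_div_assoc, div_le_iff₀ hxpos]
      have h4 : W * binMin k n q ≤ W * k := mul_le_mul_of_nonneg_left hMk hW.le
      have h5 : W * k = η * Λ := by rw [hΛ]; field_simp
      have h6 : η * Λ ≤ η * x := mul_le_mul_of_nonneg_left hlarge hη.le
      linarith
    rw [hsplit]
    linarith
  · have hJ := limitValue_le hk hxpos
    have he : k * (((k : ℝ) ^ 2 + x ^ 2) / n) ≤ k * ((k : ℝ) ^ 2 + Λ ^ 2) / n := by
      rw [mul_div_assoc]
      gcongr
    have hratio : (W + x) / x ≤ (W + η) / η := by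
      rw [div_le_div_iff₀ hxpos hη]
      nlinarith
    have hval : (W + x) * α ≤ limitValue k x + (W + x) / x * (k * ((k : ℝ) ^ 2 + Λ ^ 2) / n) := by
      rw [hαx, limitValue, ← hWdef]
      have : (W + x) * (binMin k n q / x) = (W + x) / x * binMin k n q := by ring
      rw [this]
      have h7 : (W + x) * poisMin k x / x = (W + x) / x * poisMin k x := by ring
      rw [h7, ← mul_add]
      exact mul_le_mul_of_nonneg_left (by linarith) (by positivity)
    have hlast : (W + x) / x * (k * ((k : ℝ) ^ 2 + Λ ^ 2) / n) ≤ η := by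
      have h8 : (W + x) / x * (k * ((k : ℝ) ^ 2 + Λ ^ 2) / n) ≤
          (W + η) / η * (k * ((k : ℝ) ^ 2 + Λ ^ 2) / n) :=
        mul_le_mul_of_nonneg_right hratio (by positivity)
      refine h8.trans ?_
      rw [← mul_div_assoc, div_le_iff₀ hn0, ← div_le_iff₀' hη]
      exact hN₀.le.trans hNn
    linarith

/-! ### Random arrival order -/

section Arrival

variable {n : ℕ}

lemma accepted_subset (k : ℕ) (τ : Equiv.Perm (Fin n)) (S : Finset (Fin n)) :
    accepted k τ S ⊆ S := Finset.filter_subset _ _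

lemma card_accepted (k : ℕ) (τ : Equiv.Perm (Fin n)) (S : Finset (Fin n)) :
    (accepted k τ S).card = min k S.card := by
  classical
  -- The rank by arrival within S maps S bijectively onto 0, ..., |S| - 1, and the accepted
  -- applicants are those of rank below k.
  set r : Fin n → ℕ := fun i => (S.filter fun j => τ j < τ i).card with hr
  have hlt : ∀ i ∈ S, ∀ j ∈ S, τ i < τ j → r i < r j := by
    intro i hi j hj hij
    refine Finset.card_lt_card ⟨?_, ?_⟩
    · intro x hx
      rw [Finset.mem_filter] at hx ⊢
      exact ⟨hx.1, hx.2.trans hij⟩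
    · intro h
      have := h (Finset.mem_filter.2 ⟨hi, hij⟩)
      exact lt_irrefl _ (Finset.mem_filter.1 this).2
  have hinj : Set.InjOn r S := by
    intro i hi j hj hij
    rcases lt_trichotomy (τ i) (τ j) with h | h | h
    · exact absurd hij (hlt i hi j hj h).ne
    · exact τ.injective h
    · exact absurd hij (hlt j hj i hi h).ne'
  have himg : S.image r = Finset.range S.card := by
    refine Finset.eq_of_subset_of_card_le ?_ ?_
    · intro x hx
      obtain ⟨i, hi, rfl⟩ := Finset.mem_image.1 hx
      rw [Finset.mem_range]
      refine Finset.card_lt_card ⟨Finset.filter_subset _ _, fun h => ?_⟩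
      exact lt_irrefl _ (Finset.mem_filter.1 (h hi)).2
    · rw [Finset.card_range, Finset.card_image_of_injOn hinj]
  have hacc : (accepted k τ S).image r = Finset.range (min k S.card) := by
    ext x
    rw [Finset.mem_image, Finset.mem_range, lt_min_iff]
    constructor
    · rintro ⟨i, hi, rfl⟩
      have hi' := Finset.mem_filter.1 hi
      refine ⟨hi'.2, ?_⟩
      rw [← Finset.mem_range, ← himg]
      exact Finset.mem_image_of_mem _ hi'.1
    · rintro ⟨h1, h2⟩
      rw [← Finset.mem_range, ← himg] at h2
      obtain ⟨i, hi, rfl⟩ := Finset.mem_image.1 h2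
      exact ⟨i, Finset.mem_filter.2 ⟨hi, h1⟩, rfl⟩
  rw [← Finset.card_range (min k S.card), ← hacc, Finset.card_image_of_injOn]
  exact hinj.mono (accepted_subset k τ S)

/-- Exchanging the positions of two members of S carries the predecessors of one to those of the
other. Hence all members are accepted in equally many orders, and double counting gives that number.
-/
lemma mem_accepted_mul_swap (k : ℕ) (τ : Equiv.Perm (Fin n)) {S : Finset (Fin n)} {i j : Fin n}
    (hi : i ∈ S) (hj : j ∈ S) :
    i ∈ accepted k (τ * Equiv.swap i j) S ↔ j ∈ accepted k τ S := by
  have hS : ∀ x, Equiv.swap i j x ∈ S ↔ x ∈ S := by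
    intro x
    by_cases h1 : x = i
    · rw [h1, Equiv.swap_apply_left]; exact ⟨fun _ => hi, fun _ => hj⟩
    by_cases h2 : x = j
    · rw [h2, Equiv.swap_apply_right]; exact ⟨fun _ => hj, fun _ => hi⟩
    rw [Equiv.swap_apply_of_ne_of_ne h1 h2]
  have hcard : (S.filter fun x => (τ * Equiv.swap i j) x < (τ * Equiv.swap i j) i).card =
      (S.filter fun x => τ x < τ j).card := by
    refine Finset.card_bij (fun x _ => Equiv.swap i j x) (fun x hx => ?_)
      (fun x _ y _ h => (Equiv.swap i j).injective h) fun y hy => ?_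
    · rw [Finset.mem_filter] at hx ⊢
      refine ⟨(hS x).2 hx.1, ?_⟩
      simpa using hx.2
    · rw [Finset.mem_filter] at hy
      refine ⟨Equiv.swap i j y, Finset.mem_filter.2 ⟨(hS y).2 hy.1, ?_⟩, by simp⟩
      simpa using hy.2
  rw [accepted, accepted, Finset.mem_filter, Finset.mem_filter, hcard]
  exact and_congr_left fun _ => ⟨fun _ => hj, fun _ => hi⟩

/-- The number of arrival orders in which an eligible applicant is accepted. -/
lemma card_filter_mem_accepted (k : ℕ) {S : Finset (Fin n)} {i : Fin n} (hi : i ∈ S) :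
    (Finset.univ.filter fun τ : Equiv.Perm (Fin n) => i ∈ accepted k τ S).card * S.card =
      Fintype.card (Equiv.Perm (Fin n)) * min k S.card := by
  have hsym : ∀ j ∈ S, (Finset.univ.filter fun τ : Equiv.Perm (Fin n) => j ∈ accepted k τ S).card =
      (Finset.univ.filter fun τ : Equiv.Perm (Fin n) => i ∈ accepted k τ S).card := by
    intro j hj
    refine Finset.card_bij (fun τ _ => τ * Equiv.swap i j) (fun τ hτ => ?_)
      (fun τ _ τ' _ h => mul_right_cancel h) fun τ hτ => ?_
    · rw [Finset.mem_filter] at hτ ⊢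
      exact ⟨Finset.mem_univ _, (mem_accepted_mul_swap k τ hi hj).2 hτ.2⟩
    · rw [Finset.mem_filter] at hτ
      refine ⟨τ * Equiv.swap i j, Finset.mem_filter.2 ⟨Finset.mem_univ _, ?_⟩, ?_⟩
      · rw [← mem_accepted_mul_swap k _ hi hj, mul_assoc, Equiv.swap_mul_self, mul_one]
        exact hτ.2
      · rw [mul_assoc, Equiv.swap_mul_self, mul_one]
  have h1 : ∑ j ∈ S, (Finset.univ.filter fun τ : Equiv.Perm (Fin n) => j ∈ accepted k τ S).card =
      ∑ τ : Equiv.Perm (Fin n), (accepted k τ S).card := by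
    simp only [Finset.card_filter]
    rw [Finset.sum_comm]
    refine Finset.sum_congr rfl fun τ _ => ?_
    rw [← Finset.card_filter]
    congr 1
    ext x
    rw [Finset.mem_filter]
    exact ⟨fun h => h.2, fun h => ⟨accepted_subset k τ S h, h⟩⟩
  rw [Finset.sum_congr rfl hsym, Finset.sum_const, smul_eq_mul] at h1
  rw [mul_comm, h1, Finset.sum_congr rfl fun τ _ => card_accepted k τ S, Finset.sum_const,
    smul_eq_mul, Finset.card_univ]

lemma card_filter_div_card (k : ℕ) {S : Finset (Fin n)} {i : Fin n} (hi : i ∈ S) :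
    ((Finset.univ.filter fun τ : Equiv.Perm (Fin n) => i ∈ accepted k τ S).card : ℝ≥0∞) /
      (Fintype.card (Equiv.Perm (Fin n)) : ℝ≥0∞) = ENNReal.ofReal (share k (S.card - 1)) := by
  have h := card_filter_mem_accepted k hi
  have hS : 0 < S.card := Finset.card_pos.2 ⟨i, hi⟩
  have hn : 0 < Fintype.card (Equiv.Perm (Fin n)) := Fintype.card_pos
  set c := (Finset.univ.filter fun τ : Equiv.Perm (Fin n) => i ∈ accepted k τ S).card
  set m := Fintype.card (Equiv.Perm (Fin n))
  have hm0 : (0 : ℝ) < m := by exact_mod_cast hn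
  have hS0 : (0 : ℝ) < S.card := by exact_mod_cast hS
  have hreal : share k (S.card - 1) = (c : ℝ) / m := by
    rw [share, Nat.cast_sub hS, Nat.cast_one, sub_add_cancel, div_eq_div_iff hS0.ne' hm0.ne']
    have : (c : ℝ) * S.card = m * min (k : ℝ) S.card := by exact_mod_cast h
    linarith
  rw [hreal, ENNReal.ofReal_div_of_pos hm0, ENNReal.ofReal_natCast, ENNReal.ofReal_natCast]

end Arrival

/-! ### Eligibility and the performance formula -/

/-- The observations which make an applicant eligible. -/
def eligSet (π : Policy) : Set (ℝ≥0 × Bool) := {x | π.t < x.1 ∨ (x.1 = π.t ∧ x.2 = true)}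

lemma measurableSet_eligSet (π : Policy) : MeasurableSet (eligSet π) := by
  have : eligSet π = Prod.fst ⁻¹' Set.Ioi π.t ∪ (Prod.fst ⁻¹' {π.t} ∩ Prod.snd ⁻¹' {true}) := rfl
  rw [this]
  exact (measurable_fst measurableSet_Ioi).union
    ((measurable_fst (measurableSet_singleton _)).inter
      (measurable_snd (measurableSet_singleton _)))

instance (μ : Measure ℝ≥0) [IsProbabilityMeasure μ] (p : I) :
    IsProbabilityMeasure (applicantLaw μ p) := by
  unfold applicantLaw; infer_instance

/-- The probability that an applicant is eligible. -/
def eligProb (μ : Measure ℝ≥0) (π : Policy) : ℝ := (applicantLaw μ π.p).real (eligSet π)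

/-- The expected value of an applicant, counted as zero if the applicant is not eligible. -/
def eligValue (μ : Measure ℝ≥0) (π : Policy) : ℝ≥0∞ :=
  ∫⁻ x in eligSet π, (x.1 : ℝ≥0∞) ∂(applicantLaw μ π.p)

lemma eligProb_mem (μ : Measure ℝ≥0) [IsProbabilityMeasure μ] (π : Policy) :
    eligProb μ π ∈ Set.Icc (0 : ℝ) 1 := ⟨measureReal_nonneg, measureReal_le_one⟩

lemma ofReal_eligProb (μ : Measure ℝ≥0) [IsProbabilityMeasure μ] (π : Policy) :
    ENNReal.ofReal (eligProb μ π) = applicantLaw μ π.p (eligSet π) :=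
  ofReal_measureReal

lemma ofReal_one_sub_eligProb (μ : Measure ℝ≥0) [IsProbabilityMeasure μ] (π : Policy) :
    ENNReal.ofReal (1 - eligProb μ π) = applicantLaw μ π.p (eligSet π)ᶜ := by
  rw [eligProb, ← probReal_compl_eq_one_sub (measurableSet_eligSet π)]
  exact ofReal_measureReal

lemma mem_eligible {n : ℕ} (π : Policy) (ω : Fin n → ℝ≥0 × Bool) (i : Fin n) :
    i ∈ eligible π ω ↔ ω i ∈ eligSet π := by
  simp [eligible, eligSet]

/-- Fubini for products of functions of single coordinates. -/
lemma lintegral_pi_prod {ι : Type*} [Fintype ι] {α : Type*} [MeasurableSpace α]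
    (μ : ι → Measure α) [∀ i, IsProbabilityMeasure (μ i)] {g : ι → α → ℝ≥0∞}
    (hg : ∀ i, Measurable (g i)) :
    ∫⁻ ω, ∏ i, g i (ω i) ∂(Measure.pi μ) = ∏ i, ∫⁻ x, g i x ∂(μ i) := by
  have h := lintegral_prod_eq_prod_lintegral_of_indepFun Finset.univ
    (fun i (ω : ι → α) => g i (ω i))
    (iIndepFun_pi (μ := μ) (X := fun i => g i) fun i => (hg i).aemeasurable)
    (fun i => (hg i).comp (measurable_pi_apply i))
  rw [h]
  refine Finset.prod_congr rfl fun i _ => ?_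
  exact (measurePreserving_eval μ i).lintegral_comp (hg i)

section Performance

variable {n : ℕ} (F : Fin n → Measure ℝ≥0) [∀ i, IsProbabilityMeasure (F i)] (π : Policy)

lemma expectedDemand_eq :
    expectedDemand F π = ENNReal.ofReal (∑ i, eligProb (F i) π) := by
  classical
  have h : ∀ ω : Fin n → ℝ≥0 × Bool, ((eligible π ω).card : ℝ≥0∞) =
      ∑ i, (eligSet π).indicator (fun _ => (1 : ℝ≥0∞)) (ω i) := by
    intro ω
    rw [Finset.card_eq_sum_ones]
    push_cast
    rw [← Finset.sum_filter_add_sum_filter_not Finset.univ (fun i => i ∈ eligible π ω)]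
    have h1 : ∑ i with i ∉ eligible π ω,
        (eligSet π).indicator (fun _ => (1 : ℝ≥0∞)) (ω i) = 0 := by
      refine Finset.sum_eq_zero fun i hi => ?_
      rw [Finset.mem_filter, mem_eligible] at hi
      exact Set.indicator_of_notMem hi.2 _
    rw [h1, add_zero]
    have h2 : (Finset.univ.filter fun i => i ∈ eligible π ω) = eligible π ω := by ext; simp
    rw [h2]
    refine Finset.sum_congr rfl fun i hi => ?_
    rw [mem_eligible] at hi
    rw [Set.indicator_of_mem hi]
  have hm : Measurable ((eligSet π).indicator (fun _ => (1 : ℝ≥0∞))) :=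
    measurable_const.indicator (measurableSet_eligSet π)
  have hm' : ∀ i : Fin n, Measurable fun ω : Fin n → ℝ≥0 × Bool =>
      (eligSet π).indicator (fun _ => (1 : ℝ≥0∞)) (ω i) :=
    fun i => hm.comp (measurable_pi_apply i)
  rw [expectedDemand, lintegral_congr h, lintegral_finsetSum _ fun i _ => hm' i, ENNReal.ofReal_sum_of_nonneg fun i _ => (eligProb_mem _ _).1]
  refine Finset.sum_congr rfl fun i _ => ?_
  rw [ofReal_eligProb]
  have := (measurePreserving_eval (fun i => applicantLaw (F i) π.p) i).lintegral_comp hm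
  exact this.trans (lintegral_indicator_one (measurableSet_eligSet π))

-- The integrand is a product of functions of single coordinates: the eligible value at i,
-- indicators of eligibility or its complement elsewhere. Independence then factors the integral.
open scoped Classical in
lemma lintegral_value_mul_eligible_eq {T : Finset (Fin n)} {i : Fin n} (hi : i ∈ T) :
    ∫⁻ ω, (if eligible π ω = T then ((ω i).1 : ℝ≥0∞) else 0) ∂(jointLaw F π) =
      eligValue (F i) π * ENNReal.ofReal ((∏ j ∈ T.erase i, eligProb (F j) π) *
        ∏ j ∈ (Finset.univ.erase i) \ T.erase i, (1 - eligProb (F j) π)) := by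
  set g : Fin n → ℝ≥0 × Bool → ℝ≥0∞ := fun j =>
    if j = i then (eligSet π).indicator fun x => (x.1 : ℝ≥0∞)
    else if j ∈ T then (eligSet π).indicator fun _ => 1
    else (eligSet π)ᶜ.indicator fun _ => 1 with hg
  have hgm : ∀ j, Measurable (g j) := by
    intro j
    simp only [hg]
    split_ifs
    · exact (measurable_coe_nnreal_ennreal.comp measurable_fst).indicator
        (measurableSet_eligSet π)
    · exact measurable_const.indicator (measurableSet_eligSet π)
    · exact measurable_const.indicator (measurableSet_eligSet π).compl
  have hpt : ∀ ω : Fin n → ℝ≥0 × Bool,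
      (if eligible π ω = T then ((ω i).1 : ℝ≥0∞) else 0) = ∏ j, g j (ω j) := by
    intro ω
    split_ifs with h
    · rw [← Finset.mul_prod_erase _ _ (Finset.mem_univ i)]
      have h1 : g i (ω i) = ((ω i).1 : ℝ≥0∞) := by
        rw [← h, mem_eligible] at hi
        simp only [hg, if_true, Set.indicator_of_mem hi]
      have h2 : ∏ j ∈ Finset.univ.erase i, g j (ω j) = 1 := by
        refine Finset.prod_eq_one fun j hj => ?_
        simp only [hg, if_neg (Finset.ne_of_mem_erase hj)]
        split_ifs with hjT
        · rw [← h, mem_eligible] at hjT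
          exact Set.indicator_of_mem hjT _
        · rw [← h, mem_eligible] at hjT
          exact Set.indicator_of_mem (Set.mem_compl hjT) _
      rw [h1, h2, mul_one]
    · symm
      have : ∃ j, ¬ (j ∈ eligible π ω ↔ j ∈ T) := by
        by_contra hcon
        push Not at hcon
        exact h (Finset.ext hcon)
      obtain ⟨j, hj⟩ := this
      refine Finset.prod_eq_zero (Finset.mem_univ j) ?_
      rw [mem_eligible] at hj
      by_cases hji : j = i
      · subst hji
        have : ω j ∉ eligSet π := fun h' => hj ⟨fun _ => hi, fun _ => h'⟩
        simp only [hg, if_true, Set.indicator_of_notMem this]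
      · simp only [hg, if_neg hji]
        split_ifs with hjT
        · exact Set.indicator_of_notMem (fun h' => hj ⟨fun _ => hjT, fun _ => h'⟩) _
        · refine Set.indicator_of_notMem (fun h' => hj ⟨fun h'' => absurd h'' h', fun h'' =>
            absurd h'' hjT⟩) _
  rw [lintegral_congr hpt, jointLaw, lintegral_pi_prod _ hgm,
    ← Finset.mul_prod_erase _ _ (Finset.mem_univ i)]
  congr 1
  · simp only [hg, if_true]
    rw [lintegral_indicator (measurableSet_eligSet π), eligValue]
  · have hq0 : ∀ j, 0 ≤ eligProb (F j) π := fun j => (eligProb_mem (F j) π).1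
    have hq1 : ∀ j, 0 ≤ 1 - eligProb (F j) π := fun j => by
      linarith [(eligProb_mem (F j) π).2]
    have hsub : T.erase i ⊆ Finset.univ.erase i := Finset.erase_subset_erase i (Finset.subset_univ T)
    rw [ENNReal.ofReal_mul (Finset.prod_nonneg fun j _ => hq0 j),
      ENNReal.ofReal_prod_of_nonneg fun j _ => hq0 j,
      ENNReal.ofReal_prod_of_nonneg fun j _ => hq1 j, mul_comm, ← Finset.prod_sdiff hsub]
    congr 1
    · refine Finset.prod_congr rfl fun j hj => ?_
      rw [Finset.mem_sdiff, Finset.mem_erase, Finset.mem_erase] at hj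
      have hjT : j ∉ T := fun h => hj.2 ⟨hj.1.1, h⟩
      simp only [hg, if_neg hj.1.1, if_neg hjT]
      rw [ofReal_one_sub_eligProb]
      exact lintegral_indicator_one (measurableSet_eligSet π).compl
    · refine Finset.prod_congr rfl fun j hj => ?_
      rw [Finset.mem_erase] at hj
      simp only [hg, if_neg hj.1, if_pos hj.2]
      rw [ofReal_eligProb]
      exact lintegral_indicator_one (measurableSet_eligSet π)

open scoped Classical in
/-- The performance of a policy: each applicant contributes the expected eligible value, times the
expected share for the number of other eligible applicants. -/
theorem performance_eq (k : ℕ) :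
    performance k F π = ∑ i, eligValue (F i) π *
      ENNReal.ofReal (ev (share k) (∏ j ∈ Finset.univ.erase i, bern (eligProb (F j) π))) := by
  set q : Fin n → ℝ := fun j => eligProb (F j) π with hq
  have hq0 : ∀ j, 0 ≤ q j := fun j => (eligProb_mem (F j) π).1
  have hq1 : ∀ j, 0 ≤ 1 - q j := fun j => by
    linarith [(eligProb_mem (F j) π).2]
  set A : Finset (Fin n) → Fin n → ℝ≥0∞ := fun T i =>
    eligValue (F i) π * ENNReal.ofReal ((∏ j ∈ T.erase i, q j) *
        ∏ j ∈ (Finset.univ.erase i) \ T.erase i, (1 - q j)) with hA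
  have h1 : ∀ τ : Equiv.Perm (Fin n),
      ∫⁻ ω, (∑ i ∈ accepted k τ (eligible π ω), ((ω i).1 : ℝ≥0∞)) ∂(jointLaw F π) =
        ∑ T : Finset (Fin n), ∑ i ∈ T, (if i ∈ accepted k τ T then A T i else 0) := by
    intro τ
    have hpt : ∀ ω : Fin n → ℝ≥0 × Bool,
        (∑ i ∈ accepted k τ (eligible π ω), ((ω i).1 : ℝ≥0∞)) =
        ∑ T : Finset (Fin n), ∑ i ∈ accepted k τ T,
          (if eligible π ω = T then ((ω i).1 : ℝ≥0∞) else 0) := by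
      intro ω
      rw [Finset.sum_eq_single (eligible π ω)]
      · simp
      · intro T _ hT
        exact Finset.sum_eq_zero fun i _ => if_neg (Ne.symm hT)
      · intro h; exact absurd (Finset.mem_univ _) h
    have hmeas : ∀ (T : Finset (Fin n)) (i : Fin n), Measurable fun ω : Fin n → ℝ≥0 × Bool =>
        (if eligible π ω = T then ((ω i).1 : ℝ≥0∞) else 0) := by
      intro T i
      refine Measurable.ite ?_ (measurable_coe_nnreal_ennreal.comp
        (measurable_fst.comp (measurable_pi_apply i))) measurable_const
      have : {ω : Fin n → ℝ≥0 × Bool | eligible π ω = T} =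
          ⋂ j, {ω | ω j ∈ eligSet π ↔ j ∈ T} := by
        ext ω
        simp only [Set.mem_iInter]
        constructor
        · intro h j
          have h : eligible π ω = T := h
          show ω j ∈ eligSet π ↔ j ∈ T
          rw [← h, mem_eligible]
        · intro h
          refine Finset.ext fun j => ?_
          rw [mem_eligible]
          exact h j
      rw [this]
      refine MeasurableSet.iInter fun j => ?_
      by_cases hj : j ∈ T
      · have : {ω : Fin n → ℝ≥0 × Bool | ω j ∈ eligSet π ↔ j ∈ T} =
            (fun ω => ω j) ⁻¹' eligSet π := by
          ext ω
          exact ⟨fun h => h.2 hj, fun h => ⟨fun _ => hj, fun _ => h⟩⟩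
        rw [this]
        exact measurable_pi_apply j (measurableSet_eligSet π)
      · have : {ω : Fin n → ℝ≥0 × Bool | ω j ∈ eligSet π ↔ j ∈ T} =
            (fun ω => ω j) ⁻¹' (eligSet π)ᶜ := by
          ext ω
          exact ⟨fun h h' => hj (h.1 h'), fun h => ⟨fun h' => absurd h' h, fun h' => absurd h' hj⟩⟩
        rw [this]
        exact measurable_pi_apply j (measurableSet_eligSet π).compl
    rw [lintegral_congr hpt, lintegral_finsetSum _ fun T _ =>
      Finset.measurable_sum _ fun i _ => hmeas T i]
    refine Finset.sum_congr rfl fun T _ => ?_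
    rw [lintegral_finsetSum _ fun i _ => hmeas T i, ← Finset.sum_filter]
    have : (T.filter fun i => i ∈ accepted k τ T) = accepted k τ T := by
      ext i
      rw [Finset.mem_filter]
      exact ⟨fun h => h.2, fun h => ⟨accepted_subset k τ T h, h⟩⟩
    rw [this]
    exact Finset.sum_congr rfl fun i hi =>
      lintegral_value_mul_eligible_eq F π (accepted_subset k τ T hi)
  have h2 : performance k F π =
      ∑ T : Finset (Fin n), ∑ i ∈ T, ENNReal.ofReal (share k (T.card - 1)) * A T i := by
    rw [performance, Finset.sum_congr rfl fun τ _ => h1 τ, Finset.sum_comm, ENNReal.div_eq_inv_mul,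
      Finset.mul_sum]
    refine Finset.sum_congr rfl fun T _ => ?_
    rw [Finset.sum_comm, Finset.mul_sum]
    refine Finset.sum_congr rfl fun i hi => ?_
    rw [← card_filter_div_card k hi, ← Finset.sum_filter, Finset.sum_const, nsmul_eq_mul,
      ENNReal.div_eq_inv_mul, mul_assoc]
  have h3 : ∀ i : Fin n, eligValue (F i) π *
      ENNReal.ofReal (ev (share k) (∏ j ∈ Finset.univ.erase i, bern (q j))) =
      ∑ T ∈ (Finset.univ.erase i).powerset,
        ENNReal.ofReal (share k T.card) * A (insert i T) i := by
    intro i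
    rw [ev_prod_bern, ENNReal.ofReal_sum_of_nonneg fun T _ => mul_nonneg
      (mul_nonneg (Finset.prod_nonneg fun j _ => hq0 j) (Finset.prod_nonneg fun j _ => hq1 j))
      (share_nonneg _ _), Finset.mul_sum]
    refine Finset.sum_congr rfl fun T hT => ?_
    have hiT : i ∉ T := fun h => Finset.notMem_erase i _ (Finset.mem_powerset.1 hT h)
    simp only [hA]
    rw [Finset.erase_insert hiT, ENNReal.ofReal_mul (mul_nonneg
      (Finset.prod_nonneg fun j _ => hq0 j) (Finset.prod_nonneg fun j _ => hq1 j))]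
    ring
  rw [h2, Finset.sum_congr rfl fun i _ => h3 i, Finset.sum_sigma', Finset.sum_sigma']
  -- A pair (eligible set T, member i) corresponds to the pair (i, set of eligible rivals T \ {i}).
  refine Finset.sum_bij' (fun x _ => ⟨x.2, x.1.erase x.2⟩) (fun x _ => ⟨insert x.1 x.2, x.1⟩)
    ?_ ?_ ?_ ?_ ?_
  · rintro ⟨T, i⟩ hx
    simp only [Finset.mem_sigma, Finset.mem_univ, true_and, Finset.mem_powerset]
    exact Finset.erase_subset_erase i (Finset.subset_univ T)
  · rintro ⟨i, T⟩ hx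
    simp
  · rintro ⟨T, i⟩ hx
    simp only [Finset.mem_sigma, Finset.mem_univ, true_and] at hx
    simp [Finset.insert_erase hx]
  · rintro ⟨i, T⟩ hx
    simp only [Finset.mem_sigma, Finset.mem_univ, true_and, Finset.mem_powerset] at hx
    have hiT : i ∉ T := fun h => Finset.notMem_erase i _ (hx h)
    simp [Finset.erase_insert hiT]
  · rintro ⟨T, i⟩ hx
    simp only [Finset.mem_sigma, Finset.mem_univ, true_and] at hx
    simp only [Finset.insert_erase hx, Finset.card_erase_of_mem hx]

end Performance

/-! ### Comparison with the prophet -/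

section Guarantee

variable {n : ℕ}

/-- Each chosen value is at most t plus its excess over t, and at most k values are chosen. -/
lemma topSum_le (k : ℕ) (v : Fin n → ℝ≥0) (t : ℝ≥0) :
    topSum k v ≤ k * t + ∑ i, (v i - t) := by
  refine Finset.sup_le fun S hS => ?_
  have hS' := (Finset.mem_filter.1 hS).2
  calc ∑ i ∈ S, v i ≤ ∑ i ∈ S, (t + (v i - t)) := Finset.sum_le_sum fun i _ => le_add_tsub
    _ = S.card * t + ∑ i ∈ S, (v i - t) := by
        rw [Finset.sum_add_distrib, Finset.sum_const, nsmul_eq_mul]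
    _ ≤ k * t + ∑ i, (v i - t) := by
        refine add_le_add ?_ (Finset.sum_le_sum_of_subset (Finset.subset_univ S))
        gcongr

lemma le_topSum {k : ℕ} (v : Fin n → ℝ≥0) {S : Finset (Fin n)} (hS : S.card ≤ k) :
    ∑ i ∈ S, v i ≤ topSum k v :=
  Finset.le_sup (f := fun S : Finset (Fin n) => ∑ i ∈ S, v i)
    (Finset.mem_filter.2 ⟨Finset.mem_powerset.2 (Finset.subset_univ S), hS⟩)

lemma lintegral_comp_fst_applicantLaw (μ : Measure ℝ≥0) (p : I) {f : ℝ≥0 → ℝ≥0∞}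
    (hf : Measurable f) : ∫⁻ x, f x.1 ∂(applicantLaw μ p) = ∫⁻ v, f v ∂μ := by
  unfold applicantLaw
  exact measurePreserving_fst.lintegral_comp hf

/-- The expected eligible value splits into the threshold and the excess over it. -/
lemma eligValue_eq (μ : Measure ℝ≥0) [IsProbabilityMeasure μ] (π : Policy) :
    eligValue μ π = π.t * ENNReal.ofReal (eligProb μ π) + ∫⁻ v, ((v - π.t : ℝ≥0) : ℝ≥0∞) ∂μ := by
  have hm : Measurable fun v : ℝ≥0 => ((v - π.t : ℝ≥0) : ℝ≥0∞) := by fun_prop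
  rw [← lintegral_comp_fst_applicantLaw μ π.p hm, ofReal_eligProb,
    ← lintegral_indicator_one (measurableSet_eligSet π), ← lintegral_const_mul' _ _ (by simp),
    eligValue, ← lintegral_indicator (measurableSet_eligSet π), ← lintegral_add_right]
  · refine lintegral_congr fun x => ?_
    by_cases hx : x ∈ eligSet π
    · rw [Set.indicator_of_mem hx, Set.indicator_of_mem hx, Pi.one_apply, mul_one]
      have : π.t ≤ x.1 := by
        rcases hx with h | h
        · exact h.le
        · exact h.1.ge
      rw [← ENNReal.coe_add, add_tsub_cancel_of_le this]
    · rw [Set.indicator_of_notMem hx, Set.indicator_of_notMem hx, mul_zero, zero_add]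
      have : x.1 ≤ π.t := by
        by_contra h
        exact hx (Or.inl (not_le.1 h))
      rw [tsub_eq_zero_of_le this, ENNReal.coe_zero]
  · exact hm.comp measurable_fst

lemma prophetValue_le (F : Fin n → Measure ℝ≥0) [∀ i, IsProbabilityMeasure (F i)] (k : ℕ)
    (t : ℝ≥0) :
    prophetValue k F ≤ k * t + ∑ i, ∫⁻ v, ((v - t : ℝ≥0) : ℝ≥0∞) ∂(F i) := by
  have hm : Measurable fun v : ℝ≥0 => ((v - t : ℝ≥0) : ℝ≥0∞) := by fun_prop
  have hm' : ∀ i : Fin n, Measurable fun v : Fin n → ℝ≥0 => ((v i - t : ℝ≥0) : ℝ≥0∞) :=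
    fun i => hm.comp (measurable_pi_apply i)
  calc prophetValue k F ≤ ∫⁻ v, (((k : ℝ≥0∞) * t) + ∑ i, ((v i - t : ℝ≥0) : ℝ≥0∞))
        ∂(Measure.pi F) := by
        refine lintegral_mono fun v => ?_
        have := ENNReal.coe_le_coe.2 (topSum_le k v t)
        push_cast at this ⊢
        exact this
    _ = _ := by
        rw [lintegral_add_left measurable_const, lintegral_const, measure_univ, mul_one,
          lintegral_finsetSum _ fun i _ => hm' i]
        congr 1
        exact Finset.sum_congr rfl fun i _ => (measurePreserving_eval F i).lintegral_comp hm

/-- The guarantee for the policies with expected demand `k`. -/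
theorem guarantee {k : ℕ} (hk : 1 ≤ k) (F : Fin n → Measure ℝ≥0)
    [∀ i, IsProbabilityMeasure (F i)] (π : Policy) (hd : expectedDemand F π = (k : ℝ≥0∞)) :
    ENNReal.ofReal (min (gam k) ((k : ℝ) / ((k : ℝ) + 1))) * prophetValue k F ≤
      performance k F π := by
  classical
  have hk0 : (0 : ℝ) < k := by exact_mod_cast hk
  have hsum : ∑ i, eligProb (F i) π = k := by
    rw [expectedDemand_eq, ← ENNReal.ofReal_natCast] at hd
    exact (ENNReal.ofReal_eq_ofReal_iff (Finset.sum_nonneg fun i _ => (eligProb_mem _ _).1)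
      hk0.le).1 hd
  have hmem : (fun i => eligProb (F i) π) ∈ successVectors n (k : ℝ) :=
    ⟨fun i => eligProb_mem _ _, hsum⟩
  -- Expected demand k enters here: k t equals t times the sum of the eligibility probabilities, at
  -- the policy's own threshold.
  have hvalue : prophetValue k F ≤ ∑ i, eligValue (F i) π := by
    refine (prophetValue_le F k π.t).trans (le_of_eq ?_)
    simp only [eligValue_eq]
    rw [Finset.sum_add_distrib, ← Finset.mul_sum, ← ENNReal.ofReal_sum_of_nonneg fun i _ =>
      (eligProb_mem _ _).1, hsum, ENNReal.ofReal_natCast, mul_comm]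
  rw [performance_eq]
  refine (mul_le_mul_right hvalue _).trans ?_
  rw [Finset.mul_sum]
  refine Finset.sum_le_sum fun i _ => ?_
  rw [mul_comm]
  refine mul_le_mul_right (ENNReal.ofReal_le_ofReal ?_) _
  exact (min_gam_le_ev_share hk hmem).trans
    (ev_prod_bern_le_of_antitone (share_antitone k) hmem.1 (Finset.mem_univ i))

end Guarantee

/-! ### Comparing γ_k with k/(k+1) -/

lemma div_le_gam {k : ℕ} (hk : 1 ≤ k) (h : k ≤ 4) : (k : ℝ) / (k + 1) ≤ gam k := by
  have he := Real.exp_one_gt_d9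
  have hexp : ∀ m : ℕ, Real.exp (-(m : ℝ)) = (Real.exp 1 ^ m)⁻¹ := by
    intro m
    rw [Real.exp_neg, ← Real.exp_nat_mul, mul_one]
  have key : ∀ m : ℕ, 1 ≤ m → ((m : ℝ) + 1) * m ^ m / m.factorial ≤ 2.7182818283 ^ m →
      (m : ℝ) / (m + 1) ≤ gam m := by
    intro m hm hle
    have h1 : (2.7182818283 : ℝ) ^ m ≤ Real.exp 1 ^ m :=
      pow_le_pow_left₀ (by norm_num) he.le m
    have hE : 0 < Real.exp 1 ^ m := by positivity
    have h2 := hle.trans h1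
    rw [div_le_iff₀ (by positivity)] at h2
    rw [gam, hexp, div_le_iff₀ (by positivity)]
    field_simp
    nlinarith
  interval_cases k
  · exact key 1 le_rfl (by norm_num)
  · exact key 2 (by norm_num) (by norm_num [Nat.factorial])
  · exact key 3 (by norm_num) (by norm_num [Nat.factorial])
  · exact key 4 (by norm_num) (by norm_num [Nat.factorial])

/-- From k to k + 1 the right side grows by the factor (1 + 1/k)^k (1 + 1/(k+1)), which is at least
e. -/
lemma exp_le_of_five_le {k : ℕ} (hk : 5 ≤ k) :
    Real.exp k ≤ ((k : ℝ) + 1) * k ^ k / k.factorial := by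
  induction k, hk using Nat.le_induction with
  | base =>
    have he := Real.exp_one_lt_d9
    have : Real.exp ((5 : ℕ) : ℝ) = Real.exp 1 ^ 5 := by rw [← Real.exp_nat_mul, mul_one]
    rw [this]
    have h1 : Real.exp 1 ^ 5 ≤ 2.7182818286 ^ 5 :=
      pow_le_pow_left₀ (Real.exp_pos 1).le he.le 5
    refine h1.trans ?_
    norm_num [Nat.factorial]
  | succ k hk ih =>
    have hk0 : (0 : ℝ) < k := by exact_mod_cast (by omega : 0 < k)
    have hlog : 2 * (1 / (k : ℝ)) / (1 / k + 2) ≤ Real.log (1 + 1 / k) :=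
      Real.le_log_one_add_of_nonneg (by positivity)
    have h1 : 1 ≤ Real.log (1 + 1 / k) * k + Real.log (1 + 1 / (k + 1)) := by
      -- This leaves (k + 1/2) log(1 + 1/k) ≥ 1, which is the bound log(1 + x) ≥ 2x/(x + 2) at x =
      -- 1/k.
      have hsq : Real.log (1 + 1 / k) ≤ 2 * Real.log (1 + 1 / (k + 1)) := by
        have : 2 * Real.log (1 + 1 / ((k : ℝ) + 1)) = Real.log ((1 + 1 / ((k : ℝ) + 1)) ^ 2) := by
          rw [Real.log_pow]; norm_num
        rw [this]
        refine Real.log_le_log (by positivity) ?_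
        rw [← sub_nonneg]
        have : (1 + 1 / ((k : ℝ) + 1)) ^ 2 - (1 + 1 / k) = (k ^ 2 + k - 1) / (k * (k + 1) ^ 2) := by
          field_simp; ring
        rw [this]
        have hk1 : (1 : ℝ) ≤ k := by exact_mod_cast (by omega : 1 ≤ k)
        exact div_nonneg (by nlinarith) (by positivity)
      have h3 : 2 * (1 / (k : ℝ)) / (1 / k + 2) * (k + 1 / 2) = 1 := by field_simp; ring
      have h4 := mul_le_mul_of_nonneg_right hlog (by positivity : (0 : ℝ) ≤ k + 1 / 2)
      linarith
    have h2 : Real.exp 1 ≤ (1 + 1 / (k : ℝ)) ^ k * (1 + 1 / (k + 1)) := by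
      have := Real.exp_le_exp.2 h1
      rwa [Real.exp_add, Real.exp_log (by positivity), mul_comm (Real.log _) (k : ℝ),
        Real.exp_nat_mul, Real.exp_log (by positivity)] at this
    have hstep : (((k + 1 : ℕ) : ℝ) + 1) * ((k + 1 : ℕ) : ℝ) ^ (k + 1) / ((k + 1).factorial : ℝ) =
        ((k : ℝ) + 1) * k ^ k / k.factorial * ((1 + 1 / (k : ℝ)) ^ k * (1 + 1 / (k + 1))) := by
      have : (1 + 1 / (k : ℝ)) = (k + 1) / k := by field_simp
      rw [this, div_pow, Nat.factorial_succ, pow_succ]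
      push_cast
      field_simp
    rw [hstep]
    push_cast
    rw [Real.exp_add]
    exact mul_le_mul ih h2 (Real.exp_pos 1).le (by positivity)

lemma gam_le_div {k : ℕ} (hk : 4 < k) : gam k ≤ (k : ℝ) / (k + 1) := by
  have h := exp_le_of_five_le hk
  have hE := Real.exp_pos (k : ℝ)
  rw [le_div_iff₀ (by positivity)] at h
  rw [gam, Real.exp_neg, le_div_iff₀ (by positivity)]
  field_simp
  nlinarith

/-! ### Two-point distributions and the first example -/

lemma coe_divNat (x : I) (m : ℕ) : (divNat x m : ℝ) = x / m := rfl

lemma ofReal_coe_toNNReal (p : I) : (unitInterval.toNNReal p : ℝ≥0∞) = ENNReal.ofReal p := by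
  rw [← ENNReal.ofReal_coe_nnreal, unitInterval.coe_toNNReal]

lemma lintegral_bernoulliMeasure {α : Type*} [MeasurableSpace α] [MeasurableSingletonClass α]
    (x y : α) (p : I) (f : α → ℝ≥0∞) :
    ∫⁻ v, f v ∂(bernoulliMeasure x y p) =
      ENNReal.ofReal p * f x + ENNReal.ofReal (1 - p) * f y := by
  rw [bernoulliMeasure_def, lintegral_add_measure, lintegral_smul_measure, lintegral_smul_measure,
    lintegral_dirac, lintegral_dirac, ENNReal.smul_def, ENNReal.smul_def, smul_eq_mul, smul_eq_mul,
    ofReal_coe_toNNReal, ofReal_coe_toNNReal, unitInterval.coe_symm_eq]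

lemma eligProb_eq (μ : Measure ℝ≥0) [IsProbabilityMeasure μ] (π : Policy) :
    eligProb μ π = μ.real (Set.Ioi π.t) + π.p * μ.real {π.t} := by
  have hE : eligSet π = Set.Ioi π.t ×ˢ Set.univ ∪ {π.t} ×ˢ {true} := by
    ext ⟨v, b⟩; simp [eligSet, or_comm]
  have hd : Disjoint (Set.Ioi π.t ×ˢ (Set.univ : Set Bool)) ({π.t} ×ˢ {true}) := by
    rw [Set.disjoint_left]
    rintro x ⟨h1, _⟩ ⟨h2, _⟩
    rw [Set.mem_singleton_iff] at h2
    exact (ne_of_gt h1) h2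
  rw [eligProb, hE, measureReal_union hd ((measurableSet_singleton _).prod
    (measurableSet_singleton _)), applicantLaw, measureReal_prod_prod, measureReal_prod_prod,
    probReal_univ, mul_one, bernoulliMeasure_real_apply_of_mem_of_notMem π.p
      (measurableSet_singleton true) (Set.mem_singleton true) (by simp)]
  ring

/-- The reference level s need not be the policy's threshold; the examples use s = 1 and s = 0, so
policies need not be classified by threshold. -/
lemma eligValue_le (μ : Measure ℝ≥0) [IsProbabilityMeasure μ] (π : Policy) (s : ℝ≥0) :
    eligValue μ π ≤ s * ENNReal.ofReal (eligProb μ π) + ∫⁻ v, ((v - s : ℝ≥0) : ℝ≥0∞) ∂μ := by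
  have hm : Measurable fun v : ℝ≥0 => ((v - s : ℝ≥0) : ℝ≥0∞) := by fun_prop
  rw [← lintegral_comp_fst_applicantLaw μ π.p hm, ofReal_eligProb,
    ← lintegral_indicator_one (measurableSet_eligSet π), ← lintegral_const_mul' _ _ (by simp),
    eligValue, ← lintegral_indicator (measurableSet_eligSet π), ← lintegral_add_right]
  · refine lintegral_mono fun x => ?_
    by_cases hx : x ∈ eligSet π
    · simp only [Set.indicator_of_mem hx, Pi.one_apply, mul_one]
      rw [← ENNReal.coe_add]
      exact ENNReal.coe_le_coe.2 le_add_tsub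
    · simp only [Set.indicator_of_notMem hx]
      exact zero_le
  · exact hm.comp measurable_fst

lemma gam_nonneg {k : ℕ} (hk : 1 ≤ k) : 0 ≤ gam k := by
  have hk0 : (0 : ℝ) < k := by exact_mod_cast hk
  have h := poisMin_nonneg k hk0.le
  rw [poisMin_self] at h
  exact nonneg_of_mul_nonneg_right h hk0

section ExampleOne

lemma poissonMeasure_real_Iio (k m : ℕ) :
    (poissonMeasure (k : ℝ≥0)).real (Set.Iio m) = Real.exp (-(k : ℝ)) * expPartial m k := by
  have : Set.Iio m = ((Finset.range m : Finset ℕ) : Set ℕ) := by ext; simp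
  rw [this, ← sum_measureReal_singleton, expPartial, Finset.mul_sum]
  refine Finset.sum_congr rfl fun i _ => ?_
  rw [poissonMeasure_real_singleton]
  simp only [NNReal.coe_natCast]
  ring

lemma coe_bigW (k : ℕ) : (bigW k : ℝ) = weight k := by
  have h1 : (poissonMeasure (k : ℝ≥0)).real (Set.Ioi k) =
      Real.exp (-(k : ℝ)) * expTail (k + 1) k := by
    have : Set.Ioi k = (Set.Iio (k + 1))ᶜ := by ext; simp
    rw [this, probReal_compl_eq_one_sub measurableSet_Iio, poissonMeasure_real_Iio, expTail,
      mul_sub, ← Real.exp_add, neg_add_cancel, Real.exp_zero]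
  have h2 := poissonMeasure_real_Iio k k
  rw [measureReal_def] at h1 h2
  rw [bigW, NNReal.coe_div, NNReal.coe_mul, ENNReal.coe_toNNReal_eq_toReal,
    ENNReal.coe_toNNReal_eq_toReal, h1, h2, weight, NNReal.coe_natCast]
  have := (Real.exp_pos (-(k : ℝ))).ne'
  rw [mul_left_comm, mul_div_mul_left _ _ this]

instance (k n : ℕ) (i : Fin n) : IsProbabilityMeasure (exampleOne k n i) := by
  unfold exampleOne; infer_instance

variable {k n : ℕ}

lemma coe_divNat_sq : ((divNat 1 (n ^ 2) : I) : ℝ) = 1 / (n : ℝ) ^ 2 := by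
  rw [coe_divNat]; simp

lemma exampleOne_performance_le (hn : 1 ≤ n) (π : Policy) :
    ∃ q : ℝ, 0 ≤ q ∧ q ≤ 1 ∧ performance k (exampleOne k n) π ≤
      ENNReal.ofReal ((weight k + n * q) * ev (share k) (bern q ^ (n - 1))) := by
  classical
  have hn0 : (0 : ℝ) < n := by exact_mod_cast hn
  set μ : Measure ℝ≥0 := bernoulliMeasure ((n : ℝ≥0) * bigW k) 1 (divNat 1 (n ^ 2)) with hμ
  have hq := eligProb_mem μ π
  set q := eligProb μ π with hqdef
  refine ⟨q, hq.1, hq.2, ?_⟩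
  have hm : eligValue μ π ≤ ENNReal.ofReal (q + weight k / n) := by
    refine (eligValue_le μ π 1).trans ?_
    have hW : 0 ≤ weight k / n := by
      rw [← coe_bigW]; positivity
    rw [ENNReal.ofReal_add hq.1 hW, ENNReal.coe_one, one_mul]
    refine add_le_add le_rfl ?_
    rw [hμ, lintegral_bernoulliMeasure, tsub_self, ENNReal.coe_zero, mul_zero, add_zero,
      coe_divNat_sq]
    have h1 : (((n : ℝ≥0) * bigW k - 1 : ℝ≥0) : ℝ≥0∞) ≤ ENNReal.ofReal (n * weight k) := by
      rw [← coe_bigW]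
      refine (ENNReal.coe_le_coe.2 tsub_le_self).trans (le_of_eq ?_)
      rw [← ENNReal.ofReal_coe_nnreal]
      push_cast
      rfl
    refine (mul_le_mul_right h1 _).trans (le_of_eq ?_)
    rw [← ENNReal.ofReal_mul (by positivity)]
    congr 1
    field_simp
  have hα : 0 ≤ ev (share k) (bern q ^ (n - 1)) := by
    rw [ev_bern_pow']
    exact Finset.sum_nonneg fun j _ => mul_nonneg (binomPmf_nonneg hq.1 hq.2 _ _) (share_nonneg _ _)
  have hF : ∀ i, exampleOne k n i = μ := fun i => rfl
  rw [performance_eq]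
  simp only [hF, Finset.prod_const, Finset.card_erase_of_mem (Finset.mem_univ _),
    Finset.card_univ, Fintype.card_fin, Finset.sum_const, nsmul_eq_mul, ← hqdef]
  calc (n : ℝ≥0∞) * (eligValue μ π * ENNReal.ofReal (ev (share k) (bern q ^ (n - 1))))
      ≤ ENNReal.ofReal n * (ENNReal.ofReal (q + weight k / n) *
          ENNReal.ofReal (ev (share k) (bern q ^ (n - 1)))) := by
        rw [ENNReal.ofReal_natCast]; gcongr
    _ = _ := by
        rw [← ENNReal.ofReal_mul' hα, ← ENNReal.ofReal_mul hn0.le]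
        congr 1
        field_simp
        ring

/-- Two disjoint kinds of outcome suffice: all values 1, worth k, and exactly one high value, worth
at least n W_k. Bernoulli's inequality bounds their probabilities. -/
lemma le_exampleOne_prophetValue (hk : 1 ≤ k) (hkn : k ≤ n) (hH : 1 < (n : ℝ) * weight k) :
    ENNReal.ofReal ((1 - 1 / n) * (weight k + k)) ≤ prophetValue k (exampleOne k n) := by
  classical
  have hn1 : 1 ≤ n := hk.trans hkn
  have hn0 : (0 : ℝ) < n := by exact_mod_cast hn1
  set H : ℝ≥0 := (n : ℝ≥0) * bigW k with hHdef
  have hHr : (H : ℝ) = n * weight k := by rw [hHdef, ← coe_bigW]; push_cast; rfl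
  have hH1 : H ≠ 1 := by
    intro h
    rw [← hHr, h] at hH
    norm_num at hH
  set ε : I := divNat 1 (n ^ 2) with hε
  have hεr : (ε : ℝ) = 1 / (n : ℝ) ^ 2 := coe_divNat_sq
  have hε0 : 0 ≤ (ε : ℝ) := ε.2.1
  have hε1 : 0 ≤ 1 - (ε : ℝ) := sub_nonneg.2 ε.2.2
  set μ : Measure ℝ≥0 := bernoulliMeasure H 1 ε with hμ
  set A : Set (Fin n → ℝ≥0) := Set.pi Set.univ fun _ => {1} with hA
  set B : Fin n → Set (Fin n → ℝ≥0) := fun i => Set.pi Set.univ fun j => if j = i then {H} else {1}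
    with hB
  have hone : μ {1} = ENNReal.ofReal (1 - ε) := by
    rw [← lintegral_indicator_one (measurableSet_singleton _), hμ, lintegral_bernoulliMeasure]
    simp [hH1]
  have hHm : μ {H} = ENNReal.ofReal ε := by
    rw [← lintegral_indicator_one (measurableSet_singleton _), hμ, lintegral_bernoulliMeasure]
    simp [hH1.symm]
  have hAm : Measure.pi (exampleOne k n) A = ENNReal.ofReal ((1 - ε) ^ n) := by
    rw [hA, Measure.pi_pi]
    have : ∀ i, exampleOne k n i {1} = ENNReal.ofReal (1 - ε) := fun i => hone
    rw [Finset.prod_congr rfl fun i _ => this i, Finset.prod_const, Finset.card_univ,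
      Fintype.card_fin, ENNReal.ofReal_pow hε1]
  have hBm : ∀ i, Measure.pi (exampleOne k n) (B i) =
      ENNReal.ofReal (ε * (1 - ε) ^ (n - 1)) := by
    intro i
    simp only [hB]
    rw [Measure.pi_pi, ← Finset.mul_prod_erase _ _ (Finset.mem_univ i), if_pos rfl,
      ENNReal.ofReal_mul hε0, ENNReal.ofReal_pow hε1]
    have h1 : exampleOne k n i {H} = ENNReal.ofReal ε := hHm
    have h2 : ∀ j ∈ Finset.univ.erase i,
        exampleOne k n j (if j = i then {H} else {1}) = ENNReal.ofReal (1 - ε) := by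
      intro j hj
      rw [if_neg (Finset.ne_of_mem_erase hj)]
      exact hone
    rw [h1, Finset.prod_congr rfl h2, Finset.prod_const,
      Finset.card_erase_of_mem (Finset.mem_univ _), Finset.card_univ, Fintype.card_fin]
  have hAmeas : MeasurableSet A := MeasurableSet.univ_pi fun _ => measurableSet_singleton _
  have hBmeas : ∀ i, MeasurableSet (B i) := fun i => MeasurableSet.univ_pi fun j => by
    split_ifs <;> exact measurableSet_singleton _
  have hpt : ∀ v : Fin n → ℝ≥0,
      A.indicator (fun _ => (k : ℝ≥0∞)) v + ∑ i, (B i).indicator (fun _ => (H : ℝ≥0∞)) v ≤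
        (topSum k v : ℝ≥0∞) := by
    intro v
    by_cases hv : v ∈ A
    · have hvone : ∀ i, v i = 1 := fun i => hv i (Set.mem_univ i)
      have h0 : ∑ i, (B i).indicator (fun _ => (H : ℝ≥0∞)) v = 0 := by
        refine Finset.sum_eq_zero fun i _ => Set.indicator_of_notMem (fun h => ?_) _
        have := h i (Set.mem_univ i)
        simp only [if_true, Set.mem_singleton_iff] at this
        exact hH1 (this ▸ hvone i)
      rw [h0, add_zero, Set.indicator_of_mem hv]
      obtain ⟨S, _, hS⟩ := Finset.exists_subset_card_eq
        (s := (Finset.univ : Finset (Fin n))) (n := k) (by simpa using hkn)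
      have := le_topSum v hS.le
      rw [Finset.sum_congr rfl fun i _ => hvone i, Finset.sum_const, hS, nsmul_eq_mul,
        mul_one] at this
      exact_mod_cast this
    · rw [Set.indicator_of_notMem hv, zero_add]
      by_cases hex : ∃ i, v ∈ B i
      · obtain ⟨i, hi⟩ := hex
        rw [Finset.sum_eq_single i]
        · rw [Set.indicator_of_mem hi]
          have hvi : v i = H := by
            have := hi i (Set.mem_univ i)
            simpa using this
          have := le_topSum (k := k) v (S := {i}) (by simpa using hk)
          rw [Finset.sum_singleton, hvi] at this
          exact_mod_cast this
        · intro j _ hji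
          refine Set.indicator_of_notMem (fun hj => ?_) _
          have h1 := hi j (Set.mem_univ j)
          have h2 := hj j (Set.mem_univ j)
          simp only [if_neg hji, if_true, Set.mem_singleton_iff] at h1 h2
          exact hH1 (h2 ▸ h1)
        · intro h; exact absurd (Finset.mem_univ i) h
      · push Not at hex
        rw [Finset.sum_eq_zero fun i _ => Set.indicator_of_notMem (hex i) _]
        exact zero_le
  have hint : ∫⁻ v, (A.indicator (fun _ => (k : ℝ≥0∞)) v +
      ∑ i, (B i).indicator (fun _ => (H : ℝ≥0∞)) v) ∂(Measure.pi (exampleOne k n)) =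
      ENNReal.ofReal (k * (1 - ε) ^ n + n * (n * weight k * (ε * (1 - ε) ^ (n - 1)))) := by
    rw [lintegral_add_left (measurable_const.indicator hAmeas),
      lintegral_finsetSum _ fun i _ => measurable_const.indicator (hBmeas i),
      lintegral_indicator_const hAmeas, hAm]
    simp only [lintegral_indicator_const (hBmeas _), hBm, Finset.sum_const, Finset.card_univ,
      Fintype.card_fin, nsmul_eq_mul]
    have hW0 : 0 ≤ weight k := (weight_pos hk).le
    have e1 : (k : ℝ≥0∞) * ENNReal.ofReal ((1 - ε) ^ n) = ENNReal.ofReal (k * (1 - ε) ^ n) := by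
      rw [ENNReal.ofReal_mul (Nat.cast_nonneg k), ENNReal.ofReal_natCast]
    have e2 : (n : ℝ≥0∞) * (H * ENNReal.ofReal (ε * (1 - ε) ^ (n - 1))) =
        ENNReal.ofReal (n * (n * weight k * (ε * (1 - ε) ^ (n - 1)))) := by
      rw [ENNReal.ofReal_mul (Nat.cast_nonneg n), ENNReal.ofReal_natCast, ← hHr,
        ENNReal.ofReal_mul (NNReal.coe_nonneg H), ENNReal.ofReal_coe_nnreal]
    rw [e1, e2, ENNReal.ofReal_add (by positivity) (by positivity)]
  refine le_trans ?_ (lintegral_mono hpt)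
  rw [hint]
  refine ENNReal.ofReal_le_ofReal ?_
  have hW0 : 0 < weight k := weight_pos hk
  have hnε : (n : ℝ) * (n * weight k * (ε * (1 - ε) ^ (n - 1))) =
      weight k * (1 - ε) ^ (n - 1) := by
    rw [hεr]; field_simp
  rw [hnε]
  have hp1 : (1 - (ε : ℝ)) ^ n ≤ (1 - ε) ^ (n - 1) :=
    pow_le_pow_of_le_one hε1 (by linarith) (Nat.sub_le _ _)
  have hp2 : 1 - 1 / (n : ℝ) ≤ (1 - (ε : ℝ)) ^ n := by
    have := one_add_mul_le_pow (a := -(ε : ℝ)) (by linarith) n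
    have e : 1 + (n : ℝ) * -(ε : ℝ) = 1 - 1 / n := by rw [hεr]; field_simp; ring
    rw [e, ← sub_eq_add_neg] at this
    exact this
  have hk0 : (0 : ℝ) ≤ k := Nat.cast_nonneg k
  have h3 := mul_le_mul_of_nonneg_left (hp2.trans hp1) hW0.le
  have h4 := mul_le_mul_of_nonneg_left hp2 hk0
  linarith

lemma exists_policy_exampleOne (hk : 1 ≤ k) (hkn : k < n) (hH : 1 < (n : ℝ) * weight k) :
    ∃ π : Policy, expectedDemand (exampleOne k n) π = (k : ℝ≥0∞) := by
  have hn0 : (0 : ℝ) < n := by exact_mod_cast (by omega : 0 < n)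
  have hn2 : (2 : ℝ) ≤ n := by exact_mod_cast (by omega : 2 ≤ n)
  have hkr : (1 : ℝ) ≤ k := by exact_mod_cast hk
  have hknr : (k : ℝ) ≤ n := by exact_mod_cast hkn.le
  set e : ℝ := 1 / (n : ℝ) ^ 2 with he
  have he1 : e ≤ 1 / n := by
    rw [he]
    refine one_div_le_one_div_of_le hn0 ?_
    nlinarith
  have hn12 : 1 / (n : ℝ) ≤ 1 / 2 := one_div_le_one_div_of_le (by norm_num) hn2
  have hden : 0 < 1 - e := by linarith
  have hkn1 : (k : ℝ) / n ≤ 1 := div_le_one_of_le₀ hknr hn0.le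
  have hkn2 : 1 / (n : ℝ) ≤ k / n := by gcongr
  -- The tie-breaking probability p solves e + p(1 - e) = k/n, with e the probability of a high
  -- value.
  refine ⟨⟨1, ⟨(k / n - e) / (1 - e), div_nonneg (by linarith) hden.le,
    div_le_one_of_le₀ (by linarith) hden.le⟩⟩, ?_⟩
  set H : ℝ≥0 := (n : ℝ≥0) * bigW k with hHdef
  have hH1 : 1 < H := by
    rw [← NNReal.coe_lt_coe, hHdef]
    push_cast
    rw [coe_bigW]
    exact hH
  rw [expectedDemand_eq]
  have hF : ∀ i, exampleOne k n i = bernoulliMeasure H 1 (divNat 1 (n ^ 2)) := fun i => rfl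
  simp only [hF, eligProb_eq]
  rw [bernoulliMeasure_real_apply_of_mem_of_notMem _ measurableSet_Ioi (by simpa using hH1)
      (by simp), bernoulliMeasure_real_apply_of_notMem_of_mem _ (measurableSet_singleton _)
      (by simpa using hH1.ne') (by simp), Finset.sum_const, Finset.card_univ, Fintype.card_fin,
    nsmul_eq_mul]
  rw [← ENNReal.ofReal_natCast]
  congr 1
  simp only [coe_divNat_sq]
  rw [← he]
  field_simp
  ring

theorem exampleOne_bound (hk : 1 ≤ k) {δ : ℝ} (hδ : 0 < δ) :
    ∃ N : ℕ, ∀ n : ℕ, N ≤ n →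
      (∃ π : Policy, expectedDemand (exampleOne k n) π = (k : ℝ≥0∞)) ∧
      ∀ π : Policy, performance k (exampleOne k n) π <
        ENNReal.ofReal (gam k + δ) * prophetValue k (exampleOne k n) := by
  have hW := weight_pos hk
  have hγ := gam_nonneg hk
  have hk0 : (0 : ℝ) < k := by exact_mod_cast hk
  obtain ⟨N₁, hN₁⟩ := exists_forall_value_le hk (η := δ * (weight k + k) / 4) (by positivity)
  obtain ⟨N₂, hN₂⟩ := exists_nat_gt (1 / weight k)
  -- The prophet's factor 1 - 1/n then costs less than δ/2, and the error δ/4 from `N₁` still fits.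
  obtain ⟨N₃, hN₃⟩ := exists_nat_gt ((gam k + δ) / (δ / 2))
  refine ⟨max (k + 1) (max N₁ (max N₂ N₃)), fun n hn => ?_⟩
  simp only [max_le_iff] at hn
  obtain ⟨h1, h2, h3, h4⟩ := hn
  have hn0 : (0 : ℝ) < n := by exact_mod_cast (by omega : 0 < n)
  have h3' : (N₂ : ℝ) ≤ n := by exact_mod_cast h3
  have h4' : (N₃ : ℝ) ≤ n := by exact_mod_cast h4
  have hH : 1 < (n : ℝ) * weight k := by
    rw [← div_lt_iff₀ hW]; linarith
  refine ⟨exists_policy_exampleOne hk h1 hH, fun π => ?_⟩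
  obtain ⟨q, hq0, hq1, hperf⟩ := exampleOne_performance_le (k := k) (n := n) (by omega) π
  have hval := hN₁ n h2 q hq0 hq1
  have hproph := le_exampleOne_prophetValue hk (by omega : k ≤ n) hH
  refine (hperf.trans (ENNReal.ofReal_le_ofReal hval)).trans_lt ?_
  refine lt_of_lt_of_le ?_ (mul_le_mul_right hproph _)
  rw [← ENNReal.ofReal_mul (by positivity)]
  have hsmall : (gam k + δ) / n < δ / 2 := by
    rw [div_lt_iff₀ hn0, mul_comm, ← div_lt_iff₀ (by positivity)]
    linarith
  have hlt : gam k + δ / 2 < (gam k + δ) * (1 - 1 / n) := by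
    have : (gam k + δ) * (1 - 1 / n) = gam k + δ - (gam k + δ) / n := by ring
    rw [this]; linarith
  have hmul := mul_lt_mul_of_pos_right hlt (by positivity : 0 < weight k + k)
  refine (ENNReal.ofReal_lt_ofReal_iff ?_).2 ?_
  · have : 0 < (gam k + δ / 2) * (weight k + k) := by positivity
    linarith
  · have : 0 < δ * (weight k + k) := by positivity
    linarith

end ExampleOne

/-! ### The second example -/

section ExampleTwo

instance (k : ℕ) (ε : I) (i : Fin (k + 1)) : IsProbabilityMeasure (exampleTwo k ε i) := by
  unfold exampleTwo
  split_ifs <;> infer_instance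

lemma exampleTwo_last (k : ℕ) (ε : I) :
    exampleTwo k ε (Fin.last k) = bernoulliMeasure (1 / (unitInterval.toNNReal ε) ^ 2) 0 ε :=
  if_pos rfl

lemma exampleTwo_of_ne {k : ℕ} (ε : I) {i : Fin (k + 1)} (hi : i ≠ Fin.last k) :
    exampleTwo k ε i = bernoulliMeasure 1 0 (unitInterval.symm (divNat ε k)) :=
  if_neg hi

lemma eligProb_le_real_Ioi_zero (μ : Measure ℝ≥0) [IsProbabilityMeasure μ] {π : Policy}
    (ht : 0 < π.t) : eligProb μ π ≤ μ.real (Set.Ioi 0) := by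
  rw [eligProb_eq]
  have hd : Disjoint (Set.Ioi π.t) {π.t} := by simp
  have h1 : μ.real (Set.Ioi π.t ∪ {π.t}) ≤ μ.real (Set.Ioi 0) := by
    refine measureReal_mono ?_
    rintro x (hx | hx)
    · exact ht.trans hx
    · rw [Set.mem_singleton_iff] at hx; exact hx ▸ ht
  rw [measureReal_union hd (measurableSet_singleton _)] at h1
  have h2 : (π.p : ℝ) * μ.real {π.t} ≤ μ.real {π.t} :=
    mul_le_of_le_one_left measureReal_nonneg π.p.2.2
  linarith

lemma bernoulliMeasure_real_Ioi_zero {x : ℝ≥0} (hx : 0 < x) (p : I) :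
    (bernoulliMeasure x 0 p).real (Set.Ioi 0) = p :=
  bernoulliMeasure_real_apply_of_mem_of_notMem _ measurableSet_Ioi (by simpa using hx) (by simp)

lemma bernoulliMeasure_real_zero {x : ℝ≥0} (hx : 0 < x) (p : I) :
    (bernoulliMeasure x 0 p).real {0} = 1 - p := by
  rw [bernoulliMeasure_real_apply_of_notMem_of_mem _ (measurableSet_singleton _)
    (by simpa using hx.ne') (by simp)]

/-- With probability q^k all k rivals are eligible, and then the share is 1 - 1/(k+1); otherwise it
is at most 1. -/
lemma ev_share_bern_pow_le (k : ℕ) {q : ℝ} (h0 : 0 ≤ q) (h1 : q ≤ 1) :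
    ev (share k) (bern q ^ k) ≤ 1 - q ^ k / (k + 1) := by
  have hle : ∀ d : ℕ, share k d ≤ 1 + -(1 / ((k : ℝ) + 1)) * (if d = k then 1 else 0) := by
    intro d
    split_ifs with h
    · rw [h, share_of_ge (Nat.le_succ k)]
      apply le_of_eq
      field_simp
      ring
    · rw [mul_zero, add_zero]; exact share_le_one k d
  have hc := coeff_prod_bern_nonneg (Finset.range k) (p := fun _ => q) (fun _ => ⟨h0, h1⟩)
  rw [Finset.prod_const, Finset.card_range] at hc
  refine (ev_mono hle hc).trans (le_of_eq ?_)
  rw [ev_add_fun, ev_const_mul_fun, ev_bern_pow_one, ev_bern_pow']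
  simp only [mul_ite, mul_one, mul_zero, Finset.sum_ite_eq', Finset.mem_range,
    Nat.lt_succ_self, if_true]
  simp [binomPmf]
  ring

variable {k : ℕ} {ε : I}

lemma coe_inv_sq (hε : 0 < (ε : ℝ)) :
    0 < (1 / (unitInterval.toNNReal ε) ^ 2 : ℝ≥0) := by
  have : 0 < unitInterval.toNNReal ε := by
    rw [← NNReal.coe_pos, unitInterval.coe_toNNReal]; exact hε
  positivity

lemma exampleTwo_demand (hk : 1 ≤ k) (hε : 0 < (ε : ℝ)) :
    expectedDemand (exampleTwo k ε) ⟨0, 0⟩ = (k : ℝ≥0∞) := by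
  have hk0 : (0 : ℝ) < k := by exact_mod_cast hk
  have h1 : ∀ i : Fin k, eligProb (exampleTwo k ε i.castSucc) ⟨0, 0⟩ = 1 - ε / k := by
    intro i
    simp only [exampleTwo_of_ne ε (Fin.castSucc_lt_last i).ne, eligProb_eq]
    rw [bernoulliMeasure_real_Ioi_zero one_pos, unitInterval.coe_symm_eq, coe_divNat]
    simp
  have h2 : eligProb (exampleTwo k ε (Fin.last k)) ⟨0, 0⟩ = ε := by
    simp only [exampleTwo_last, eligProb_eq]
    rw [bernoulliMeasure_real_Ioi_zero (coe_inv_sq hε)]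
    simp
  rw [expectedDemand_eq, Fin.sum_univ_castSucc, Finset.sum_congr rfl fun i _ => h1 i, h2,
    Finset.sum_const, Finset.card_univ, Fintype.card_fin, nsmul_eq_mul, ← ENNReal.ofReal_natCast]
  congr 1
  field_simp
  ring

lemma exampleTwo_performance_le (hk : 1 ≤ k) (hε : 0 < (ε : ℝ)) {π : Policy}
    (hd : expectedDemand (exampleTwo k ε) π = (k : ℝ≥0∞)) :
    performance k (exampleTwo k ε) π ≤
      ENNReal.ofReal (k + 1 / ε * (1 - (1 - ε) / (k + 1))) := by
  classical
  have hk0 : (0 : ℝ) < k := by exact_mod_cast hk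
  have hk1 : (1 : ℝ) ≤ k := by exact_mod_cast hk
  have hε1 : (ε : ℝ) ≤ 1 := ε.2.2
  set μ : Measure ℝ≥0 := bernoulliMeasure 1 0 (unitInterval.symm (divNat ε k)) with hμ
  set ν : Measure ℝ≥0 := bernoulliMeasure (1 / (unitInterval.toNNReal ε) ^ 2) 0 ε with hν
  have hF : ∀ i : Fin k, exampleTwo k ε i.castSucc = μ := fun i =>
    exampleTwo_of_ne ε (Fin.castSucc_lt_last i).ne
  have hL : exampleTwo k ε (Fin.last k) = ν := exampleTwo_last k ε
  have hq := eligProb_mem μ π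
  have hr := eligProb_mem ν π
  have hsum : k * eligProb μ π + eligProb ν π = k := by
    rw [expectedDemand_eq, Fin.sum_univ_castSucc] at hd
    simp only [hF, hL, Finset.sum_const, Finset.card_univ, Fintype.card_fin, nsmul_eq_mul] at hd
    rw [← ENNReal.ofReal_natCast k] at hd
    exact (ENNReal.ofReal_eq_ofReal_iff (add_nonneg (mul_nonneg hk0.le hq.1) hr.1) hk0.le).1 hd
  -- At t = 0 the demand is k + p, which forces p = 0; for t > 0 the value 0 is never eligible. So
  -- the last applicant takes up at most ε of the demand and the others remain nearly certain
  -- rivals.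
  have hrε : eligProb ν π ≤ ε := by
    rcases eq_or_lt_of_le (zero_le : 0 ≤ π.t) with ht | ht
    · have hμq : eligProb μ π = 1 - ε / k + π.p * (ε / k) := by
        rw [eligProb_eq, ← ht, hμ, bernoulliMeasure_real_Ioi_zero one_pos,
          bernoulliMeasure_real_zero one_pos, unitInterval.coe_symm_eq, coe_divNat]
        ring
      have hνq : eligProb ν π = ε + π.p * (1 - ε) := by
        rw [eligProb_eq, ← ht, hν, bernoulliMeasure_real_Ioi_zero (coe_inv_sq hε),
          bernoulliMeasure_real_zero (coe_inv_sq hε)]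
      rw [hμq, hνq] at hsum
      have hp : (π.p : ℝ) = 0 := by
        field_simp at hsum
        linarith
      rw [hνq, hp]
      linarith
    · refine (eligProb_le_real_Ioi_zero ν ht).trans (le_of_eq ?_)
      rw [hν, bernoulliMeasure_real_Ioi_zero (coe_inv_sq hε)]
  set q := eligProb μ π with hqdef
  have hqge : 1 - (ε : ℝ) / k ≤ q := by
    rw [sub_le_iff_le_add, ← sub_le_iff_le_add', le_div_iff₀ hk0]
    linarith
  have hεk : (ε : ℝ) / k ≤ 1 := div_le_one_of_le₀ (hε1.trans hk1) hk0.le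
  have hpow : 1 - (ε : ℝ) ≤ q ^ k := by
    have h1 := one_add_mul_le_pow (a := -((ε : ℝ) / k)) (by linarith) k
    have e : 1 + (k : ℝ) * -((ε : ℝ) / k) = 1 - ε := by field_simp; ring
    rw [e, ← sub_eq_add_neg] at h1
    exact h1.trans (pow_le_pow_left₀ (by linarith) hqge k)
  have hlast : eligValue ν π * ENNReal.ofReal (ev (share k) (bern q ^ k)) ≤
      ENNReal.ofReal (1 / ε * (1 - (1 - ε) / (k + 1))) := by
    rw [ENNReal.ofReal_mul (by positivity)]
    refine mul_le_mul' ?_ (ENNReal.ofReal_le_ofReal ?_)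
    · refine (eligValue_le ν π 0).trans ?_
      rw [hν, lintegral_bernoulliMeasure]
      simp only [tsub_zero, ENNReal.coe_zero, zero_mul, zero_add, mul_zero, add_zero]
      rw [← ENNReal.ofReal_coe_nnreal, ← ENNReal.ofReal_mul hε.le]
      refine ENNReal.ofReal_le_ofReal (le_of_eq ?_)
      push_cast
      rw [unitInterval.coe_toNNReal]
      field_simp
    · refine (ev_share_bern_pow_le k hq.1 hq.2).trans ?_
      gcongr
  have hfirst : eligValue μ π ≤ 1 := by
    refine (eligValue_le μ π 0).trans ?_
    rw [hμ, lintegral_bernoulliMeasure]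
    simp only [tsub_zero, ENNReal.coe_zero, zero_mul, zero_add, mul_zero, add_zero,
      ENNReal.coe_one, mul_one]
    exact ENNReal.ofReal_le_one.2 (unitInterval.symm (divNat ε k)).2.2
  have hprod : ∏ j ∈ Finset.univ.erase (Fin.last k), bern (eligProb (exampleTwo k ε j) π) =
      bern q ^ k := by
    have : ∀ j ∈ Finset.univ.erase (Fin.last k),
        bern (eligProb (exampleTwo k ε j) π) = bern q := by
      intro j hj
      have hj' := Finset.ne_of_mem_erase hj
      have : exampleTwo k ε j = μ := exampleTwo_of_ne ε hj'
      simp only [this, hqdef]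
    rw [Finset.prod_congr rfl this, Finset.prod_const,
      Finset.card_erase_of_mem (Finset.mem_univ _), Finset.card_univ, Fintype.card_fin,
      Nat.add_sub_cancel]
  have hone : ∀ i : Fin k, eligValue (exampleTwo k ε i.castSucc) π * ENNReal.ofReal
      (ev (share k) (∏ j ∈ Finset.univ.erase i.castSucc,
        bern (eligProb (exampleTwo k ε j) π))) ≤ 1 := by
    intro i
    rw [hF, ← one_mul (1 : ℝ≥0∞)]
    refine mul_le_mul' hfirst (ENNReal.ofReal_le_one.2 ?_)
    refine (ev_mono (share_le_one k) (coeff_prod_bern_nonneg _ fun j =>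
      eligProb_mem _ π)).trans (le_of_eq (ev_const_prod_bern _ _ 1))
  rw [performance_eq, Fin.sum_univ_castSucc, hprod, hL,
    ENNReal.ofReal_add hk0.le (mul_nonneg (by positivity) (by
      rw [sub_nonneg]
      exact div_le_one_of_le₀ (by linarith) (by positivity)))]
  refine add_le_add ?_ hlast
  refine (Finset.sum_le_sum fun i _ => hone i).trans ?_
  simp

lemma le_exampleTwo_prophetValue (hk : 1 ≤ k) (hε : 0 < (ε : ℝ)) :
    ENNReal.ofReal (1 / ε) ≤ prophetValue k (exampleTwo k ε) := by
  have h1 : ∀ v : Fin (k + 1) → ℝ≥0, ((v (Fin.last k) : ℝ≥0) : ℝ≥0∞) ≤ topSum k v := by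
    intro v
    have := le_topSum (k := k) v (S := {Fin.last k}) (by simpa using hk)
    rw [Finset.sum_singleton] at this
    exact_mod_cast this
  have h2 : ∫⁻ v, ((v (Fin.last k) : ℝ≥0) : ℝ≥0∞) ∂(Measure.pi (exampleTwo k ε)) =
      ENNReal.ofReal (1 / ε) := by
    have := (measurePreserving_eval (exampleTwo k ε) (Fin.last k)).lintegral_comp
      measurable_coe_nnreal_ennreal
    refine this.trans ?_
    rw [exampleTwo_last, lintegral_bernoulliMeasure, ENNReal.coe_zero, mul_zero, add_zero,
      ← ENNReal.ofReal_coe_nnreal, ← ENNReal.ofReal_mul hε.le]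
    congr 1
    push_cast
    rw [unitInterval.coe_toNNReal]
    field_simp
  rw [← h2]
  exact lintegral_mono h1

theorem exampleTwo_bound (hk : 1 ≤ k) {δ : ℝ} (hδ : 0 < δ) :
    ∃ ε₀ : ℝ, 0 < ε₀ ∧ ∀ ε : I, 0 < (ε : ℝ) → (ε : ℝ) < ε₀ →
      expectedDemand (exampleTwo k ε) ⟨0, 0⟩ = (k : ℝ≥0∞) ∧
      ∀ π : Policy, expectedDemand (exampleTwo k ε) π = (k : ℝ≥0∞) →
        performance k (exampleTwo k ε) π <
          ENNReal.ofReal ((k : ℝ) / ((k : ℝ) + 1) + δ) * prophetValue k (exampleTwo k ε) := by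
  -- The margin between the two sides is (δ - ε(k + 1/(k+1)))/ε, positive as soon as ε(k + 1) < δ.
  refine ⟨δ / (k + 1), by positivity, fun ε hε hεlt => ⟨exampleTwo_demand hk hε, fun π hd => ?_⟩⟩
  refine (exampleTwo_performance_le hk hε hd).trans_lt ?_
  refine lt_of_lt_of_le ?_ (mul_le_mul_right (le_exampleTwo_prophetValue hk hε) _)
  rw [← ENNReal.ofReal_mul (by positivity)]
  have hk0 : (0 : ℝ) < k := by exact_mod_cast hk
  rw [lt_div_iff₀ (by positivity)] at hεlt
  have hid : ((k : ℝ) / (k + 1) + δ) * (1 / ε) - (k + 1 / ε * (1 - (1 - ε) / (k + 1))) =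
      (δ - ε * (k + 1 / (k + 1))) / ε := by
    field_simp
    ring
  have hle : (1 : ℝ) / (k + 1) ≤ 1 := div_le_one_of_le₀ (by linarith) (by positivity)
  have hpos : 0 < (δ - ε * (k + 1 / (k + 1))) / ε := div_pos (by nlinarith) hε
  exact (ENNReal.ofReal_lt_ofReal_iff (by positivity)).2 (by linarith)

end ExampleTwo

/-! ### Tightness and optimality from the examples -/

lemma lt_of_ofReal_mul_lt {c d : ℝ} {x y : ℝ≥0∞} (h1 : ENNReal.ofReal c * x ≤ y)
    (h2 : y < ENNReal.ofReal d * x) : c < d := by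
  by_contra h
  exact absurd (h1.trans_lt h2) (not_lt.2 (mul_le_mul_left
    (ENNReal.ofReal_le_ofReal (not_lt.1 h)) x))

lemma exists_exampleTwo_parameter {ε₀ : ℝ} (h : 0 < ε₀) : ∃ ε : I, 0 < (ε : ℝ) ∧ (ε : ℝ) < ε₀ := by
  refine ⟨⟨min 1 (ε₀ / 2), le_min zero_le_one (by linarith), min_le_left _ _⟩, ?_, ?_⟩
  · exact lt_min one_pos (by linarith)
  · exact (min_le_right _ _).trans_lt (by linarith)

end ProphetSecretary

end

theorem theorem3 (k : ℕ) (hk : 1 ≤ k) :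
    -- the guarantee
    (∀ (n : ℕ) (F : Fin n → Measure ℝ≥0) [∀ i, IsProbabilityMeasure (F i)]
        (π : ProphetSecretary.Policy),
        ProphetSecretary.expectedDemand F π = (k : ℝ≥0∞) →
        ENNReal.ofReal (min (ProphetSecretary.gam k) ((k : ℝ) / ((k : ℝ) + 1))) *
            ProphetSecretary.prophetValue k F ≤
          ProphetSecretary.performance k F π) ∧
    -- which of the two terms is the minimum
    (k ≤ 4 → min (ProphetSecretary.gam k) ((k : ℝ) / ((k : ℝ) + 1)) = (k : ℝ) / ((k : ℝ) + 1)) ∧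
    (4 < k → min (ProphetSecretary.gam k) ((k : ℝ) / ((k : ℝ) + 1)) = ProphetSecretary.gam k) ∧
    -- the first example: no static threshold policy does better than `γ_k`
    (∀ δ : ℝ, 0 < δ → ∃ N : ℕ, ∀ n : ℕ, N ≤ n →
        (∃ π : ProphetSecretary.Policy,
          ProphetSecretary.expectedDemand (ProphetSecretary.exampleOne k n) π = (k : ℝ≥0∞)) ∧
        ∀ π : ProphetSecretary.Policy,
          ProphetSecretary.performance k (ProphetSecretary.exampleOne k n) π <
            ENNReal.ofReal (ProphetSecretary.gam k + δ) *
              ProphetSecretary.prophetValue k (ProphetSecretary.exampleOne k n)) ∧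
    -- the second example: with expected demand `k` one does not do better than `k / (k + 1)`
    (∀ δ : ℝ, 0 < δ → ∃ ε₀ : ℝ, 0 < ε₀ ∧ ∀ ε : I, 0 < (ε : ℝ) → (ε : ℝ) < ε₀ →
        ProphetSecretary.expectedDemand (ProphetSecretary.exampleTwo k ε) ⟨0, 0⟩ = (k : ℝ≥0∞) ∧
        ∀ π : ProphetSecretary.Policy,
          ProphetSecretary.expectedDemand (ProphetSecretary.exampleTwo k ε) π = (k : ℝ≥0∞) →
          ProphetSecretary.performance k (ProphetSecretary.exampleTwo k ε) π <
            ENNReal.ofReal ((k : ℝ) / ((k : ℝ) + 1) + δ) *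
              ProphetSecretary.prophetValue k (ProphetSecretary.exampleTwo k ε)) ∧
    -- tightness: expected demand `k` guarantees no larger fraction
    (∀ c : ℝ,
        (∀ (n : ℕ) (F : Fin n → Measure ℝ≥0) [∀ i, IsProbabilityMeasure (F i)]
          (π : ProphetSecretary.Policy), k < n →
          ProphetSecretary.expectedDemand F π = (k : ℝ≥0∞) →
          ENNReal.ofReal c * ProphetSecretary.prophetValue k F ≤
            ProphetSecretary.performance k F π) →
        c ≤ min (ProphetSecretary.gam k) ((k : ℝ) / ((k : ℝ) + 1))) ∧
    -- optimality for `k > 4`: no choice of static thresholds guarantees a larger fraction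
    (4 < k → ∀ c : ℝ,
        (∀ (n : ℕ) (F : Fin n → Measure ℝ≥0) [∀ i, IsProbabilityMeasure (F i)], k < n →
          ∃ π : ProphetSecretary.Policy,
            ENNReal.ofReal c * ProphetSecretary.prophetValue k F ≤
              ProphetSecretary.performance k F π) →
        c ≤ min (ProphetSecretary.gam k) ((k : ℝ) / ((k : ℝ) + 1))) := by

  have hmin_small : k ≤ 4 → min (ProphetSecretary.gam k) ((k : ℝ) / ((k : ℝ) + 1)) =
      (k : ℝ) / ((k : ℝ) + 1) := fun h => min_eq_right (ProphetSecretary.div_le_gam hk h)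
  have hmin_large : 4 < k → min (ProphetSecretary.gam k) ((k : ℝ) / ((k : ℝ) + 1)) =
      ProphetSecretary.gam k := fun h => min_eq_left (ProphetSecretary.gam_le_div h)
  refine ⟨fun n F _ π hd => ProphetSecretary.guarantee hk F π hd, hmin_small, hmin_large,
    fun δ hδ => ProphetSecretary.exampleOne_bound hk hδ,
    fun δ hδ => ProphetSecretary.exampleTwo_bound hk hδ, fun c hc => le_min ?_ ?_,
    fun h c hc => ?_⟩
  · refine le_of_forall_pos_le_add fun δ hδ => ?_
    obtain ⟨N, hN⟩ := ProphetSecretary.exampleOne_bound hk hδ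
    -- The maximum with k + 1 secures more than k applicants.
    obtain ⟨⟨π, hπ⟩, hlt⟩ := hN (max N (k + 1)) (le_max_left _ _)
    exact (ProphetSecretary.lt_of_ofReal_mul_lt
      (hc _ _ π (Nat.lt_of_succ_le (le_max_right _ _)) hπ) (hlt π)).le
  · refine le_of_forall_pos_le_add fun δ hδ => ?_
    obtain ⟨ε₀, hε₀, h⟩ := ProphetSecretary.exampleTwo_bound hk hδ
    obtain ⟨ε, h0, h1⟩ := ProphetSecretary.exists_exampleTwo_parameter hε₀
    obtain ⟨hd, hlt⟩ := h ε h0 h1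
    exact (ProphetSecretary.lt_of_ofReal_mul_lt
      (hc _ _ ⟨0, 0⟩ (Nat.lt_succ_self k) hd) (hlt _ hd)).le
  · rw [hmin_large h]
    refine le_of_forall_pos_le_add fun δ hδ => ?_
    obtain ⟨N, hN⟩ := ProphetSecretary.exampleOne_bound hk hδ
    obtain ⟨_, hlt⟩ := hN (max N (k + 1)) (le_max_left _ _)
    obtain ⟨π, hπ⟩ := hc _ (ProphetSecretary.exampleOne k (max N (k + 1)))
      (Nat.lt_of_succ_le (le_max_right _ _))
    exact (ProphetSecretary.lt_of_ofReal_mul_lt hπ (hlt π)).le
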